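/- **Conventions.** Fix a smooth radial function $\phi:\mathbb R^3\to[0,1]$ supported in the ball of radius $2$ with $\phi=1$ on the unit ball, and put $\psi(\xi)=\phi(\xi)-\phi(2\xi)$, $\psi_j(\xi)=\psi(2^{-j}\xi)$ for $j\in\mathbb Z$. The Littlewood–Paley projection is $\widehat{P_jf}=\psi_j\hat f$, that is, $P_jf=\check\psi_j*f$, where $\hat f(\xi)=\int f(x)e^{-2\pi i x\cdot\xi}\,dx$ and $\check{}$ is the inverse transform. $D^{n}f$ is the collection of all $n$-th order spatial derivatives of $f$, $|D^nf|$ is its Euclidean length, and $\|\cdot\|_q$ is the norm of $L^q(\mathbb R^3)$. Put $$k_0=100,\qquad \sigma=2,\qquad B_{k_0}=\Big(B+1+\frac1{\sqrt{k_0}}\Big)k_0 .$$ **Theorem 7.1.** There is a constant $C>0$ (universal, once $\phi$ is fixed) such that the following holds. Let $u_0:\mathbb R^3\to\mathbb R^3$ be smooth with $|\partial^\alpha u_0(x)|\le C_{\alpha K}(1+|x|)^{-K}$ on $\mathbb R^3$ for all $\alpha$ and $K$. Then there is $\tilde B_2>1$, depending only on $u_0$ (and $\phi$), such that for all real numbers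 $\nu>0$, $T>0$, $0\le T'\le T$, $\mathcal B>1$, $B>1$ with $B\ge\tilde B_2$, and all $u$ (vector valued) and $p$ (scalar) with $u,p\in C^1\big([0,T],W^{m,2}(\mathbb R^3)\cap W^{m,\infty}(\mathbb R^3)\big)$ for every integer $m\ge1$ and $$u_t-\nu\Delta u+(u\cdot\nabla)u+\nabla p=0,\qquad \operatorname{div}u=0\quad\text{on }\mathbb R^3\times[0,T],\qquad u(\cdot,0)=u_0,$$ the following implication is true. If $$\sum_{j=1}^\infty\|D^{\sigma}P_ju(t)\|_{k_0}^{k_0}\le\mathcal B\,2^{B_{k_0}}\qquad\text{for all }0\le t\le T',$$ then, for all $0\le t\le T'$, $$\sum_{j=1}^\infty\|D^{\sigma+1}P_ju(t)\|_{k_0}^{k_0}\le C\Big(1+\frac1\nu\Big)^{k_0+1}(1+T)\,(1+\|u_0\|_2)^{2k_0+2}\;\mathcal B^{\,1+\frac{5(k_0+2)/2}{(\sigma+3/2)k_0-3}}\;2^{\frac{5(k_0+2)B/2}{\sigma+3/2-3/k_0}}\;2^{B_{k_0}} .$$ -/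

import Mathlib

open MeasureTheory Filter Topology
open scoped ENNReal ContDiff FourierTransform SchwartzMap

namespace NSReg

noncomputable section

/-- Three-dimensional Euclidean space. -/
abbrev E3 : Type := EuclideanSpace ℝ (Fin 3)

/-! ### Littlewood-Paley projections -/

/-- The cutoffs from which the decomposition is built: smooth, radial, with values in `[0, 1]`,
equal to one on the unit ball and supported in the ball of radius two. -/
structure IsCutoff (φ : E3 → ℝ) : Prop where
  smooth : ContDiff ℝ ∞ φ
  radial : ∀ ξ η : E3, ‖ξ‖ = ‖η‖ → φ ξ = φ η
  nonneg : ∀ ξ, 0 ≤ φ ξ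
  le_one : ∀ ξ, φ ξ ≤ 1
  eq_one : ∀ ξ, ‖ξ‖ ≤ 1 → φ ξ = 1
  supp : ∀ ξ, 2 < ‖ξ‖ → φ ξ = 0

/-- `ψ_j(ξ) = ψ(2^{-j} ξ)` with `ψ(ξ) = φ(ξ) - φ(2 ξ)`. -/
def psi (φ : E3 → ℝ) (j : ℤ) (ξ : E3) : ℝ :=
  φ ((2 : ℝ) ^ (-j) • ξ) - φ ((2 : ℝ) • (2 : ℝ) ^ (-j) • ξ)

/-- The inverse Fourier transform of `ψ_j`, with the convention `∫ ψ_j(ξ) e^{2π i x·ξ} dξ`.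
It is real valued because `ψ_j` is even, see `lpKernel_ofReal`. -/
def lpKernel (φ : E3 → ℝ) (j : ℤ) (x : E3) : ℝ :=
  (𝓕⁻ (fun ξ : E3 => (psi φ j ξ : ℂ)) x).re

/-- The Littlewood-Paley projection `P_j f`, i.e. the Fourier multiplier with symbol `ψ_j`, written
as the convolution of `f` with the inverse Fourier transform of `ψ_j`. This form makes sense for
every `f` in some `L^q`; the multiplier identity is `fourier_lpProj`. -/
def lpProj {F : Type*} [NormedAddCommGroup F] [NormedSpace ℝ F]
    (φ : E3 → ℝ) (j : ℤ) (f : E3 → F) (x : E3) : F :=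
  ∫ y, lpKernel φ j y • f (x - y)

theorem psi_neg {φ : E3 → ℝ} (hφ : IsCutoff φ) (j : ℤ) (ξ : E3) :
    psi φ j (-ξ) = psi φ j ξ := by
  unfold psi
  rw [hφ.radial ((2 : ℝ) ^ (-j) • -ξ) ((2 : ℝ) ^ (-j) • ξ) (by simp [norm_smul]),
    hφ.radial ((2 : ℝ) • (2 : ℝ) ^ (-j) • -ξ) ((2 : ℝ) • (2 : ℝ) ^ (-j) • ξ)
      (by simp [norm_smul])]

theorem psi_contDiff {φ : E3 → ℝ} (hφ : IsCutoff φ) (j : ℤ) : ContDiff ℝ ∞ (psi φ j) := by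
  unfold psi
  have := hφ.smooth
  exact (this.comp (by fun_prop)).sub (this.comp (by fun_prop))

theorem psi_hasCompactSupport {φ : E3 → ℝ} (hφ : IsCutoff φ) (j : ℤ) :
    HasCompactSupport (psi φ j) := by
  refine HasCompactSupport.of_support_subset_isCompact
    (isCompact_closedBall (0 : E3) (2 * (2 : ℝ) ^ j)) ?_
  intro ξ hξ
  by_contra h
  apply hξ
  have h2 : (0 : ℝ) < (2 : ℝ) ^ j := by positivity
  have h1 : 2 * (2 : ℝ) ^ j < ‖ξ‖ := by simpa using h
  have h3 : 2 < ((2 : ℝ) ^ j)⁻¹ * ‖ξ‖ := by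
    rw [inv_mul_eq_div, lt_div_iff₀ h2]; exact h1
  unfold psi
  rw [hφ.supp _ (by simpa [norm_smul] using h3), hφ.supp _ (by
    simp only [norm_smul, zpow_neg, norm_inv, norm_zpow, Real.norm_ofNat]
    linarith)]
  simp

theorem psi_ofReal_contDiff {φ : E3 → ℝ} (hφ : IsCutoff φ) (j : ℤ) :
    ContDiff ℝ ∞ (fun ξ : E3 => (psi φ j ξ : ℂ)) :=
  Complex.ofRealCLM.contDiff.comp (psi_contDiff hφ j)

theorem psi_ofReal_hasCompactSupport {φ : E3 → ℝ} (hφ : IsCutoff φ) (j : ℤ) :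
    HasCompactSupport (fun ξ : E3 => (psi φ j ξ : ℂ)) :=
  (psi_hasCompactSupport hφ j).comp_left (g := fun r : ℝ => (r : ℂ)) (by simp)

theorem lpKernel_ofReal {φ : E3 → ℝ} (hφ : IsCutoff φ) (j : ℤ) (x : E3) :
    ((lpKernel φ j x : ℝ) : ℂ) = 𝓕⁻ (fun ξ : E3 => (psi φ j ξ : ℂ)) x := by
  unfold lpKernel
  rw [← Complex.conj_eq_iff_re, Real.fourierInv_eq', ← integral_conj,
    ← integral_neg_eq_self]
  congr 1
  ext ξ
  simp only [smul_eq_mul, map_mul, Complex.conj_ofReal, psi_neg hφ, inner_neg_left]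
  rw [← Complex.exp_conj]
  congr 2
  simp [Complex.conj_ofNat]

theorem fourier_lpProj {φ : E3 → ℝ} (hφ : IsCutoff φ) (j : ℤ) {f : E3 → ℝ}
    (hf : Integrable f) (ξ : E3) :
    𝓕 (fun x : E3 => ((lpProj φ j f x : ℝ) : ℂ)) ξ =
      (psi φ j ξ : ℂ) * 𝓕 (fun x : E3 => (f x : ℂ)) ξ := by
  set Ψ : 𝓢(E3, ℂ) :=
    (psi_ofReal_hasCompactSupport hφ j).toSchwartzMap (psi_ofReal_contDiff hφ j) with hΨ
  have hΨc : (Ψ : E3 → ℂ) = fun ξ : E3 => (psi φ j ξ : ℂ) := by ext; simp [hΨ]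
  have hK : (𝓕⁻ Ψ : 𝓢(E3, ℂ)) = (fun x : E3 => ((lpKernel φ j x : ℝ) : ℂ)) := by
    ext x
    rw [lpKernel_ofReal hφ, SchwartzMap.fourierInv_coe, hΨc]
  have key := Real.fourier_smul_convolution_eq (f₁ := (𝓕⁻ Ψ : 𝓢(E3, ℂ)))
    (f₂ := fun x : E3 => (f x : ℂ)) (SchwartzMap.integrable _) hf.ofReal ξ
  have h1 : 𝓕 ((𝓕⁻ Ψ : 𝓢(E3, ℂ)) : E3 → ℂ) = fun ξ : E3 => (psi φ j ξ : ℂ) := by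
    rw [← SchwartzMap.fourier_coe, FourierTransform.fourier_fourierInv_eq, hΨc]
  rw [h1, smul_eq_mul] at key
  rw [← key, hK]
  refine congrArg (fun h : E3 → ℂ => 𝓕 h ξ) (funext fun x => ?_)
  simp only [lpProj, convolution, ContinuousLinearMap.lsmul_apply, smul_eq_mul]
  rw [← integral_complex_ofReal]
  congr 1
  ext y
  simp

/-! ### Derivatives and the dyadic sums -/

/-- The classical partial derivative `∂_{s 0} ⋯ ∂_{s (n-1)} f`. -/
def partialD {F : Type*} [NormedAddCommGroup F] [NormedSpace ℝ F]
    {n : ℕ} (s : Fin n → Fin 3) (f : E3 → F) (x : E3) : F :=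
  iteratedFDeriv ℝ n f x (fun i => EuclideanSpace.single (s i) (1 : ℝ))

/-- `|D^n f(x)|`, the Euclidean length of the vector of all `n`-th order partial derivatives. -/
def derivNorm {F : Type*} [NormedAddCommGroup F] [NormedSpace ℝ F]
    (n : ℕ) (f : E3 → F) (x : E3) : ℝ :=
  √(∑ s : Fin n → Fin 3, ‖partialD s f x‖ ^ 2)

/-- `∑_{j ≥ 1} ‖D^σ P_j f‖_k^k`, with values in `[0, ∞]`. -/
def dyadicSum {F : Type*} [NormedAddCommGroup F] [NormedSpace ℝ F]
    (φ : E3 → ℝ) (σ k : ℕ) (f : E3 → F) : ℝ≥0∞ :=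
  ∑' j : ℕ, eLpNorm (derivNorm σ (lpProj φ ((j : ℤ) + 1) f)) (k : ℝ≥0∞) volume ^ k

/-- `B_k = (B + 1 + 1/√k) k`. -/
def powB (B : ℝ) (k : ℕ) : ℝ := (B + 1 + 1 / √(k : ℝ)) * k

/-! ### Sobolev spaces and their `C¹` curves -/

/-- `g` is the weak derivative `∂_{s 0} ⋯ ∂_{s (n-1)} f` on the whole space. -/
def HasWeakDeriv {F : Type*} [NormedAddCommGroup F] [NormedSpace ℝ F]
    {n : ℕ} (s : Fin n → Fin 3) (f g : E3 → F) : Prop :=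
  LocallyIntegrable f ∧ LocallyIntegrable g ∧
    ∀ θ : E3 → ℝ, ContDiff ℝ ∞ θ → HasCompactSupport θ →
      ∫ x, partialD s θ x • f x = (-1 : ℝ) ^ n • ∫ x, θ x • g x

open Classical in
/-- A representative of the weak derivative (unique almost everywhere), zero if there is none. -/
def weakDeriv {F : Type*} [NormedAddCommGroup F] [NormedSpace ℝ F]
    {n : ℕ} (s : Fin n → Fin 3) (f : E3 → F) : E3 → F :=
  if h : ∃ g, HasWeakDeriv s f g then h.choose else 0

/-- `f ∈ W^{m,q}`: all weak derivatives of order at most `m` exist and lie in `L^q`. -/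
def MemW {F : Type*} [NormedAddCommGroup F] [NormedSpace ℝ F]
    (m : ℕ) (q : ℝ≥0∞) (f : E3 → F) : Prop :=
  ∀ n ≤ m, ∀ s : Fin n → Fin 3, ∃ g, HasWeakDeriv s f g ∧ MemLp g q volume

/-- The norm of `W^{m,q}`. -/
def normW {F : Type*} [NormedAddCommGroup F] [NormedSpace ℝ F]
    (m : ℕ) (q : ℝ≥0∞) (f : E3 → F) : ℝ≥0∞ :=
  ∑ n ∈ Finset.range (m + 1), ∑ s : Fin n → Fin 3, eLpNorm (weakDeriv s f) q volume

/-- `u ∈ C¹([0,T], W^{m,q})` with time derivative `v` (one-sided at the two ends). -/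
structure IsC1W {F : Type*} [NormedAddCommGroup F] [NormedSpace ℝ F]
    (T : ℝ) (m : ℕ) (q : ℝ≥0∞) (u v : ℝ → E3 → F) : Prop where
  mem : ∀ t ∈ Set.Icc 0 T, MemW m q (u t)
  mem_deriv : ∀ t ∈ Set.Icc 0 T, MemW m q (v t)
  hasDeriv : ∀ t ∈ Set.Icc 0 T,
    Tendsto (fun s => normW m q (fun x => (s - t)⁻¹ • (u s x - u t x) - v t x))
      (𝓝[Set.Icc 0 T \ {t}] t) (𝓝 0)
  cont_deriv : ∀ t ∈ Set.Icc 0 T,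
    Tendsto (fun s => normW m q (fun x => v s x - v t x)) (𝓝[Set.Icc 0 T] t) (𝓝 0)

/-- `u ∈ C¹([0,T], W^{m,2} ∩ W^{m,∞})` for every integer `m ≥ 1`, with time derivative `v`. -/
def IsC1AllW {F : Type*} [NormedAddCommGroup F] [NormedSpace ℝ F]
    (T : ℝ) (u v : ℝ → E3 → F) : Prop :=
  ∀ m : ℕ, 1 ≤ m → IsC1W T m 2 u v ∧ IsC1W T m ∞ u v

/-! ### The Navier-Stokes equations -/

/-- At one time, `u_t - ν Δu + (u·∇)u + ∇p = 0` and `div u = 0`, where `v` stands for `u_t`. -/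
def NavierStokesAt (ν : ℝ) (u v : E3 → E3) (p : E3 → ℝ) : Prop :=
  (∀ᵐ x, ∀ i : Fin 3,
    v x i - ν * (∑ a : Fin 3, weakDeriv ![a, a] u x i)
      + (∑ a : Fin 3, u x a * weakDeriv ![a] u x i) + weakDeriv ![i] p x = 0) ∧
  ∀ᵐ x, ∑ a : Fin 3, weakDeriv ![a] u x a = 0

/-- The regularity class of the solutions: `u` and `p` are `C¹` in time on `[0,T]` with values in
all Sobolev spaces `W^{m,2} ∩ W^{m,∞}`, and they solve the unforced Navier-Stokes equations with
viscosity `ν` and initial value `u₀`. -/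
def IsRegularSolution (ν T : ℝ) (u₀ : E3 → E3) (u : ℝ → E3 → E3) (p : ℝ → E3 → ℝ) : Prop :=
  ∃ (ut : ℝ → E3 → E3) (pt : ℝ → E3 → ℝ),
    IsC1AllW T u ut ∧ IsC1AllW T p pt ∧
    (∀ t ∈ Set.Icc 0 T, NavierStokesAt ν (u t) (ut t) (p t)) ∧
    u 0 =ᵐ[volume] u₀

end

end NSReg

/-! Write A for the assumed bound on the sum of the hundredth powers of the norms of D²P_j u, and E
for the L² norm of the initial data. By Bernstein, the hypothesis says that the L^100 norm of P_j u
is at most a constant times 4^{-j} δ_j, where the δ_j^100 sum to at most A. The goal is the same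
with 8^{-j} and a larger sum. The additional derivative comes from viscosity, one frequency band at
a time.

Sup bound. The energy inequality and Bernstein give |P_j u| ≲ 4^j E, while the hypothesis gives |P_j
u| ≲ 2^{-j} A^{1/100}. The geometric mean with weights 3/10 and 7/10 decays like 2^{-j/10}, so it
sums to |u| ≤ R with R ~ (1+E) A^{7/1000} (`abs_le_of_nm_lp_le`).

Smoothing of one band. In the time derivative of the integral of (P_j u_i)^100 the viscous term is
at least of order ν 4^j times that integral (`dissipation`). The pressure disappears under the Leray
projection, and the transport term has L^100 norm at most of order 2^j R W, where W measures the
part of u above frequency 2^{j-3}: a product of two lower-frequency factors does not reach the band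
(`nm_bilinear_le`). A barrier argument bounds P_j u(t) by the maximum of its initial size and a
multiple of R W / (ν 2^j) (`Classical.nm_lp_le`). Decay r^{-j} therefore improves to (2r)^{-j} at
the price of a factor K ~ (1+1/ν) R, provided the data decay that fast (`Classical.gain_one`). Two
passes lead from 4^{-j} to 16^{-j} at the price of K².

Summation. A bound 8^{-j} uniform in j would not be summable after three derivatives. Instead the
hypothesis itself is used where 2^j ≤ K, and the 16^{-j} bound where 2^j > K. The hundredth powers
then sum to a multiple of K^101 A (`exists_interpolation`). This K^101 carries (1+1/ν)^101,
(1+E)^101 and A^{707/1000}, and 707/1000 is below the exponent 255/347 allowed by the statement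
(`rpow_absorb_le`). The factor 1+T and the remaining powers of 1+E are slack. The threshold on B
serves only to make the data term smaller than A^{1/100}. -/

namespace NSReg

open scoped LineDeriv

noncomputable section

/-! ### Smooth scalar functions with bounded, square integrable derivatives -/

/-- The coordinate partial derivative `∂_a f`. -/
def pd (a : Fin 3) (f : E3 → ℝ) (x : E3) : ℝ := fderiv ℝ f x (EuclideanSpace.single a 1)

/-- Continuous, bounded and square integrable functions. -/
structure BL2 (f : E3 → ℝ) : Prop where
  cont : Continuous f
  bdd : ∃ C, ∀ x, |f x| ≤ C
  memLp : MemLp f 2 volume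

/-- `n` times differentiable functions with partial derivatives up to order `n` in `BL2`. -/
def Reg : ℕ → (E3 → ℝ) → Prop
  | 0, f => BL2 f
  | n + 1, f => BL2 f ∧ Differentiable ℝ f ∧ ∀ a, Reg n (pd a f)

/-- Smooth functions all of whose partial derivatives are bounded and square integrable. -/
def Sm (f : E3 → ℝ) : Prop := ∀ n, Reg n f

/-- Convolution of scalar functions. -/
def cv (K f : E3 → ℝ) (x : E3) : ℝ := ∫ y, K y * f (x - y)

theorem BL2.integrable_mul {f g : E3 → ℝ} (hf : BL2 f) (hg : BL2 g) :
    Integrable (fun x => f x * g x) :=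
  hf.memLp.integrable_mul hg.memLp

theorem BL2.add {f g : E3 → ℝ} (hf : BL2 f) (hg : BL2 g) : BL2 (fun x => f x + g x) := by
  obtain ⟨C, hC⟩ := hf.bdd
  obtain ⟨D, hD⟩ := hg.bdd
  exact ⟨hf.cont.add hg.cont, ⟨C + D, fun x => (abs_add_le _ _).trans (add_le_add (hC x) (hD x))⟩,
    hf.memLp.add hg.memLp⟩

theorem BL2.mul {f g : E3 → ℝ} (hf : BL2 f) (hg : BL2 g) : BL2 (fun x => f x * g x) := by
  obtain ⟨C, hC⟩ := hf.bdd
  obtain ⟨D, hD⟩ := hg.bdd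
  refine ⟨hf.cont.mul hg.cont, ⟨C * D, fun x => ?_⟩, ?_⟩
  · rw [abs_mul]
    exact mul_le_mul (hC x) (hD x) (abs_nonneg _) ((abs_nonneg _).trans (hC x))
  · refine MemLp.of_le_mul (c := C) hg.memLp (hf.cont.mul hg.cont).aestronglyMeasurable
      (Eventually.of_forall fun x => ?_)
    rw [norm_mul]
    exact mul_le_mul_of_nonneg_right (hC x) (norm_nonneg _)

theorem BL2.const_mul {f : E3 → ℝ} (hf : BL2 f) (c : ℝ) : BL2 (fun x => c * f x) := by
  obtain ⟨C, hC⟩ := hf.bdd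
  refine ⟨continuous_const.mul hf.cont, ⟨|c| * C, fun x => ?_⟩, hf.memLp.const_mul c⟩
  rw [abs_mul]
  exact mul_le_mul_of_nonneg_left (hC x) (abs_nonneg _)

theorem Reg.bl2 {n : ℕ} {f : E3 → ℝ} (hf : Reg n f) : BL2 f := by
  cases n with
  | zero => exact hf
  | succ n => exact hf.1

theorem pd_add {f g : E3 → ℝ} (hf : Differentiable ℝ f) (hg : Differentiable ℝ g) (a : Fin 3) :
    pd a (fun x => f x + g x) = fun x => pd a f x + pd a g x := by
  ext x
  simp [pd, fderiv_fun_add (hf x) (hg x)]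

theorem pd_const_mul {f : E3 → ℝ} (hf : Differentiable ℝ f) (c : ℝ) (a : Fin 3) :
    pd a (fun x => c * f x) = fun x => c * pd a f x := by
  ext x
  simp [pd, fderiv_const_mul (hf x)]

theorem pd_mul {f g : E3 → ℝ} (hf : Differentiable ℝ f) (hg : Differentiable ℝ g) (a : Fin 3) :
    pd a (fun x => f x * g x) = fun x => f x * pd a g x + pd a f x * g x := by
  ext x
  simp [pd, fderiv_fun_mul (hf x) (hg x), mul_comm]

theorem pd_pow {f : E3 → ℝ} (hf : Differentiable ℝ f) (n : ℕ) (a : Fin 3) :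
    pd a (fun x => f x ^ n) = fun x => n * f x ^ (n - 1) * pd a f x := by
  ext x
  simp [pd, fderiv_fun_pow n (hf x)]

theorem Reg.add {n : ℕ} {f g : E3 → ℝ} (hf : Reg n f) (hg : Reg n g) :
    Reg n (fun x => f x + g x) := by
  induction n generalizing f g with
  | zero => exact BL2.add hf hg
  | succ n ih =>
    refine ⟨hf.1.add hg.1, hf.2.1.add hg.2.1, fun a => ?_⟩
    rw [pd_add hf.2.1 hg.2.1]
    exact ih (hf.2.2 a) (hg.2.2 a)

theorem Reg.const_mul {n : ℕ} {f : E3 → ℝ} (hf : Reg n f) (c : ℝ) :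
    Reg n (fun x => c * f x) := by
  induction n generalizing f with
  | zero => exact BL2.const_mul hf c
  | succ n ih =>
    refine ⟨hf.1.const_mul c, hf.2.1.const_mul c, fun a => ?_⟩
    rw [pd_const_mul hf.2.1]
    exact ih (hf.2.2 a)

theorem Reg.of_succ {n : ℕ} {f : E3 → ℝ} (hf : Reg (n + 1) f) : Reg n f := by
  induction n generalizing f with
  | zero => exact hf.1
  | succ n ih => exact ⟨hf.1, hf.2.1, fun a => ih (hf.2.2 a)⟩

theorem Reg.mul {n : ℕ} {f g : E3 → ℝ} (hf : Reg n f) (hg : Reg n g) :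
    Reg n (fun x => f x * g x) := by
  induction n generalizing f g with
  | zero => exact BL2.mul hf hg
  | succ n ih =>
    refine ⟨hf.1.mul hg.1, hf.2.1.mul hg.2.1, fun a => ?_⟩
    rw [pd_mul hf.2.1 hg.2.1]
    exact (ih hf.of_succ (hg.2.2 a)).add (ih (hf.2.2 a) hg.of_succ)

theorem Sm.bl2 {f : E3 → ℝ} (hf : Sm f) : BL2 f := (hf 0).bl2
theorem Sm.cont {f : E3 → ℝ} (hf : Sm f) : Continuous f := hf.bl2.cont
theorem Sm.diff {f : E3 → ℝ} (hf : Sm f) : Differentiable ℝ f := (hf 1).2.1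
theorem Sm.pd {f : E3 → ℝ} (hf : Sm f) (a : Fin 3) : Sm (pd a f) := fun n => (hf (n + 1)).2.2 a
theorem Sm.add {f g : E3 → ℝ} (hf : Sm f) (hg : Sm g) : Sm (fun x => f x + g x) :=
  fun n => (hf n).add (hg n)
theorem Sm.mul {f g : E3 → ℝ} (hf : Sm f) (hg : Sm g) : Sm (fun x => f x * g x) :=
  fun n => (hf n).mul (hg n)
theorem Sm.const_mul {f : E3 → ℝ} (hf : Sm f) (c : ℝ) : Sm (fun x => c * f x) :=
  fun n => (hf n).const_mul c
theorem Sm.neg {f : E3 → ℝ} (hf : Sm f) : Sm (fun x => -f x) := by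
  simpa using hf.const_mul (-1)
theorem Sm.sub {f g : E3 → ℝ} (hf : Sm f) (hg : Sm g) : Sm (fun x => f x - g x) := by
  simpa [sub_eq_add_neg] using hf.add hg.neg
theorem Sm.sum {f : Fin 3 → E3 → ℝ} (hf : ∀ a, Sm (f a)) : Sm (fun x => ∑ a, f a x) := by
  simp only [Fin.sum_univ_three]
  exact ((hf 0).add (hf 1)).add (hf 2)
theorem Sm.pow {f : E3 → ℝ} (hf : Sm f) {n : ℕ} (hn : n ≠ 0) : Sm (fun x => f x ^ n) := by
  induction n with
  | zero => exact absurd rfl hn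
  | succ n ih =>
    rcases eq_or_ne n 0 with rfl | h
    · simpa using hf
    · simpa only [pow_succ] using (ih h).mul hf
theorem Sm.integrable_mul {f g : E3 → ℝ} (hf : Sm f) (hg : Sm g) :
    Integrable (fun x => f x * g x) := hf.bl2.integrable_mul hg.bl2

theorem Sm.integrable_pow {f : E3 → ℝ} (hf : Sm f) {n : ℕ} (hn : 2 ≤ n) :
    Integrable (fun x => f x ^ n) := by
  obtain ⟨m, rfl⟩ := Nat.exists_eq_add_of_le hn
  have := (hf.pow (n := m + 1) (by omega)).integrable_mul hf
  refine this.congr (Eventually.of_forall fun x => ?_)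
  simp only; ring

theorem pd_sum {f : Fin 3 → E3 → ℝ} (hf : ∀ b, Differentiable ℝ (f b)) (a : Fin 3) :
    pd a (fun x => ∑ b, f b x) = fun x => ∑ b, pd a (f b) x := by
  ext x
  simp [pd, fderiv_fun_sum (fun b _ => hf b x)]

theorem pd_zero (a : Fin 3) : pd a (fun _ => 0) = fun _ => 0 := by
  ext x; simp [pd]

/-- There are no boundary terms: the product and both mixed products are integrable, which is all
that integration by parts on the whole space requires. -/
theorem integral_mul_pd {f g : E3 → ℝ} (hf : Sm f) (hg : Sm g) (a : Fin 3) :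
    ∫ x, f x * pd a g x = -∫ x, pd a f x * g x :=
  integral_mul_fderiv_eq_neg_fderiv_mul_of_integrable ((hf.pd a).integrable_mul hg)
    (hf.integrable_mul (hg.pd a)) (hf.integrable_mul hg) (fun x _ => hf.diff x)
    (fun x _ => hg.diff x)

theorem fderiv_eq_sum_pd (f : E3 → ℝ) (x y : E3) : fderiv ℝ f x y = ∑ a, y a * pd a f x := by
  have hy : y = ∑ a, y a • EuclideanSpace.single a (1 : ℝ) := by
    ext i
    simp [Finset.sum_apply, Pi.single_apply]
  conv_lhs => rw [hy]
  simp [pd]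

theorem Reg.contDiff {n : ℕ} {f : E3 → ℝ} (hf : Reg n f) : ContDiff ℝ n f := by
  induction n generalizing f with
  | zero => exact contDiff_zero.2 hf.bl2.cont
  | succ n ih =>
    rw [Nat.cast_add, Nat.cast_one, contDiff_succ_iff_fderiv_apply]
    refine ⟨hf.2.1, by simp, fun y => ?_⟩
    simp_rw [fderiv_eq_sum_pd]
    exact ContDiff.sum fun a _ => contDiff_const.mul (ih (hf.2.2 a))

theorem Sm.contDiff {f : E3 → ℝ} (hf : Sm f) : ContDiff ℝ ∞ f :=
  contDiff_infty.2 fun n => (hf n).contDiff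

theorem Sm.pd_comm {f : E3 → ℝ} (hf : Sm f) (a b : Fin 3) :
    NSReg.pd a (NSReg.pd b f) = NSReg.pd b (NSReg.pd a f) := by
  ext x
  have h2 : ContDiff ℝ 2 f := by exact_mod_cast (hf 2).contDiff
  have hd : Differentiable ℝ (fderiv ℝ f) :=
    (h2.fderiv_right (m := 1) (by norm_num)).differentiable (by norm_num)
  have key : ∀ v w : E3, fderiv ℝ (fun y => fderiv ℝ f y v) x w = fderiv ℝ (fderiv ℝ f) x w v := by
    intro v w
    rw [fderiv_clm_apply (hd x) (differentiableAt_const v)]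
    simp
  have hs := (h2.contDiffAt (x := x)).isSymmSndFDerivAt (by simp)
  change fderiv ℝ (fun y => fderiv ℝ f y _) x _ = fderiv ℝ (fun y => fderiv ℝ f y _) x _
  rw [key, key]
  exact hs _ _

theorem schwartz_pd (K : 𝓢(E3, ℝ)) (a : Fin 3) :
    pd a K = (∂_{(EuclideanSpace.single a (1 : ℝ) : E3)} K : 𝓢(E3, ℝ)) := by
  ext x
  rw [SchwartzMap.lineDerivOp_apply_eq_fderiv]
  rfl

theorem schwartz_bl2 (K : 𝓢(E3, ℝ)) : BL2 K :=
  ⟨K.continuous, ⟨_, fun x => SchwartzMap.norm_le_seminorm ℝ K x⟩, K.memLp 2 volume⟩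

theorem schwartz_sm (K : 𝓢(E3, ℝ)) : Sm K := by
  intro n
  induction n generalizing K with
  | zero => exact schwartz_bl2 K
  | succ n ih =>
    refine ⟨schwartz_bl2 K, K.differentiable, fun a => ?_⟩
    rw [schwartz_pd]
    exact ih _

/-! ### Convolution -/

/-- Hölder with exponents 1 - 1/p and 1/p applied to k g = k^{1-1/p} (k g^p)^{1/p}. Keeping the
weight inside the last integral lets the same inequality serve Young's inequality and the pointwise
bounds by the supremum of the kernel. -/
theorem lintegral_mul_rpow_le {α : Type*} [MeasurableSpace α] {μ : Measure α} {k g : α → ℝ≥0∞}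
    (hk : AEMeasurable k μ) (hg : AEMeasurable g μ) {p : ℝ} (hp : 1 ≤ p) (hkt : ∀ x, k x ≠ ⊤) :
    (∫⁻ x, k x * g x ∂μ) ^ p ≤ (∫⁻ x, k x ∂μ) ^ (p - 1) * ∫⁻ x, k x * g x ^ p ∂μ := by
  have hp0 : 0 < p := by linarith
  have h := ENNReal.lintegral_mul_norm_pow_le (μ := μ) (f := k) (g := fun x => k x * g x ^ p)
    hk (hk.mul (hg.pow_const p)) (p := 1 - 1 / p) (q := 1 / p)
    (by rw [sub_nonneg, div_le_one hp0]; exact hp) (by positivity) (by ring)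
  have e : ∀ x, k x ^ (1 - 1 / p) * (k x * g x ^ p) ^ (1 / p) = k x * g x := by
    intro x
    rw [ENNReal.mul_rpow_of_nonneg _ _ (by positivity), ← ENNReal.rpow_mul, mul_one_div_cancel hp0.ne',
      ENNReal.rpow_one, ← mul_assoc]
    rcases eq_or_ne (k x) 0 with h0 | h0
    · rw [h0, ENNReal.zero_rpow_of_pos (y := 1 / p) (by positivity)]; simp
    · rw [← ENNReal.rpow_add _ _ h0 (hkt x)]; simp
  simp_rw [e] at h
  have := ENNReal.rpow_le_rpow h hp0.le
  rwa [ENNReal.mul_rpow_of_nonneg _ _ hp0.le, ← ENNReal.rpow_mul, ← ENNReal.rpow_mul,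
    one_div_mul_cancel hp0.ne', ENNReal.rpow_one, sub_mul, one_mul, one_div_mul_cancel hp0.ne'] at this

/-- Young's inequality `‖K * f‖_p ≤ ‖K‖_1 ‖f‖_p`. -/
theorem eLpNorm_cv_le {K f : E3 → ℝ} (hK : AEStronglyMeasurable K volume)
    (hf : AEStronglyMeasurable f volume) {p : ℝ≥0∞} (hp : 1 ≤ p) (hpt : p ≠ ⊤) :
    eLpNorm (cv K f) p volume ≤ eLpNorm K 1 volume * eLpNorm f p volume := by
  have hp0 : p ≠ 0 := (zero_lt_one.trans_le hp).ne'
  have hp1 : 1 ≤ p.toReal := by simpa using ENNReal.toReal_mono hpt hp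
  have hp2 : 0 < p.toReal := by linarith
  have hm : AEMeasurable (fun q : E3 × E3 => ‖K q.2‖ₑ * ‖f (q.1 - q.2)‖ₑ ^ p.toReal)
      (volume.prod volume) := by
    refine AEMeasurable.mul ?_ (AEMeasurable.pow_const ?_ _)
    · exact (hK.comp_quasiMeasurePreserving Measure.quasiMeasurePreserving_snd).enorm
    · exact (hf.comp_quasiMeasurePreserving (quasiMeasurePreserving_sub volume volume)).enorm
  have hsec : ∀ x, AEStronglyMeasurable (fun y => f (x - y)) volume := fun x =>
    hf.comp_quasiMeasurePreserving (quasiMeasurePreserving_sub_left volume x)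
  have h1 : ∀ x, ‖cv K f x‖ₑ ^ p.toReal ≤ (∫⁻ y, ‖K y‖ₑ) ^ (p.toReal - 1) *
      ∫⁻ y, ‖K y‖ₑ * ‖f (x - y)‖ₑ ^ p.toReal := by
    intro x
    refine le_trans (ENNReal.rpow_le_rpow ?_ hp2.le)
      (lintegral_mul_rpow_le (g := fun y => ‖f (x - y)‖ₑ) hK.enorm (hsec x).enorm hp1 (by simp))
    refine (enorm_integral_le_lintegral_enorm _).trans (le_of_eq ?_)
    simp only [enorm_mul]
  rw [eLpNorm_eq_lintegral_rpow_enorm_toReal hp0 hpt, eLpNorm_eq_lintegral_rpow_enorm_toReal hp0 hpt,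
    eLpNorm_one_eq_lintegral_enorm]
  have h2 : ∫⁻ x, ‖cv K f x‖ₑ ^ p.toReal ≤
      (∫⁻ y, ‖K y‖ₑ) ^ p.toReal * ∫⁻ x, ‖f x‖ₑ ^ p.toReal := by
    calc ∫⁻ x, ‖cv K f x‖ₑ ^ p.toReal
        ≤ ∫⁻ x, (∫⁻ y, ‖K y‖ₑ) ^ (p.toReal - 1) * ∫⁻ y, ‖K y‖ₑ * ‖f (x - y)‖ₑ ^ p.toReal :=
          lintegral_mono h1
      _ = (∫⁻ y, ‖K y‖ₑ) ^ (p.toReal - 1) * ∫⁻ x, ∫⁻ y, ‖K y‖ₑ * ‖f (x - y)‖ₑ ^ p.toReal := by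
          rw [lintegral_const_mul'' _ hm.lintegral_prod_right']
      _ = (∫⁻ y, ‖K y‖ₑ) ^ (p.toReal - 1) * ((∫⁻ y, ‖K y‖ₑ) * ∫⁻ x, ‖f x‖ₑ ^ p.toReal) := by
          rw [lintegral_lintegral_swap hm]
          congr 1
          rw [← lintegral_mul_const'' _ hK.enorm]
          congr 1; ext y
          rw [lintegral_const_mul' _ _ (by simp),
            lintegral_sub_right_eq_self (fun x => ‖f x‖ₑ ^ p.toReal) y]
      _ = _ := by
          rw [← mul_assoc]
          congr 1
          conv_lhs => rw [← ENNReal.rpow_one (∫⁻ y, ‖K y‖ₑ), ← ENNReal.rpow_mul, one_mul]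
          rw [← ENNReal.rpow_add_of_nonneg _ _ (by linarith) zero_le_one]
          simp
  calc _ ≤ ((∫⁻ y, ‖K y‖ₑ) ^ p.toReal * ∫⁻ x, ‖f x‖ₑ ^ p.toReal) ^ (1 / p.toReal) :=
        ENNReal.rpow_le_rpow h2 (by positivity)
    _ = _ := by
        rw [ENNReal.mul_rpow_of_nonneg _ _ (by positivity), ← ENNReal.rpow_mul,
          mul_one_div_cancel hp2.ne', ENNReal.rpow_one]

theorem BL2.integrable_cv {K f : E3 → ℝ} (hK : Integrable K) (hf : BL2 f) (x : E3) :
    Integrable (fun y => K y * f (x - y)) := by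
  obtain ⟨C, hC⟩ := hf.bdd
  exact hK.mul_bdd (c := C) (hf.cont.comp (continuous_const.sub continuous_id)).aestronglyMeasurable
    (Eventually.of_forall fun y => hC _)

theorem abs_cv_le {K f : E3 → ℝ} (hK : Integrable K) {C : ℝ} (hC : ∀ x, |f x| ≤ C) (x : E3) :
    |cv K f x| ≤ (∫ y, |K y|) * C := by
  rw [← integral_mul_const]
  refine norm_integral_le_of_norm_le (f := fun y => K y * f (x - y)) (hK.abs.mul_const C)
    (Eventually.of_forall fun y => ?_)
  rw [norm_mul]
  exact mul_le_mul_of_nonneg_left (hC _) (norm_nonneg _)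

theorem BL2.cv {K f : E3 → ℝ} (hK : Integrable K) (hf : BL2 f) : BL2 (cv K f) := by
  obtain ⟨C, hC⟩ := hf.bdd
  have hc : Continuous (NSReg.cv K f) := by
    refine continuous_of_dominated (bound := fun y => |K y| * C)
      (fun x => (hf.integrable_cv hK x).aestronglyMeasurable)
      (fun x => Eventually.of_forall fun y => ?_) (hK.abs.mul_const C)
      (Eventually.of_forall fun y => ?_)
    · rw [norm_mul]
      exact mul_le_mul_of_nonneg_left (hC _) (norm_nonneg _)
    · exact continuous_const.mul (hf.cont.comp (continuous_id.sub continuous_const))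
  refine ⟨hc, ⟨_, abs_cv_le hK hC⟩, hc.aestronglyMeasurable, ?_⟩
  refine (eLpNorm_cv_le hK.1 hf.memLp.1 (by norm_num) (by norm_num)).trans_lt ?_
  exact ENNReal.mul_lt_top (memLp_one_iff_integrable.2 hK).2 hf.memLp.2

theorem Reg.norm_fderiv_le {f : E3 → ℝ} (hf : Reg 1 f) : ∃ C, ∀ x, ‖fderiv ℝ f x‖ ≤ C := by
  choose C hC using fun a => (hf.2.2 a).bl2.bdd
  refine ⟨∑ a, C a, fun x => ContinuousLinearMap.opNorm_le_bound _
    (Finset.sum_nonneg fun a _ => (abs_nonneg _).trans (hC a 0)) fun y => ?_⟩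
  rw [fderiv_eq_sum_pd, Finset.sum_mul]
  refine (norm_sum_le _ _).trans (Finset.sum_le_sum fun a _ => ?_)
  rw [norm_mul, mul_comm]
  exact mul_le_mul (hC a x) (PiLp.norm_apply_le y a) (norm_nonneg _)
    ((abs_nonneg _).trans (hC a 0))

/-- The derivative falls on `f`, whose gradient is bounded, so the kernel needs only to be
integrable. -/
theorem hasFDerivAt_cv {K f : E3 → ℝ} (hK : Integrable K) (hf : Reg 1 f) (x : E3) :
    HasFDerivAt (cv K f) (∫ y, K y • fderiv ℝ f (x - y)) x := by
  have hcd : ContDiff ℝ 1 f := by exact_mod_cast hf.contDiff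
  have hcf : Continuous (fderiv ℝ f) := hcd.continuous_fderiv (by norm_num)
  obtain ⟨C, hb⟩ := hf.norm_fderiv_le
  refine hasFDerivAt_integral_of_dominated_of_fderiv_le (s := Set.univ)
    (F := fun x y => K y * f (x - y)) (F' := fun x y => K y • fderiv ℝ f (x - y))
    (bound := fun y => |K y| * C) Filter.univ_mem
    (Eventually.of_forall fun x => (hf.bl2.integrable_cv hK x).aestronglyMeasurable)
    (hf.bl2.integrable_cv hK x) ?_ (Eventually.of_forall fun y x _ => ?_)
    (hK.abs.mul_const _) (Eventually.of_forall fun y x _ => ?_)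
  · exact hK.1.smul (hcf.comp (continuous_const.sub continuous_id)).aestronglyMeasurable
  · rw [norm_smul]
    exact mul_le_mul_of_nonneg_left (hb _) (norm_nonneg _)
  · have h1 : HasFDerivAt f (fderiv ℝ f (x - y)) (x - y) := (hf.2.1 _).hasFDerivAt
    have h2 : HasFDerivAt (fun x : E3 => x - y) (ContinuousLinearMap.id ℝ E3) x :=
      (hasFDerivAt_id x).sub_const y
    simpa using (h1.comp x h2).const_mul (K y)

theorem pd_cv_right {K f : E3 → ℝ} (hK : Integrable K) (hf : Reg 1 f) (a : Fin 3) :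
    pd a (cv K f) = cv K (pd a f) := by
  ext x
  have hcd : ContDiff ℝ 1 f := by exact_mod_cast hf.contDiff
  have hcf : Continuous (fderiv ℝ f) := hcd.continuous_fderiv (by norm_num)
  unfold pd
  rw [(hasFDerivAt_cv hK hf x).fderiv]
  by_cases hi : Integrable (fun y => K y • fderiv ℝ f (x - y))
  · rw [ContinuousLinearMap.integral_apply hi]
    rfl
  · exfalso
    apply hi
    obtain ⟨C, hb⟩ := hf.norm_fderiv_le
    exact hK.smul_bdd C
      (hcf.comp (continuous_const.sub continuous_id)).aestronglyMeasurable
      (Eventually.of_forall fun x => hb _)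

theorem Reg.cv {n : ℕ} {K f : E3 → ℝ} (hK : Integrable K) (hf : Reg n f) : Reg n (cv K f) := by
  induction n generalizing f with
  | zero => exact BL2.cv hK hf
  | succ n ih =>
    have h1 : Reg 1 f := ⟨hf.1, hf.2.1, fun a => (hf.2.2 a).bl2⟩
    refine ⟨hf.1.cv hK, fun x => (hasFDerivAt_cv hK h1 x).differentiableAt, fun a => ?_⟩
    rw [pd_cv_right hK h1]
    exact ih (hf.2.2 a)

theorem Sm.cv {K f : E3 → ℝ} (hK : Integrable K) (hf : Sm f) : Sm (cv K f) :=
  fun n => (hf n).cv hK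

theorem Sm.pd_cv {K f : E3 → ℝ} (hK : Integrable K) (hf : Sm f) (a : Fin 3) :
    NSReg.pd a (NSReg.cv K f) = NSReg.cv K (NSReg.pd a f) := pd_cv_right hK (hf 1) a

/-! ### Weak derivatives and smooth representatives -/

theorem partialD_zero {F : Type*} [NormedAddCommGroup F] [NormedSpace ℝ F] (s : Fin 0 → Fin 3)
    (f : E3 → F) : partialD s f = f := by
  ext x
  simp [partialD]

theorem partialD_succ {F : Type*} [NormedAddCommGroup F] [NormedSpace ℝ F] {n : ℕ}
    (s : Fin (n + 1) → Fin 3) {f : E3 → F} (hf : ContDiff ℝ ∞ f) (x : E3) :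
    partialD s f x =
      fderiv ℝ (partialD (Fin.tail s) f) x (EuclideanSpace.single (s 0) 1) := by
  have hd : DifferentiableAt ℝ (iteratedFDeriv ℝ n f) x :=
    (hf.differentiable_iteratedFDeriv (by exact_mod_cast ENat.natCast_lt_top n)) x
  unfold partialD
  rw [iteratedFDeriv_succ_apply_left]
  have := (ContinuousMultilinearMap.apply ℝ (fun _ : Fin n => E3) F
    (fun i => EuclideanSpace.single (Fin.tail s i) (1 : ℝ))).hasFDerivAt.comp x hd.hasFDerivAt
  have h2 := this.fderiv
  have h3 : (⇑(ContinuousMultilinearMap.apply ℝ (fun _ : Fin n => E3) F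
    (fun i => EuclideanSpace.single (Fin.tail s i) (1 : ℝ))) ∘ iteratedFDeriv ℝ n f) =
    fun x => iteratedFDeriv ℝ n f x (fun i => EuclideanSpace.single (Fin.tail s i) (1 : ℝ)) := by
    ext; simp
  rw [h3] at h2
  rw [h2]
  simp only [ContinuousLinearMap.comp_apply, ContinuousMultilinearMap.apply_apply]
  rfl

theorem partialD_succ_real {n : ℕ} (s : Fin (n + 1) → Fin 3) {f : E3 → ℝ} (hf : ContDiff ℝ ∞ f) :
    partialD s f = pd (s 0) (partialD (Fin.tail s) f) := by
  ext x
  exact partialD_succ s hf x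

theorem partialD_one (a : Fin 3) {f : E3 → ℝ} (hf : ContDiff ℝ ∞ f) :
    partialD ![a] f = pd a f := by
  rw [partialD_succ_real _ hf, partialD_zero]; rfl

theorem partialD_two (a b : Fin 3) {f : E3 → ℝ} (hf : ContDiff ℝ ∞ f) :
    partialD ![a, b] f = pd a (pd b f) := by
  rw [partialD_succ_real _ hf, ← partialD_one b hf]; rfl

theorem contDiff_pd {f : E3 → ℝ} (hf : ContDiff ℝ ∞ f) (a : Fin 3) : ContDiff ℝ ∞ (pd a f) :=
  (hf.fderiv_right (m := ∞) (by simp)).clm_apply contDiff_const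

theorem hasCompactSupport_pd {f : E3 → ℝ} (hf : HasCompactSupport f) (a : Fin 3) :
    HasCompactSupport (pd a f) := hf.fderiv_apply (𝕜 := ℝ) _

theorem test_sm {f : E3 → ℝ} (hf : ContDiff ℝ ∞ f) (hc : HasCompactSupport f) : Sm f := by
  exact schwartz_sm (hc.toSchwartzMap hf)

theorem contDiff_partialD {n : ℕ} (s : Fin n → Fin 3) {f : E3 → ℝ} (hf : ContDiff ℝ ∞ f) :
    ContDiff ℝ ∞ (partialD s f) := by
  induction n with
  | zero => rwa [partialD_zero]
  | succ n ih => rw [partialD_succ_real s hf]; exact contDiff_pd (ih _) _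

theorem hasCompactSupport_partialD {n : ℕ} (s : Fin n → Fin 3) {f : E3 → ℝ}
    (hf : ContDiff ℝ ∞ f) (hc : HasCompactSupport f) : HasCompactSupport (partialD s f) := by
  induction n with
  | zero => rwa [partialD_zero]
  | succ n ih => rw [partialD_succ_real s hf]; exact hasCompactSupport_pd (ih _) _

section Weak

variable {F : Type*} [NormedAddCommGroup F] [NormedSpace ℝ F]

theorem HasWeakDeriv.unique [CompleteSpace F] {n : ℕ} {s : Fin n → Fin 3} {f g g' : E3 → F}
    (h : HasWeakDeriv s f g)
    (h' : HasWeakDeriv s f g') : g =ᵐ[volume] g' := by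
  refine ae_eq_of_integral_contDiff_smul_eq h.2.1 h'.2.1 fun θ hθ hc => ?_
  have := (h.2.2 θ hθ hc).symm.trans (h'.2.2 θ hθ hc)
  exact smul_right_injective F (pow_ne_zero n (by norm_num : (-1 : ℝ) ≠ 0)) this

theorem hasWeakDeriv_zero {s : Fin 0 → Fin 3} {f : E3 → F} (hf : LocallyIntegrable f) :
    HasWeakDeriv s f f :=
  ⟨hf, hf, fun θ _ _ => by simp [partialD_zero]⟩

/-- `partialD s θ` is again a test function, so the first-order identity for `g` applies to it, and
the signs (-1) and (-1)^(n+1) combine to (-1)^n. This is what keeps weak first derivatives in the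
class `AllW`. -/
theorem HasWeakDeriv.cons {n : ℕ} {s : Fin n → Fin 3} {a : Fin 3} {f g h : E3 → F}
    (hg : HasWeakDeriv ![a] f g)
    (hh : HasWeakDeriv (Fin.cons a s : Fin (n + 1) → Fin 3) f h) : HasWeakDeriv s g h := by
  refine ⟨hg.2.1, hh.2.1, fun θ hθ hc => ?_⟩
  have h1 := hg.2.2 (partialD s θ) (contDiff_partialD s hθ) (hasCompactSupport_partialD s hθ hc)
  have h2 := hh.2.2 θ hθ hc
  rw [partialD_one a (contDiff_partialD s hθ)] at h1
  rw [partialD_succ_real _ hθ] at h2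
  simp only [Fin.cons_zero, Fin.tail_cons] at h2
  rw [h1] at h2
  simpa [pow_succ] using h2

theorem weakDeriv_spec {n : ℕ} {s : Fin n → Fin 3} {f g : E3 → F} (h : HasWeakDeriv s f g) :
    HasWeakDeriv s f (weakDeriv s f) := by
  unfold weakDeriv
  rw [dif_pos ⟨g, h⟩]
  exact Exists.choose_spec (p := fun g => HasWeakDeriv s f g) ⟨g, h⟩

theorem eLpNorm_le_normW [CompleteSpace F] {f : E3 → F} (hf : LocallyIntegrable f) (m : ℕ)
    (q : ℝ≥0∞) : eLpNorm f q volume ≤ normW m q f := by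
  unfold normW
  refine le_trans ?_ (Finset.single_le_sum (f := fun n => ∑ s : Fin n → Fin 3,
    eLpNorm (weakDeriv s f) q volume) (fun _ _ => zero_le) (Finset.mem_range.2 m.succ_pos))
  refine le_trans (le_of_eq ?_) (Finset.single_le_sum (f := fun s : Fin 0 → Fin 3 =>
    eLpNorm (weakDeriv s f) q volume) (fun _ _ => zero_le) (Finset.mem_univ default))
  have h := hasWeakDeriv_zero (s := default) hf
  exact eLpNorm_congr_ae (h.unique (weakDeriv_spec h))

/-- Membership in all the spaces `W^{m,2} ∩ W^{m,∞}`. -/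
def AllW (f : E3 → F) : Prop := ∀ m, MemW m 2 f ∧ MemW m ⊤ f

theorem AllW.locallyIntegrable {f : E3 → F} (hf : AllW f) : LocallyIntegrable f := by
  obtain ⟨g, hg, -⟩ := (hf 0).1 0 le_rfl default
  exact hg.1

theorem AllW.exists_weak [CompleteSpace F] {f : E3 → F} (hf : AllW f) (a : Fin 3) :
    ∃ g, HasWeakDeriv ![a] f g ∧ AllW g := by
  obtain ⟨g, hg, -⟩ := (hf 1).1 1 le_rfl ![a]
  refine ⟨g, hg, fun m => ⟨fun n hn s => ?_, fun n hn s => ?_⟩⟩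
  · obtain ⟨h, hh, hm⟩ := (hf (m + 1)).1 (n + 1) (by omega) (Fin.cons a s)
    exact ⟨h, hg.cons hh, hm⟩
  · obtain ⟨h, hh, hm⟩ := (hf (m + 1)).2 (n + 1) (by omega) (Fin.cons a s)
    exact ⟨h, hg.cons hh, hm⟩

theorem AllW.memLp [CompleteSpace F] {f : E3 → F} (hf : AllW f) :
    MemLp f 2 volume ∧ MemLp f ⊤ volume := by
  obtain ⟨g, hg, hm⟩ := (hf 0).1 0 le_rfl default
  obtain ⟨g', hg', hm'⟩ := (hf 0).2 0 le_rfl default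
  have h := hasWeakDeriv_zero (s := default) hf.locallyIntegrable
  exact ⟨hm.ae_eq (hg.unique h), hm'.ae_eq (hg'.unique h)⟩

theorem HasWeakDeriv.clm_comp [CompleteSpace F] (L : F →L[ℝ] ℝ) {n : ℕ} {s : Fin n → Fin 3}
    {f g : E3 → F} (h : HasWeakDeriv s f g) :
    HasWeakDeriv s (fun x => L (f x)) (fun x => L (g x)) := by
  have hL : ∀ {k : E3 → F}, LocallyIntegrable k → LocallyIntegrable (fun x => L (k x)) :=
    fun {k} hk x => by
      obtain ⟨U, hU, hi⟩ := hk x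
      exact ⟨U, hU, L.integrable_comp hi⟩
  refine ⟨hL h.1, hL h.2.1, fun θ hθ hc => ?_⟩
  have key := congrArg L (h.2.2 θ hθ hc)
  have hi : ∀ {η : E3 → ℝ} {k : E3 → F}, Continuous η → HasCompactSupport η →
      LocallyIntegrable k → L (∫ x, η x • k x) = ∫ x, η x • L (k x) := by
    intro η k hη hηc hk
    rw [← L.integral_comp_comm (hk.integrable_smul_left_of_hasCompactSupport hη hηc)]
    simp
  rw [map_smul, hi (contDiff_partialD s hθ).continuous (hasCompactSupport_partialD s hθ hc) h.1,
    hi hθ.continuous hc h.2.1] at key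
  exact key

theorem AllW.clm_comp [CompleteSpace F] (L : F →L[ℝ] ℝ) {f : E3 → F} (hf : AllW f) :
    AllW (fun x => L (f x)) := by
  refine fun m => ⟨fun n hn s => ?_, fun n hn s => ?_⟩
  · obtain ⟨g, hg, hm⟩ := (hf m).1 n hn s
    exact ⟨_, hg.clm_comp L, L.comp_memLp' hm⟩
  · obtain ⟨g, hg, hm⟩ := (hf m).2 n hn s
    exact ⟨_, hg.clm_comp L, L.comp_memLp' hm⟩

end Weak

/-! ### Mollification -/

/-- A standard mollifier at scale `1 / (n + 1)`. -/
def bump (n : ℕ) : ContDiffBump (0 : E3) where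
  rIn := 1 / (n + 1)
  rOut := 2 / (n + 1)
  rIn_pos := by positivity
  rIn_lt_rOut := by gcongr; norm_num

theorem tendsto_bump_rOut : Tendsto (fun n => (bump n).rOut) atTop (𝓝 0) := by
  have := tendsto_one_div_add_atTop_nhds_zero_nat (𝕜 := ℝ)
  have h2 := this.const_mul 2
  simp only [mul_zero] at h2
  refine h2.congr fun n => ?_
  simp [bump]; ring

theorem ae_tendsto_bump {f : E3 → ℝ} (hf : LocallyIntegrable f) :
    ∀ᵐ x, Tendsto (fun n => cv ((bump n).normed volume) f x) atTop (𝓝 (f x)) :=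
  ContDiffBump.ae_convolution_tendsto_right_of_locallyIntegrable (K := 2) tendsto_bump_rOut
    (Eventually.of_forall fun n => by simp [bump]; ring_nf; exact le_rfl) hf

theorem hasFDerivAt_bump_cv {f : E3 → ℝ} (hf : LocallyIntegrable f) (φ : ContDiffBump (0 : E3)) (x : E3) :
    DifferentiableAt ℝ (cv (φ.normed volume) f) x :=
  ((φ.hasCompactSupport_normed.hasFDerivAt_convolution_left (ContinuousLinearMap.lsmul ℝ ℝ)
    φ.contDiff_normed hf x)).differentiableAt

/-- The classical derivative is put on the mollifier, and y ↦ ρ(x - y) is an admissible test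
function in the definition of the weak derivative. -/
theorem pd_bump_cv {f g : E3 → ℝ} {a : Fin 3} (h : HasWeakDeriv ![a] f g)
    (φ : ContDiffBump (0 : E3)) : pd a (cv (φ.normed volume) f) = cv (φ.normed volume) g := by
  ext x
  set ρ := φ.normed volume with hρ
  have hρs : ContDiff ℝ ∞ ρ := φ.contDiff_normed
  have hρc : HasCompactSupport ρ := φ.hasCompactSupport_normed
  have hd := hρc.hasFDerivAt_convolution_left (ContinuousLinearMap.lsmul ℝ ℝ)
    (hρs.of_le (by simp)) h.1 x
  have hfd : Continuous (fderiv ℝ ρ) := hρs.continuous_fderiv (by simp)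
  have h1 : pd a (cv ρ f) x = ∫ y, pd a ρ y * f (x - y) := by
    have : pd a (cv ρ f) x = (convolution (fderiv ℝ ρ) f
        ((ContinuousLinearMap.lsmul ℝ ℝ).precompL E3) volume x) (EuclideanSpace.single a 1) := by
      unfold pd
      exact congrArg (fun L : E3 →L[ℝ] ℝ => L (EuclideanSpace.single a 1)) hd.fderiv
    rw [this, convolution, ContinuousLinearMap.integral_apply]
    · rfl
    · exact (HasCompactSupport.convolutionExists_left _ (hρc.fderiv ℝ) hfd h.1 x)
  rw [h1]
  have h2 := h.2.2 (fun y => ρ (x - y)) (hρs.comp (contDiff_const.sub contDiff_id))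
    (hρc.comp_homeomorph (Homeomorph.subLeft x))
  have h3 : partialD ![a] (fun y => ρ (x - y)) = fun y => - pd a ρ (x - y) := by
    rw [partialD_one (f := fun y => ρ (x - y)) a (hρs.comp (contDiff_const.sub contDiff_id))]
    ext y
    have e1 : HasFDerivAt ρ (fderiv ℝ ρ (x - y)) (x - y) :=
      (hρs.differentiable (by simp) _).hasFDerivAt
    have e2 : HasFDerivAt (fun y : E3 => x - y) (-ContinuousLinearMap.id ℝ E3) y :=
      (hasFDerivAt_id y).const_sub x
    unfold pd
    change fderiv ℝ (ρ ∘ fun y => x - y) y _ = _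
    rw [(e1.comp y e2).fderiv]
    simp
  rw [h3] at h2
  have swap : ∀ k l : E3 → ℝ, ∫ y, k y * l (x - y) = ∫ y, k (x - y) * l y := by
    intro k l
    rw [← integral_sub_left_eq_self (fun y => k y * l (x - y)) volume x]
    simp
  unfold cv
  rw [swap, swap]
  simp only [smul_eq_mul, pow_one, neg_mul, integral_neg, one_mul] at h2
  linarith

theorem abs_bump_cv_le {g : E3 → ℝ} {C : ℝ} (hC : ∀ᵐ x, |g x| ≤ C) (φ : ContDiffBump (0 : E3))
    (x : E3) : |cv (φ.normed volume) g x| ≤ C := by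
  have h1 : ∀ᵐ y, |g (x - y)| ≤ C :=
    (quasiMeasurePreserving_sub_left volume x).ae hC
  have h2 := norm_integral_le_of_norm_le (f := fun y => φ.normed volume y * g (x - y))
    (φ.integrable_normed.mul_const C)
    (h1.mono fun y hy => by
      rw [norm_mul, Real.norm_of_nonneg (φ.nonneg_normed y)]
      exact mul_le_mul_of_nonneg_left hy (φ.nonneg_normed y))
  rw [integral_mul_const, φ.integral_normed, one_mul] at h2
  exact h2

/-- The gradients of the mollifications are averages of the bounded weak derivatives, so all
mollifications share one Lipschitz constant. It passes to `f` on the full-measure set where they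
converge to `f`, and from there a Lipschitz extension reaches the whole space. -/
theorem exists_lipschitz_rep {f : E3 → ℝ} {g : Fin 3 → E3 → ℝ}
    (h : ∀ a, HasWeakDeriv ![a] f (g a)) (hg : ∀ a, MemLp (g a) ⊤ volume) :
    ∃ (L : NNReal) (F : E3 → ℝ), LipschitzWith L F ∧ F =ᵐ[volume] f := by
  have hlf : LocallyIntegrable f := (h 0).1
  have hb : ∀ a, ∀ᵐ x, |g a x| ≤ lpNorm (g a) ⊤ volume := fun a => ae_le_lpNorm_exponent_top (hg a)
  set L : ℝ := ∑ a, lpNorm (g a) ⊤ volume with hL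
  have hL0 : 0 ≤ L := Finset.sum_nonneg fun a _ => lpNorm_nonneg
  have hlip : ∀ n, LipschitzWith L.toNNReal (cv ((bump n).normed volume) f) := by
    intro n
    refine lipschitzWith_of_nnnorm_fderiv_le (𝕜 := ℝ) (hasFDerivAt_bump_cv hlf (bump n)) fun x => ?_
    rw [← NNReal.coe_le_coe, coe_nnnorm, Real.coe_toNNReal _ hL0]
    refine ContinuousLinearMap.opNorm_le_bound _ hL0 fun y => ?_
    rw [fderiv_eq_sum_pd, hL, Finset.sum_mul]
    refine (norm_sum_le _ _).trans (Finset.sum_le_sum fun a _ => ?_)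
    rw [norm_mul, mul_comm, pd_bump_cv (h a)]
    exact mul_le_mul (abs_bump_cv_le (hb a) _ x) (PiLp.norm_apply_le y a) (norm_nonneg _)
      lpNorm_nonneg
  have hae := ae_tendsto_bump hlf
  have hon : LipschitzOnWith L.toNNReal f
      {x | Tendsto (fun n => cv ((bump n).normed volume) f x) atTop (𝓝 (f x))} := by
    refine LipschitzOnWith.of_dist_le_mul fun x hx y hy => ?_
    exact le_of_tendsto (Tendsto.dist hx hy) (Eventually.of_forall fun n => (hlip n).dist_le_mul x y)
  obtain ⟨F, hF, hE⟩ := hon.extend_real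
  exact ⟨_, F, hF, hae.mono fun x hx => (hE hx).symm⟩

theorem AllW.exists_lipschitz {f : E3 → ℝ} (hf : AllW f) :
    ∃ (L : NNReal) (F : E3 → ℝ), LipschitzWith L F ∧ F =ᵐ[volume] f := by
  choose g hg hga using hf.exists_weak
  exact exists_lipschitz_rep hg fun a => (hga a).memLp.2

theorem HasWeakDeriv.congr {n : ℕ} {s : Fin n → Fin 3} {f g f' g' : E3 → ℝ}
    (h : HasWeakDeriv s f g) (hf : f =ᵐ[volume] f') (hg : g =ᵐ[volume] g') :
    HasWeakDeriv s f' g' := by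
  refine ⟨h.1.congr hf, h.2.1.congr hg, fun θ hθ hc => ?_⟩
  have h1 : ∫ x, partialD s θ x • f' x = ∫ x, partialD s θ x • f x :=
    integral_congr_ae (hf.mono fun x hx => by simp only [hx])
  have h2 : ∫ x, θ x • g' x = ∫ x, θ x • g x :=
    integral_congr_ae (hg.mono fun x hx => by simp only [hx])
  rw [h1, h2, h.2.2 θ hθ hc]

/-- A Lipschitz function with Lipschitz weak derivatives is classically differentiable. -/
theorem hasFDerivAt_of_weak {F : E3 → ℝ} {G : Fin 3 → E3 → ℝ} {L : Fin 3 → NNReal}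
    (hF : Continuous F)
    (hG : ∀ a, LipschitzWith (L a) (G a)) (h : ∀ a, HasWeakDeriv ![a] F (G a)) (x : E3) :
    HasFDerivAt F (∑ a, G a x • (EuclideanSpace.proj a : E3 →L[ℝ] ℝ)) x := by
  have hlf : LocallyIntegrable F := hF.locallyIntegrable
  refine hasFDerivAt_of_tendstoUniformly (l := atTop)
    (f := fun n => cv ((bump n).normed volume) F)
    (f' := fun n x => ∑ a, cv ((bump n).normed volume) (G a) x •
      (EuclideanSpace.proj a : E3 →L[ℝ] ℝ))
    (g' := fun x => ∑ a, G a x • (EuclideanSpace.proj a : E3 →L[ℝ] ℝ)) ?_ ?_ ?_ x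
  · rw [Metric.tendstoUniformly_iff]
    intro ε hε
    have ht : Tendsto (fun n => (∑ a, (L a : ℝ)) * (bump n).rOut) atTop (𝓝 0) := by
      simpa using tendsto_bump_rOut.const_mul (∑ a, (L a : ℝ))
    filter_upwards [ht.eventually_lt_const hε] with n hn x
    refine lt_of_le_of_lt ?_ hn
    rw [dist_eq_norm, ← Finset.sum_sub_distrib]
    refine ContinuousLinearMap.opNorm_le_bound _ (mul_nonneg (Finset.sum_nonneg fun a _ => (L a).2)
      (bump n).rOut_pos.le) fun y => ?_
    rw [sum_apply, Finset.sum_mul, Finset.sum_mul]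
    refine (norm_sum_le _ _).trans (Finset.sum_le_sum fun a _ => ?_)
    rw [← sub_smul]
    simp only [smul_apply, PiLp.proj_apply, smul_eq_mul, norm_mul]
    refine mul_le_mul ?_ (PiLp.norm_apply_le y a) (norm_nonneg _)
      (mul_nonneg (L a).2 (bump n).rOut_pos.le)
    rw [← dist_eq_norm, dist_comm]
    refine (bump n).dist_normed_convolution_le (hG a).continuous.aestronglyMeasurable fun z hz => ?_
    refine ((hG a).dist_le_mul z x).trans ?_
    exact mul_le_mul_of_nonneg_left (Metric.mem_ball.1 hz).le (L a).2
  · intro n x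
    have hd := (hasFDerivAt_bump_cv hlf (bump n) x).hasFDerivAt
    have e : ∑ a, cv ((bump n).normed volume) (G a) x • (EuclideanSpace.proj a : E3 →L[ℝ] ℝ) =
        fderiv ℝ (cv ((bump n).normed volume) F) x := ?_
    · rw [e]; exact hd
    refine ContinuousLinearMap.ext fun y => ?_
    rw [fderiv_eq_sum_pd, sum_apply]
    refine Finset.sum_congr rfl fun a _ => ?_
    rw [pd_bump_cv (h a)]
    simp [mul_comm]
  · intro x
    exact ContDiffBump.convolution_tendsto_right_of_continuous tendsto_bump_rOut hF x

/-- The Lipschitz representatives of the first weak derivatives coincide with the `Reg n`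
representatives from the induction, since continuous functions that agree almost everywhere agree.
They are thus the classical partial derivatives of the representative of `f`. -/
theorem AllW.exists_reg (n : ℕ) {f : E3 → ℝ} (hf : AllW f) : ∃ F, Reg n F ∧ F =ᵐ[volume] f := by
  induction n generalizing f with
  | zero =>
    obtain ⟨L, F, hF, he⟩ := hf.exists_lipschitz
    refine ⟨F, ⟨hF.continuous, ⟨lpNorm f ⊤ volume, fun x => ?_⟩, hf.memLp.1.ae_eq he.symm⟩, he⟩
    have hae : ∀ᵐ x, |F x| ≤ lpNorm f ⊤ volume := by
      filter_upwards [ae_le_lpNorm_exponent_top hf.memLp.2, he] with x hx hx'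
      rw [hx']; exact hx
    -- The bound holds on a closed set of full measure, which is dense and hence everything.
    have hcl : IsClosed {x | |F x| ≤ lpNorm f ⊤ volume} :=
      isClosed_le hF.continuous.abs continuous_const
    have := (Measure.dense_of_ae hae).closure_eq
    rw [hcl.closure_eq] at this
    exact Set.eq_univ_iff_forall.1 this x
  | succ n ih =>
    obtain ⟨F, hF, he⟩ := ih hf
    choose g hg hga using hf.exists_weak
    choose L G hGL hGe using fun a => (hga a).exists_lipschitz
    choose G' hG' hGe' using fun a => ih (hga a)
    have hGG : ∀ a, G a = G' a := fun a =>
      ((hGL a).continuous.ae_eq_iff_eq volume (hG' a).bl2.cont).1 ((hGe a).trans (hGe' a).symm)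
    have hd := hasFDerivAt_of_weak hF.bl2.cont hGL
      (fun a => (hg a).congr he.symm (hGe a).symm)
    refine ⟨F, ⟨hF.bl2, fun x => (hd x).differentiableAt, fun a => ?_⟩, he⟩
    have : NSReg.pd a F = G' a := by
      rw [← hGG]
      ext x
      unfold NSReg.pd
      rw [(hd x).fderiv]
      simp
    rw [this]
    exact hG' a

/-- Functions in all the spaces `W^{m,2} ∩ W^{m,∞}` have a smooth representative. -/
theorem AllW.exists_sm {f : E3 → ℝ} (hf : AllW f) : ∃ F, Sm F ∧ F =ᵐ[volume] f := by
  obtain ⟨F, hF, he⟩ := hf.exists_reg 0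
  refine ⟨F, fun n => ?_, he⟩
  obtain ⟨F', hF', he'⟩ := hf.exists_reg n
  have : F = F' :=
    (hF.bl2.cont.ae_eq_iff_eq volume hF'.bl2.cont).1 (he.trans he'.symm)
  rwa [this]

theorem Sm.hasWeakDeriv_one {F : E3 → ℝ} (hF : Sm F) (a : Fin 3) :
    HasWeakDeriv ![a] F (NSReg.pd a F) := by
  refine ⟨hF.cont.locallyIntegrable, (hF.pd a).cont.locallyIntegrable, fun θ hθ hc => ?_⟩
  rw [partialD_one a hθ]
  have := integral_mul_pd (test_sm hθ hc) hF a
  simp only [smul_eq_mul]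
  linarith

theorem Sm.hasWeakDeriv_two {F : E3 → ℝ} (hF : Sm F) (a b : Fin 3) :
    HasWeakDeriv ![a, b] F (NSReg.pd a (NSReg.pd b F)) := by
  refine ⟨hF.cont.locallyIntegrable, ((hF.pd b).pd a).cont.locallyIntegrable, fun θ hθ hc => ?_⟩
  have hs := test_sm hθ hc
  rw [partialD_two a b hθ, hF.pd_comm a b]
  have h1 := integral_mul_pd (hs.pd b) hF a
  have h2 := integral_mul_pd hs (hF.pd a) b
  simp only [smul_eq_mul]
  linarith

/-! ### Kernels of Fourier multipliers -/

/-- Smooth, compactly supported, even multipliers. -/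
structure Sym (χ : E3 → ℝ) : Prop where
  smooth : ContDiff ℝ ∞ χ
  compact : HasCompactSupport χ
  even : ∀ ξ, χ (-ξ) = χ ξ

theorem Sym.smoothC {χ : E3 → ℝ} (h : Sym χ) : ContDiff ℝ ∞ (fun ξ => (χ ξ : ℂ)) :=
  Complex.ofRealCLM.contDiff.comp h.smooth

theorem Sym.compactC {χ : E3 → ℝ} (h : Sym χ) : HasCompactSupport (fun ξ => (χ ξ : ℂ)) :=
  h.compact.comp_left (g := fun r : ℝ => (r : ℂ)) (by simp)

/-- A multiplier as a complex Schwartz function. -/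
def Sym.toS {χ : E3 → ℝ} (h : Sym χ) : 𝓢(E3, ℂ) := h.compactC.toSchwartzMap h.smoothC

theorem Sym.toS_apply {χ : E3 → ℝ} (h : Sym χ) (ξ : E3) : h.toS ξ = (χ ξ : ℂ) := rfl

theorem Sym.coe_toS {χ : E3 → ℝ} (h : Sym χ) : (h.toS : E3 → ℂ) = fun ξ => (χ ξ : ℂ) := rfl

open Classical in
/-- The inverse Fourier transform of a multiplier, as a real Schwartz function. -/
def ker (χ : E3 → ℝ) : 𝓢(E3, ℝ) :=
  if h : Sym χ then (𝓕⁻ h.toS).postcompCLM Complex.reCLM else 0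

theorem Sym.ker_eq {χ : E3 → ℝ} (h : Sym χ) :
    ker χ = (𝓕⁻ h.toS).postcompCLM Complex.reCLM := dif_pos h

theorem Sym.ker_apply {χ : E3 → ℝ} (h : Sym χ) (x : E3) :
    ker χ x = (𝓕⁻ (fun ξ => (χ ξ : ℂ)) x).re := by
  rw [h.ker_eq, SchwartzMap.postcompCLM_apply, SchwartzMap.fourierInv_coe, h.coe_toS]
  rfl

theorem Sym.ker_ofReal {χ : E3 → ℝ} (h : Sym χ) (x : E3) :
    (ker χ x : ℂ) = 𝓕⁻ (fun ξ => (χ ξ : ℂ)) x := by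
  rw [h.ker_apply, ← Complex.conj_eq_iff_re, Real.fourierInv_eq', ← integral_conj,
    ← integral_neg_eq_self]
  congr 1
  ext ξ
  simp only [smul_eq_mul, map_mul, Complex.conj_ofReal, h.even, inner_neg_left]
  rw [← Complex.exp_conj]
  congr 2
  simp [Complex.conj_ofNat]

theorem Sym.fourier_ker {χ : E3 → ℝ} (h : Sym χ) (ξ : E3) :
    𝓕 (fun x => (ker χ x : ℂ)) ξ = (χ ξ : ℂ) := by
  have h1 : (fun x => (ker χ x : ℂ)) = (𝓕⁻ h.toS : 𝓢(E3, ℂ)) := by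
    ext x
    rw [h.ker_ofReal, SchwartzMap.fourierInv_coe, h.coe_toS]
  rw [h1, ← SchwartzMap.fourier_coe, FourierTransform.fourier_fourierInv_eq, h.toS_apply]

theorem Sym.integrableC {χ : E3 → ℝ} (h : Sym χ) : Integrable (fun ξ => (χ ξ : ℂ)) :=
  h.toS.integrable

/-- The inverse transform at w - y is the forward transform, in y, of the modulated symbol; the
Fourier integral is then moved to the other factor. Only integrability of `g` and `χ` enters. -/
theorem integral_mul_fourierInv_sub {g χ : E3 → ℂ} (hg : Integrable g) (hχ : Integrable χ)
    (w : E3) : ∫ y, g y * 𝓕⁻ χ (w - y) =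
      ∫ ξ, 𝓕 g ξ * (Complex.exp (↑(2 * Real.pi * inner ℝ ξ w) * Complex.I) * χ ξ) := by
  have hi : Integrable (fun ξ => Complex.exp (↑(2 * Real.pi * inner ℝ ξ w) * Complex.I) * χ ξ) := by
    refine hχ.bdd_mul (c := 1) (Continuous.aestronglyMeasurable (by fun_prop))
      (Eventually.of_forall fun ξ => ?_)
    rw [Complex.norm_exp_ofReal_mul_I]
  have h1 : ∀ y, 𝓕⁻ χ (w - y) =
      𝓕 (fun ξ => Complex.exp (↑(2 * Real.pi * inner ℝ ξ w) * Complex.I) * χ ξ) y := by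
    intro y
    rw [Real.fourierInv_eq', Real.fourier_eq']
    congr 1
    ext ξ
    rw [smul_eq_mul, smul_eq_mul, ← mul_assoc, ← Complex.exp_add, inner_sub_right]
    congr 2
    push_cast
    ring
  simp_rw [h1]
  have := VectorFourier.integral_fourierIntegral_smul_eq_flip (L := innerₗ E3)
    Real.continuous_fourierChar (by exact continuous_inner) hg hi
  simp only [smul_eq_mul, flip_innerₗ] at this
  exact this.symm

theorem integral_mul_fourierInv_sub_eq_zero {g χ : E3 → ℂ} (hg : Integrable g)
    (hχ : Integrable χ) (h : ∀ ξ, 𝓕 g ξ * χ ξ = 0) (w : E3) :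
    ∫ y, g y * 𝓕⁻ χ (w - y) = 0 := by
  rw [integral_mul_fourierInv_sub hg hχ]
  refine integral_eq_zero_of_ae (Eventually.of_forall fun ξ => ?_)
  have := h ξ
  simp only [Pi.zero_apply]
  rw [mul_left_comm, this, mul_zero]

theorem cv_ofReal (K f : E3 → ℝ) (x : E3) :
    ((cv K f x : ℝ) : ℂ) = ∫ y, (K y : ℂ) * (f (x - y) : ℂ) := by
  unfold cv
  rw [← integral_complex_ofReal]
  simp

theorem Sym.mul {χ χ' : E3 → ℝ} (h : Sym χ) (h' : Sym χ') : Sym (fun ξ => χ ξ * χ' ξ) :=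
  ⟨h.smooth.mul h'.smooth, h.compact.mul_right, fun ξ => by rw [h.even, h'.even]⟩

theorem Sym.cv_ker {χ χ' : E3 → ℝ} (h : Sym χ) (h' : Sym χ') :
    cv (ker χ) (ker χ') = ker (fun ξ => χ ξ * χ' ξ) := by
  ext x
  have : ((cv (ker χ) (ker χ') x : ℝ) : ℂ) = ((ker (fun ξ => χ ξ * χ' ξ) x : ℝ) : ℂ) := by
    rw [cv_ofReal, (h.mul h').ker_ofReal]
    simp_rw [h'.ker_ofReal]
    have hi : Integrable (fun y => ((ker χ y : ℝ) : ℂ)) := (ker χ).integrable.ofReal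
    rw [integral_mul_fourierInv_sub hi h'.integrableC, Real.fourierInv_eq']
    congr 1
    ext ξ
    rw [h.fourier_ker]
    push_cast
    rw [smul_eq_mul]
    ring
  exact_mod_cast this

theorem fourier_modulate (N : E3 → ℂ) (ξ η : E3) :
    𝓕 (fun y => Complex.exp (↑(-2 * Real.pi * inner ℝ y ξ) * Complex.I) * N y) η =
      𝓕 N (ξ + η) := by
  rw [Real.fourier_eq', Real.fourier_eq']
  congr 1
  ext y
  rw [smul_eq_mul, smul_eq_mul, ← mul_assoc, ← Complex.exp_add, inner_add_right]
  congr 2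
  push_cast
  ring

/-- The frequency support of a product is contained in the sum of the supports. -/
theorem integral_ker_mul_ker_mul_ker {m χ : E3 → ℝ} (hm : Sym m) (h : Sym χ)
    (h0 : ∀ ξ η, m (ξ + η) * χ ξ * χ η = 0) (w w' : E3) :
    ∫ y, ker m y * (ker χ (w - y) * ker χ (w' - y)) = 0 := by
  have hint : ∀ w', Integrable (fun y => ((ker m y : ℝ) : ℂ) * (ker χ (w' - y) : ℂ)) := fun w' =>
    ((schwartz_bl2 (ker χ)).integrable_cv (ker m).integrable w').ofReal.congr
      (Eventually.of_forall fun y => by simp)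
  -- The transform of y ↦ `ker m y` times `ker χ (w' - y)` is, up to phases, the integral over η of
  -- m(ξ + η) χ(η). Multiplied by χ(ξ) it vanishes by `h0`, and a second use of the multiplication
  -- formula handles the remaining factor.
  have hz : ∀ ξ, 𝓕 (fun y => ((ker m y : ℝ) : ℂ) * (ker χ (w' - y) : ℂ)) ξ * (χ ξ : ℂ) = 0 := by
    intro ξ
    rw [Real.fourier_eq']
    have e : ∀ y, Complex.exp (↑(-2 * Real.pi * inner ℝ y ξ) * Complex.I) •
        (((ker m y : ℝ) : ℂ) * (ker χ (w' - y) : ℂ)) =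
        (Complex.exp (↑(-2 * Real.pi * inner ℝ y ξ) * Complex.I) * ((ker m y : ℝ) : ℂ)) *
          𝓕⁻ (fun ξ => (χ ξ : ℂ)) (w' - y) := by
      intro y
      rw [smul_eq_mul, ← mul_assoc, h.ker_ofReal (w' - y)]
    simp_rw [e]
    rw [integral_mul_fourierInv_sub _ h.integrableC, ← integral_mul_const]
    · refine integral_eq_zero_of_ae (Eventually.of_forall fun η => ?_)
      simp only [Pi.zero_apply]
      rw [fourier_modulate, hm.fourier_ker]
      have := h0 ξ η
      have h2 : (m (ξ + η) : ℂ) * χ ξ * χ η = 0 := by exact_mod_cast this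
      linear_combination (Complex.exp (↑(2 * Real.pi * inner ℝ η w') * Complex.I)) * h2
    · refine (ker m).integrable.ofReal.bdd_mul (c := 1)
        (Continuous.aestronglyMeasurable (by fun_prop)) (Eventually.of_forall fun ξ => ?_)
      rw [Complex.norm_exp_ofReal_mul_I]
  have key := integral_mul_fourierInv_sub_eq_zero (hint w') h.integrableC hz w
  simp_rw [← h.ker_ofReal] at key
  have key2 : ((∫ y, ker m y * (ker χ (w - y) * ker χ (w' - y)) : ℝ) : ℂ) = 0 := by
    rw [← integral_complex_ofReal, ← key]
    congr 1
    ext y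
    push_cast
    ring
  exact_mod_cast key2

/-! #### Derivatives -/

theorem pd_re (G : 𝓢(E3, ℂ)) (a : Fin 3) (x : E3) :
    pd a (fun x => (G x).re) x =
      ((∂_{(EuclideanSpace.single a (1 : ℝ) : E3)} G : 𝓢(E3, ℂ)) x).re := by
  rw [SchwartzMap.lineDerivOp_apply_eq_fderiv]
  have := Complex.reCLM.hasFDerivAt.comp x (G.differentiable x).hasFDerivAt
  unfold pd
  change fderiv ℝ (⇑Complex.reCLM ∘ ⇑G) x _ = _
  rw [this.fderiv]
  rfl

theorem smulLeft_twice (f : 𝓢(E3, ℂ)) (c : ℂ) (m ξ : E3) :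
    (c • SchwartzMap.smulLeftCLM ℂ (inner ℝ · m) (c • SchwartzMap.smulLeftCLM ℂ (inner ℝ · m) f) :
      𝓢(E3, ℂ)) ξ = c ^ 2 * (inner ℝ ξ m : ℝ) ^ 2 * f ξ := by
  have hg : (inner ℝ · m : E3 → ℝ).HasTemperateGrowth := by fun_prop
  rw [smul_apply, SchwartzMap.smulLeftCLM_apply_apply hg, smul_apply,
    SchwartzMap.smulLeftCLM_apply_apply hg]
  simp only [smul_eq_mul, Complex.real_smul]
  ring

/-- Each derivative multiplies the symbol by 2πi ξ_a, and the squares of these factors sum to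
-4π²‖ξ‖². -/
theorem Sym.laplacian_ker {χ χ' : E3 → ℝ} (h : Sym χ) (h' : Sym χ')
    (e : ∀ ξ, χ' ξ = 4 * Real.pi ^ 2 * ‖ξ‖ ^ 2 * χ ξ) (x : E3) :
    ∑ a, pd a (pd a (ker χ)) x = -ker χ' x := by
  have h1 : ∀ a, pd a (pd a (ker χ)) x =
      ((𝓕⁻ ((2 * Real.pi * Complex.I) • SchwartzMap.smulLeftCLM ℂ
          (inner ℝ · (EuclideanSpace.single a (1 : ℝ) : E3)) ((2 * Real.pi * Complex.I) •
          SchwartzMap.smulLeftCLM ℂ (inner ℝ · (EuclideanSpace.single a (1 : ℝ) : E3)) h.toS)) :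
            𝓢(E3, ℂ)) x).re := by
    intro a
    have e1 : (ker χ : E3 → ℝ) = fun x => ((𝓕⁻ h.toS : 𝓢(E3, ℂ)) x).re := by
      ext x; rw [h.ker_eq]; rfl
    have e2 : pd a (ker χ) = fun x =>
        ((∂_{(EuclideanSpace.single a (1 : ℝ) : E3)} (𝓕⁻ h.toS : 𝓢(E3, ℂ)) : 𝓢(E3, ℂ)) x).re := by
      ext x; rw [e1, pd_re]
    rw [e2, pd_re, SchwartzMap.lineDerivOp_fourierInv_eq, SchwartzMap.lineDerivOp_fourierInv_eq]
  have h2 : ∑ a : Fin 3, (𝓕⁻ ((2 * Real.pi * Complex.I) • SchwartzMap.smulLeftCLM ℂ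
          (inner ℝ · (EuclideanSpace.single a (1 : ℝ) : E3)) ((2 * Real.pi * Complex.I) •
          SchwartzMap.smulLeftCLM ℂ (inner ℝ · (EuclideanSpace.single a (1 : ℝ) : E3)) h.toS)) :
            𝓢(E3, ℂ)) = - 𝓕⁻ h'.toS := by
    rw [← FourierTransform.fourierInv_sum, ← FourierTransform.fourierInv_neg]
    congr 1
    ext ξ
    rw [sum_apply, neg_apply]
    simp_rw [smulLeft_twice, h.toS_apply, h'.toS_apply, e, EuclideanSpace.inner_single_right,
      EuclideanSpace.norm_sq_eq, Real.norm_eq_abs, sq_abs]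
    simp only [Fin.sum_univ_three, mul_pow, Complex.I_sq]
    push_cast
    simp
    ring
  simp_rw [h1]
  have h3 := congrArg (fun G : 𝓢(E3, ℂ) => (G x).re) h2
  simp only [sum_apply, Complex.re_sum, neg_apply, Complex.neg_re] at h3
  rw [h3, h'.ker_eq]
  rfl

/-! #### Dilations -/

/-- The `L¹` normalised dilation `2^{3j} K(2^j x)`. -/
def dil (j : ℤ) (K : E3 → ℝ) (x : E3) : ℝ := ((2 : ℝ) ^ j) ^ 3 * K ((2 : ℝ) ^ j • x)

/-- The multiplier `χ(2^{-j} ξ)`. -/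
def scl (j : ℤ) (χ : E3 → ℝ) (ξ : E3) : ℝ := χ ((2 : ℝ) ^ (-j) • ξ)

theorem Sym.scl {χ : E3 → ℝ} (h : Sym χ) (j : ℤ) : Sym (scl j χ) := by
  refine ⟨h.smooth.comp (by fun_prop), ?_, fun ξ => ?_⟩
  · exact h.compact.comp_homeomorph
      (Homeomorph.smulOfNeZero ((2 : ℝ) ^ (-j)) (zpow_ne_zero _ two_ne_zero))
  · unfold NSReg.scl
    rw [smul_neg, h.even]

theorem Sym.ker_scl {χ : E3 → ℝ} (h : Sym χ) (j : ℤ) : (ker (NSReg.scl j χ) : E3 → ℝ) = dil j (ker χ) := by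
  ext x
  have key : ((ker (NSReg.scl j χ) x : ℝ) : ℂ) = ((dil j (ker χ) x : ℝ) : ℂ) := by
    unfold dil
    rw [(h.scl j).ker_ofReal]
    push_cast
    rw [h.ker_ofReal, Real.fourierInv_eq', Real.fourierInv_eq']
    have := Measure.integral_comp_smul_of_nonneg (volume : Measure E3)
      (fun v => Complex.exp (↑(2 * Real.pi * inner ℝ v ((2 : ℝ) ^ j • x)) * Complex.I) •
        (χ v : ℂ)) ((2 : ℝ) ^ (-j)) (hR := by positivity)
    have h3 : Module.finrank ℝ E3 = 3 := by simp
    rw [h3] at this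
    have e : ∀ v : E3, inner ℝ ((2 : ℝ) ^ (-j) • v) ((2 : ℝ) ^ j • x) = inner ℝ v x := by
      intro v
      rw [inner_smul_left, inner_smul_right, ← mul_assoc, zpow_neg]
      simp [zpow_ne_zero]
    simp_rw [e] at this
    unfold NSReg.scl
    rw [this, zpow_neg, inv_pow, inv_inv, Complex.real_smul]
    push_cast
    rfl
  exact_mod_cast key

theorem pd_dil {K : E3 → ℝ} (hK : Differentiable ℝ K) (j : ℤ) (a : Fin 3) :
    pd a (dil j K) = fun x => (2 : ℝ) ^ j * dil j (pd a K) x := by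
  ext x
  have h1 : HasFDerivAt K (fderiv ℝ K ((2 : ℝ) ^ j • x)) ((2 : ℝ) ^ j • x) := (hK _).hasFDerivAt
  have h2 : HasFDerivAt (fun x : E3 => (2 : ℝ) ^ j • x) ((2 : ℝ) ^ j • ContinuousLinearMap.id ℝ E3) x :=
    ((2 : ℝ) ^ j • ContinuousLinearMap.id ℝ E3).hasFDerivAt
  have h3 := (h1.comp x h2).const_mul (((2 : ℝ) ^ j) ^ 3)
  have h4 : fderiv ℝ (dil j K) x = _ := h3.fderiv
  unfold pd
  rw [h4]
  simp [dil]
  ring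

/-- The `L¹` norm. -/
def l1 (K : E3 → ℝ) : ℝ := ∫ x, |K x|

theorem l1_nonneg (K : E3 → ℝ) : 0 ≤ l1 K := integral_nonneg fun _ => abs_nonneg _

theorem integral_comp_dil (f : E3 → ℝ) (j : ℤ) :
    ∫ x : E3, ((2 : ℝ) ^ j) ^ 3 * f ((2 : ℝ) ^ j • x) = ∫ x, f x := by
  rw [integral_const_mul, Measure.integral_comp_smul_of_nonneg _ _ _ (hR := by positivity)]
  have h3 : Module.finrank ℝ E3 = 3 := by simp
  rw [h3, smul_eq_mul, ← mul_assoc, mul_inv_cancel₀ (by positivity), one_mul]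

theorem l1_dil (K : E3 → ℝ) (j : ℤ) : l1 (dil j K) = l1 K := by
  unfold l1 dil
  rw [← integral_comp_dil (fun x => |K x|) j]
  congr 1; ext x
  rw [abs_mul, abs_of_pos (by positivity)]

theorem l1_const_mul (c : ℝ) (K : E3 → ℝ) : l1 (fun x => c * K x) = |c| * l1 K := by
  unfold l1
  simp_rw [abs_mul]
  rw [integral_const_mul]

theorem integrable_pd (K : 𝓢(E3, ℝ)) (a : Fin 3) : Integrable (pd a K) := by
  rw [schwartz_pd]; exact SchwartzMap.integrable _

/-! #### Algebra of convolutions -/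

theorem cv_sub_left {K L f : E3 → ℝ} (hK : Integrable K) (hL : Integrable L) (hf : BL2 f) :
    cv (fun x => K x - L x) f = fun x => cv K f x - cv L f x := by
  ext x
  unfold cv
  rw [← integral_sub (hf.integrable_cv hK x) (hf.integrable_cv hL x)]
  congr 1; ext y; ring

theorem cv_neg_left (K f : E3 → ℝ) : cv (fun x => -K x) f = fun x => -cv K f x := by
  ext x
  unfold cv
  rw [← integral_neg]
  congr 1; ext y; ring

theorem cv_add_right {K f g : E3 → ℝ} (hK : Integrable K) (hf : BL2 f) (hg : BL2 g) :
    cv K (fun x => f x + g x) = fun x => cv K f x + cv K g x := by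
  ext x
  unfold cv
  rw [← integral_add (hf.integrable_cv hK x) (hg.integrable_cv hK x)]
  congr 1; ext y; ring

theorem cv_const_mul_right (c : ℝ) (K f : E3 → ℝ) :
    cv K (fun x => c * f x) = fun x => c * cv K f x := by
  ext x
  unfold cv
  rw [← integral_const_mul]
  congr 1; ext y; ring

theorem BL2.sub {f g : E3 → ℝ} (hf : BL2 f) (hg : BL2 g) : BL2 (fun x => f x - g x) := by
  simpa [sub_eq_add_neg] using hf.add (hg.const_mul (-1))

theorem cv_sum_left {K : Fin 3 → E3 → ℝ} {f : E3 → ℝ} (hK : ∀ a, Integrable (K a)) (hf : BL2 f) :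
    cv (fun x => ∑ a, K a x) f = fun x => ∑ a, cv (K a) f x := by
  ext x
  unfold cv
  rw [← integral_finsetSum _ fun a _ => hf.integrable_cv (hK a) x]
  congr 1; ext y; rw [Finset.sum_mul]

theorem cv_sum_right {K : E3 → ℝ} {f : Fin 3 → E3 → ℝ} (hK : Integrable K) (hf : ∀ a, BL2 (f a)) :
    cv K (fun x => ∑ a, f a x) = fun x => ∑ a, cv K (f a) x := by
  ext x
  unfold cv
  rw [← integral_finsetSum _ fun a _ => (hf a).integrable_cv hK x]
  congr 1; ext y; rw [Finset.mul_sum]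

/-- Fubini, justified because K(z) L(y - z) is integrable on the product and `f` is bounded. -/
theorem cv_assoc {K L f : E3 → ℝ} (hK : Integrable K) (hL : Integrable L)
    (hf : BL2 f) : cv (cv K L) f = cv K (cv L f) := by
  ext x
  obtain ⟨C, hC⟩ := hf.bdd
  unfold cv
  have hi : Integrable (fun q : E3 × E3 => K q.2 * L (q.1 - q.2) * f (x - q.1))
      (volume.prod volume) := by
    have := hK.convolution_integrand (ContinuousLinearMap.mul ℝ ℝ) hL
    refine this.mul_bdd (c := C)
      (hf.cont.comp (continuous_const.sub continuous_fst)).aestronglyMeasurable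
      (Eventually.of_forall fun y => hC _)
  calc ∫ y, (∫ z, K z * L (y - z)) * f (x - y)
      = ∫ y, ∫ z, K z * L (y - z) * f (x - y) := by
        congr 1; ext y; rw [integral_mul_const]
    _ = ∫ z, ∫ y, K z * L (y - z) * f (x - y) := integral_integral_swap hi
    _ = ∫ z, K z * ∫ y, L y * f (x - z - y) := by
        congr 1; ext z
        rw [← integral_const_mul, ← integral_add_right_eq_self _ z]
        congr 1; ext y
        rw [add_sub_cancel_right, mul_assoc, sub_sub, add_comm z y]

theorem Reg.reflect {n : ℕ} {f : E3 → ℝ} (hf : Reg n f) (x : E3) : Reg n (fun y => f (x - y)) := by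
  have h0 : ∀ {f : E3 → ℝ}, BL2 f → BL2 (fun y => f (x - y)) := fun {f} hf => by
    obtain ⟨C, hC⟩ := hf.bdd
    exact ⟨hf.cont.comp (continuous_const.sub continuous_id), ⟨C, fun y => hC _⟩,
      hf.memLp.comp_measurePreserving (Measure.measurePreserving_sub_left volume x)⟩
  induction n generalizing f with
  | zero => exact h0 hf
  | succ n ih =>
    refine ⟨h0 hf.1, hf.2.1.comp (differentiable_id.const_sub x), fun a => ?_⟩
    have : NSReg.pd a (fun y => f (x - y)) = fun y => (-1) * NSReg.pd a f (x - y) := by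
      ext y
      have e1 : HasFDerivAt f (fderiv ℝ f (x - y)) (x - y) := (hf.2.1 _).hasFDerivAt
      have e2 : HasFDerivAt (fun y : E3 => x - y) (-ContinuousLinearMap.id ℝ E3) y :=
        (hasFDerivAt_id y).const_sub x
      unfold pd
      change fderiv ℝ (f ∘ fun y => x - y) y _ = _
      rw [(e1.comp y e2).fderiv]
      simp
    rw [this]
    exact (ih (hf.2.2 a)).const_mul _

theorem pd_reflect {f : E3 → ℝ} (hf : Differentiable ℝ f) (x : E3) (a : Fin 3) :
    pd a (fun y => f (x - y)) = fun y => -pd a f (x - y) := by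
  ext y
  have e1 : HasFDerivAt f (fderiv ℝ f (x - y)) (x - y) := (hf _).hasFDerivAt
  have e2 : HasFDerivAt (fun y : E3 => x - y) (-ContinuousLinearMap.id ℝ E3) y :=
    (hasFDerivAt_id y).const_sub x
  unfold pd
  change fderiv ℝ (f ∘ fun y => x - y) y _ = _
  rw [(e1.comp y e2).fderiv]
  simp

theorem Sm.reflect {f : E3 → ℝ} (hf : Sm f) (x : E3) : Sm (fun y => f (x - y)) :=
  fun n => (hf n).reflect x

/-- Integration by parts in the convolution variable. Together with `Sm.pd_cv` it lets derivatives
move freely between kernel, function and convolution. -/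
theorem cv_pd_left {K f : E3 → ℝ} (hK : Sm K) (hf : Sm f) (a : Fin 3) :
    cv (pd a K) f = cv K (pd a f) := by
  ext x
  have := integral_mul_pd hK (hf.reflect x) a
  rw [pd_reflect hf.diff] at this
  unfold cv
  simp only [mul_neg, integral_neg] at this
  linarith

/-! ### The Littlewood-Paley kernels -/

/-- The symbol of `P_0`. -/
def bandSym (φ : E3 → ℝ) (ξ : E3) : ℝ := φ ξ - φ ((2 : ℝ) • ξ)

/-- A symbol equal to one on the support of `bandSym`. -/
def fatSym (φ : E3 → ℝ) (ξ : E3) : ℝ := φ ((1 / 2 : ℝ) • ξ) - φ ((4 : ℝ) • ξ)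

/-- The symbol of the inverse Laplacian times `χ`. -/
def invLapSym (χ : E3 → ℝ) (ξ : E3) : ℝ := χ ξ / (4 * Real.pi ^ 2 * ‖ξ‖ ^ 2)

section Cutoff

variable {φ : E3 → ℝ}

theorem IsCutoff.sym (hφ : IsCutoff φ) : Sym φ :=
  ⟨hφ.smooth, HasCompactSupport.of_support_subset_isCompact (isCompact_closedBall (0 : E3) 2)
    fun ξ hξ => by
      by_contra h
      exact hξ (hφ.supp ξ (by simpa using h)), fun ξ => hφ.radial _ _ (norm_neg ξ)⟩

theorem Sym.comp_smul {χ : E3 → ℝ} (h : Sym χ) {c : ℝ} (hc : c ≠ 0) : Sym (fun ξ => χ (c • ξ)) :=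
  ⟨h.smooth.comp (by fun_prop), h.compact.comp_homeomorph (Homeomorph.smulOfNeZero c hc),
    fun ξ => by rw [smul_neg, h.even]⟩

theorem Sym.sub {χ χ' : E3 → ℝ} (h : Sym χ) (h' : Sym χ') : Sym (fun ξ => χ ξ - χ' ξ) :=
  ⟨h.smooth.sub h'.smooth, h.compact.sub h'.compact, fun ξ => by rw [h.even, h'.even]⟩

theorem IsCutoff.bandSym (hφ : IsCutoff φ) : Sym (bandSym φ) :=
  hφ.sym.sub (hφ.sym.comp_smul two_ne_zero)

theorem IsCutoff.fatSym (hφ : IsCutoff φ) : Sym (fatSym φ) :=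
  (hφ.sym.comp_smul (by norm_num)).sub (hφ.sym.comp_smul (by norm_num))

theorem IsCutoff.bandSym_eq_zero (hφ : IsCutoff φ) {ξ : E3} (h : ‖ξ‖ ≤ 1 / 2) :
    NSReg.bandSym φ ξ = 0 := by
  unfold NSReg.bandSym
  rw [hφ.eq_one ξ (by linarith), hφ.eq_one _ (by rw [norm_smul, Real.norm_ofNat]; linarith), sub_self]

theorem IsCutoff.fatSym_eq_zero (hφ : IsCutoff φ) {ξ : E3} (h : ‖ξ‖ ≤ 1 / 4) :
    NSReg.fatSym φ ξ = 0 := by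
  unfold NSReg.fatSym
  rw [hφ.eq_one _ (by rw [norm_smul, Real.norm_of_nonneg (by norm_num)]; linarith),
    hφ.eq_one _ (by rw [norm_smul, Real.norm_ofNat]; linarith), sub_self]

/-- On 1/2 < ‖ξ‖ ≤ 2 one has φ(ξ/2) = 1 and φ(4ξ) = 0. This is the reproducing property behind every
Bernstein inequality below: a Littlewood-Paley piece equals its own convolution with the fattened
kernel. -/
theorem IsCutoff.fat_mul_band (hφ : IsCutoff φ) (ξ : E3) :
    NSReg.fatSym φ ξ * NSReg.bandSym φ ξ = NSReg.bandSym φ ξ := by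
  rcases le_or_gt ‖ξ‖ (1 / 2) with h | h
  · rw [hφ.bandSym_eq_zero h, mul_zero]
  · rcases le_or_gt ‖ξ‖ 2 with h2 | h2
    · have : NSReg.fatSym φ ξ = 1 := by
        unfold NSReg.fatSym
        rw [hφ.eq_one _ (by rw [norm_smul, Real.norm_of_nonneg (by norm_num)]; linarith),
          hφ.supp _ (by rw [norm_smul, Real.norm_ofNat]; linarith), sub_zero]
      rw [this, one_mul]
    · have : NSReg.bandSym φ ξ = 0 := by
        unfold NSReg.bandSym
        rw [hφ.supp _ h2, hφ.supp _ (by rw [norm_smul, Real.norm_ofNat]; linarith), sub_zero]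
      rw [this, mul_zero]

/-- Division by ‖ξ‖² costs no smoothness because the symbol vanishes on a ball around the origin. -/
theorem Sym.invLapSym {χ : E3 → ℝ} (h : Sym χ) {r : ℝ} (hr : 0 < r)
    (h0 : ∀ ξ, ‖ξ‖ ≤ r → χ ξ = 0) : Sym (invLapSym χ) := by
  refine ⟨contDiff_iff_contDiffAt.2 fun ξ => ?_, ?_, fun ξ => ?_⟩
  · rcases eq_or_ne ξ 0 with rfl | hξ
    · have : NSReg.invLapSym χ =ᶠ[𝓝 0] fun _ => 0 := by
        filter_upwards [Metric.closedBall_mem_nhds (0 : E3) hr] with η hη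
        unfold NSReg.invLapSym
        rw [h0 η (by simpa using hη), zero_div]
      exact contDiffAt_const.congr_of_eventuallyEq this
    · refine h.smooth.contDiffAt.div ?_ ?_
      · exact contDiffAt_const.mul (contDiff_norm_sq ℝ).contDiffAt
      · have := norm_pos_iff.2 hξ
        positivity
  · exact h.compact.mul_right
  · unfold NSReg.invLapSym
    rw [h.even, norm_neg]

theorem invLapSym_mul {χ : E3 → ℝ} (h0 : χ 0 = 0) (ξ : E3) :
    χ ξ = 4 * Real.pi ^ 2 * ‖ξ‖ ^ 2 * invLapSym χ ξ := by
  rcases eq_or_ne ξ 0 with rfl | hξ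
  · simp [h0]
  · unfold invLapSym
    have := norm_pos_iff.2 hξ
    have := Real.pi_pos
    field_simp

theorem IsCutoff.invBand (hφ : IsCutoff φ) : Sym (invLapSym (NSReg.bandSym φ)) :=
  hφ.bandSym.invLapSym (r := 1 / 2) (by norm_num) fun _ h => hφ.bandSym_eq_zero h

theorem IsCutoff.invFat (hφ : IsCutoff φ) : Sym (invLapSym (NSReg.fatSym φ)) :=
  hφ.fatSym.invLapSym (r := 1 / 4) (by norm_num) fun _ h => hφ.fatSym_eq_zero h

end Cutoff

/-- The kernel of the low-pass filter at frequency `2^j`. -/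
def kS (φ : E3 → ℝ) (j : ℤ) : 𝓢(E3, ℝ) := ker (scl j φ)
/-- The kernel of `P_j`. -/
def kP (φ : E3 → ℝ) (j : ℤ) : 𝓢(E3, ℝ) := ker (scl j (bandSym φ))
/-- The kernel of the fattened projection. -/
def kF (φ : E3 → ℝ) (j : ℤ) : 𝓢(E3, ℝ) := ker (scl j (fatSym φ))
/-- The kernel of `(-Δ)⁻¹ P_j`. -/
def kN (φ : E3 → ℝ) (j : ℤ) : 𝓢(E3, ℝ) := ((2 : ℝ) ^ (-j)) ^ 2 • ker (scl j (invLapSym (bandSym φ)))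
/-- The kernel of the fattened `(-Δ)⁻¹ P_j`. -/
def kG (φ : E3 → ℝ) (j : ℤ) : 𝓢(E3, ℝ) := ((2 : ℝ) ^ (-j)) ^ 2 • ker (scl j (invLapSym (fatSym φ)))

section Kernels

variable {φ : E3 → ℝ}

theorem lpKernel_eq (hφ : IsCutoff φ) (j : ℤ) : lpKernel φ j = kP φ j := by
  ext x
  unfold kP
  rw [(hφ.bandSym.scl j).ker_apply]
  rfl

/-- Dilating the inverse Laplacian symbol produces a factor 2^{2j} relative to the true inverse
Laplacian of the dilated symbol; the prefactor 2^{-2j} compensates it. -/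
theorem laplacian_smul_ker {χ : E3 → ℝ} (h : Sym χ) (h' : Sym (invLapSym χ)) (h0 : χ 0 = 0) (j : ℤ)
    (x : E3) :
    ∑ a, pd a (pd a (((2 : ℝ) ^ (-j)) ^ 2 • ker (scl j (invLapSym χ)) : 𝓢(E3, ℝ))) x =
      -ker (scl j χ) x := by
  have e : ∀ a, pd a (pd a (((2 : ℝ) ^ (-j)) ^ 2 • ker (scl j (invLapSym χ)) : 𝓢(E3, ℝ))) x =
      ((2 : ℝ) ^ (-j)) ^ 2 * pd a (pd a (ker (scl j (invLapSym χ)))) x := by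
    intro a
    have hs := schwartz_sm (ker (scl j (invLapSym χ)))
    have := pd_const_mul hs.diff (((2 : ℝ) ^ (-j)) ^ 2) a
    have e1 : pd a (((2 : ℝ) ^ (-j)) ^ 2 • ker (scl j (invLapSym χ)) : 𝓢(E3, ℝ)) =
      fun x => ((2 : ℝ) ^ (-j)) ^ 2 * pd a (ker (scl j (invLapSym χ))) x := this
    rw [e1, pd_const_mul (hs.pd a).diff]
  simp_rw [e]
  rw [← Finset.mul_sum]
  have hsc : ∀ ξ, (fun ξ => 4 * Real.pi ^ 2 * ‖ξ‖ ^ 2 * scl j (invLapSym χ) ξ) ξ =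
      4 * Real.pi ^ 2 * ‖ξ‖ ^ 2 * scl j (invLapSym χ) ξ := fun _ => rfl
  have hval : ∀ ξ, 4 * Real.pi ^ 2 * ‖ξ‖ ^ 2 * scl j (invLapSym χ) ξ =
      ((2 : ℝ) ^ j) ^ 2 * scl j χ ξ := by
    intro ξ
    have h1 := invLapSym_mul h0 ((2 : ℝ) ^ (-j) • ξ)
    unfold scl
    rw [h1, norm_smul, zpow_neg, norm_inv, Real.norm_of_nonneg (by positivity : (0 : ℝ) ≤ 2 ^ j)]
    have : (2 : ℝ) ^ j ≠ 0 := by positivity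
    field_simp
  have hcoe : ∀ x, ker (fun ξ => 4 * Real.pi ^ 2 * ‖ξ‖ ^ 2 * scl j (invLapSym χ) ξ) x =
      ((2 : ℝ) ^ j) ^ 2 * ker (scl j χ) x := by
    intro x
    have hS : Sym (fun ξ => 4 * Real.pi ^ 2 * ‖ξ‖ ^ 2 * scl j (invLapSym χ) ξ) := by
      simp_rw [hval]
      exact ⟨contDiff_const.mul (h.scl j).smooth, (h.scl j).compact.mul_left,
        fun ξ => by rw [(h.scl j).even]⟩
    have : ((ker (fun ξ => 4 * Real.pi ^ 2 * ‖ξ‖ ^ 2 * scl j (invLapSym χ) ξ) x : ℝ) : ℂ) =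
        ((((2 : ℝ) ^ j) ^ 2 * ker (scl j χ) x : ℝ) : ℂ) := by
      rw [hS.ker_ofReal]
      simp_rw [hval]
      push_cast
      rw [(h.scl j).ker_ofReal, Real.fourierInv_eq', Real.fourierInv_eq', ← integral_const_mul]
      congr 1
      ext v
      simp only [smul_eq_mul]
      ring
    exact_mod_cast this
  have hS : Sym (fun ξ => 4 * Real.pi ^ 2 * ‖ξ‖ ^ 2 * scl j (invLapSym χ) ξ) := by
    simp_rw [hval]
    exact ⟨contDiff_const.mul (h.scl j).smooth, (h.scl j).compact.mul_left,
      fun ξ => by rw [(h.scl j).even]⟩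
  rw [(h'.scl j).laplacian_ker hS hsc, hcoe, zpow_neg]
  have : (2 : ℝ) ^ j ≠ 0 := by positivity
  field_simp


theorem laplacian_kN (hφ : IsCutoff φ) (j : ℤ) (x : E3) : ∑ a, pd a (pd a (kN φ j)) x = -kP φ j x :=
  laplacian_smul_ker hφ.bandSym hφ.invBand (hφ.bandSym_eq_zero (by simp)) j x


theorem laplacian_kG (hφ : IsCutoff φ) (j : ℤ) (x : E3) : ∑ a, pd a (pd a (kG φ j)) x = -kF φ j x :=
  laplacian_smul_ker hφ.fatSym hφ.invFat (hφ.fatSym_eq_zero (by simp)) j x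


theorem cv_kF_kP (hφ : IsCutoff φ) (j : ℤ) : cv (kF φ j) (kP φ j) = kP φ j := by
  unfold kF kP
  rw [(hφ.fatSym.scl j).cv_ker (hφ.bandSym.scl j)]
  have : (fun ξ => scl j (fatSym φ) ξ * scl j (bandSym φ) ξ) = scl j (bandSym φ) := by
    ext ξ
    exact hφ.fat_mul_band _
  rw [this]


theorem kP_eq_sub (hφ : IsCutoff φ) (j : ℤ) (x : E3) : kP φ j x = kS φ j x - kS φ (j - 1) x := by
  unfold kP kS
  have h1 := hφ.sym.scl j
  have h2 := hφ.sym.scl (j - 1)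
  have e : scl j (bandSym φ) = fun ξ => scl j φ ξ - scl (j - 1) φ ξ := by
    ext ξ
    unfold scl bandSym
    rw [smul_smul]
    congr 3
    rw [neg_sub, sub_eq_add_neg, zpow_add₀ two_ne_zero, zpow_one]
  have : ((ker (scl j (bandSym φ)) x : ℝ) : ℂ) =
      ((ker (scl j φ) x - ker (scl (j - 1) φ) x : ℝ) : ℂ) := by
    push_cast
    rw [(hφ.bandSym.scl j).ker_ofReal, h1.ker_ofReal, h2.ker_ofReal, e, Real.fourierInv_eq',
      Real.fourierInv_eq', Real.fourierInv_eq', ← integral_sub]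
    · congr 1
      ext v
      push_cast
      simp only [smul_eq_mul]
      ring
    all_goals
      refine Integrable.bdd_mul (c := 1) (Sym.integrableC (by assumption))
        (Continuous.aestronglyMeasurable (by fun_prop)) (Eventually.of_forall fun ξ => ?_)
      rw [Complex.norm_exp_ofReal_mul_I]
  exact_mod_cast this


/-- The shift by three is what the supports require: each low-pass symbol lives in ‖ξ‖ ≤ 2^{j-2}, so
sums of two such frequencies stay in ‖ξ‖ ≤ 2^{j-1}, where the symbol of the j-th band vanishes. -/
theorem integral_kN_kS_kS (hφ : IsCutoff φ) (j : ℤ) (w w' : E3) :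
    ∫ y, kN φ j y * (kS φ (j - 3) (w - y) * kS φ (j - 3) (w' - y)) = 0 := by
  have h0 : ∀ ξ η, scl j (invLapSym (bandSym φ)) (ξ + η) * scl (j - 3) φ ξ * scl (j - 3) φ η = 0 := by
    intro ξ η
    have h2 : (0 : ℝ) < 2 ^ (-j) := by positivity
    have e : ∀ ξ : E3, ‖(2 : ℝ) ^ (-(j - 3)) • ξ‖ = 8 * ‖(2 : ℝ) ^ (-j) • ξ‖ := by
      intro ξ
      rw [norm_smul, norm_smul, neg_sub, sub_eq_add_neg, zpow_add₀ two_ne_zero,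
        Real.norm_of_nonneg h2.le, Real.norm_of_nonneg (by positivity)]
      norm_num
      ring
    by_contra hne
    have h1 : scl (j - 3) φ η ≠ 0 := right_ne_zero_of_mul hne
    have h3 : scl (j - 3) φ ξ ≠ 0 := right_ne_zero_of_mul (left_ne_zero_of_mul hne)
    have h4 := left_ne_zero_of_mul (left_ne_zero_of_mul hne)
    have a1 : ‖(2 : ℝ) ^ (-(j - 3)) • η‖ ≤ 2 := by
      by_contra hc; exact h1 (hφ.supp _ (not_le.1 hc))
    have a2 : ‖(2 : ℝ) ^ (-(j - 3)) • ξ‖ ≤ 2 := by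
      by_contra hc; exact h3 (hφ.supp _ (not_le.1 hc))
    rw [e] at a1 a2
    apply h4
    unfold scl invLapSym
    rw [hφ.bandSym_eq_zero, zero_div]
    rw [smul_add]
    refine (norm_add_le _ _).trans (by linarith)
  have := integral_ker_mul_ker_mul_ker (hφ.invBand.scl j) (hφ.sym.scl (j - 3)) h0 w w'
  have e : ∀ y, kN φ j y * (kS φ (j - 3) (w - y) * kS φ (j - 3) (w' - y)) =
    ((2 : ℝ) ^ (-j)) ^ 2 * (ker (scl j (invLapSym (bandSym φ))) y *
      (ker (scl (j - 3) φ) (w - y) * ker (scl (j - 3) φ) (w' - y))) := by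
    intro y
    unfold kN kS
    rw [smul_apply, smul_eq_mul]
    ring
  simp_rw [e]
  rw [integral_const_mul, this, mul_zero]


theorem integral_kS_zero (hφ : IsCutoff φ) : ∫ x, kS φ 0 x = 1 := by
  have h := (hφ.sym.scl 0).fourier_ker 0
  rw [Real.fourier_eq'] at h
  simp only [inner_zero_right, mul_zero, Complex.ofReal_zero, zero_mul, Complex.exp_zero, one_smul] at h
  have h1 : scl 0 φ 0 = 1 := by
    unfold scl
    exact hφ.eq_one _ (by simp)
  rw [h1, integral_complex_ofReal] at h
  exact_mod_cast h


theorem kS_eq_dil (hφ : IsCutoff φ) (j : ℤ) : (kS φ j : E3 → ℝ) = dil j (kS φ 0) := by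
  unfold kS
  have : scl 0 φ = φ := by ext ξ; simp [scl]
  rw [hφ.sym.ker_scl j, this]

theorem pd_const_mul_dil (K : 𝓢(E3, ℝ)) (c : ℝ) (j : ℤ) (a : Fin 3) :
    pd a (fun x => c * dil j K x) = fun x => (c * (2 : ℝ) ^ j) * dil j
      (∂_{(EuclideanSpace.single a (1 : ℝ) : E3)} K : 𝓢(E3, ℝ)) x := by
  have hd : Differentiable ℝ (dil j K) := by
    unfold dil
    exact (K.differentiable.comp (differentiable_id.const_smul ((2 : ℝ) ^ j))).const_mul _
  rw [pd_const_mul hd, pd_dil K.differentiable, schwartz_pd]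
  ext x
  ring

/-- A common bound for the norms of the Littlewood-Paley kernels. -/
structure KBound (φ : E3 → ℝ) (M : ℝ) : Prop where
  one_le : 1 ≤ M
  l1_kP : ∀ j, l1 (kP φ j) ≤ M
  l1_kS : ∀ j, l1 (kS φ j) ≤ M
  l1_kF : ∀ j, l1 (kF φ j) ≤ M
  sup_kS : ∀ j x, |kS φ j x| ≤ M * ((2 : ℝ) ^ j) ^ 3
  sup_kF : ∀ j x, |kF φ j x| ≤ M * ((2 : ℝ) ^ j) ^ 3
  sup_kP : ∀ j x, |kP φ j x| ≤ M * ((2 : ℝ) ^ j) ^ 3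
  l1_kG : ∀ j, l1 (kG φ j) ≤ M * ((2 : ℝ) ^ (-j)) ^ 2
  l1_pd_kG : ∀ j a, l1 (pd a (kG φ j)) ≤ M * (2 : ℝ) ^ (-j)
  l1_pd3_kF : ∀ j a b c, l1 (pd a (pd b (pd c (kF φ j)))) ≤ M * ((2 : ℝ) ^ j) ^ 3
  l1_pd3_kN : ∀ j a b c, l1 (pd a (pd b (pd c (kN φ j)))) ≤ M * (2 : ℝ) ^ j

theorem exists_sup_bound (K : 𝓢(E3, ℝ)) : ∃ C, ∀ x, |K x| ≤ C := (schwartz_bl2 K).bdd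

theorem abs_dil_le {K : E3 → ℝ} {C : ℝ} (h : ∀ x, |K x| ≤ C) (j : ℤ) (x : E3) :
    |dil j K x| ≤ C * ((2 : ℝ) ^ j) ^ 3 := by
  unfold dil
  rw [abs_mul, abs_of_pos (by positivity), mul_comm]
  exact mul_le_mul_of_nonneg_right (h _) (by positivity)


/-- Every kernel is a power of 2^j times the dilation of one fixed Schwartz function. Dilation keeps
the L¹ norm, multiplies the supremum by 2^{3j}, and each derivative contributes 2^j, so finitely
many norms bound everything uniformly in j. -/
theorem exists_kBound (hφ : IsCutoff φ) : ∃ M, KBound φ M := by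
  have eP : ∀ j, (kP φ j : E3 → ℝ) = dil j (ker (bandSym φ)) := fun j => hφ.bandSym.ker_scl j
  have eF : ∀ j, (kF φ j : E3 → ℝ) = fun x => 1 * dil j (ker (fatSym φ)) x := fun j => by
    simp only [one_mul]; exact hφ.fatSym.ker_scl j
  have eS : ∀ j, (kS φ j : E3 → ℝ) = dil j (ker φ) := fun j => hφ.sym.ker_scl j
  have eG : ∀ j, (kG φ j : E3 → ℝ) =
      fun x => ((2 : ℝ) ^ (-j)) ^ 2 * dil j (ker (invLapSym (fatSym φ))) x := fun j => by
    rw [← hφ.invFat.ker_scl j]; rfl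
  have eN : ∀ j, (kN φ j : E3 → ℝ) =
      fun x => ((2 : ℝ) ^ (-j)) ^ 2 * dil j (ker (invLapSym (bandSym φ))) x := fun j => by
    rw [← hφ.invBand.ker_scl j]; rfl
  set d : Fin 3 → 𝓢(E3, ℝ) → 𝓢(E3, ℝ) :=
    fun a K => ∂_{(EuclideanSpace.single a (1 : ℝ) : E3)} K with hd
  obtain ⟨cS, hcS⟩ := exists_sup_bound (ker φ)
  obtain ⟨cF, hcF⟩ := exists_sup_bound (ker (fatSym φ))
  obtain ⟨cP, hcP⟩ := exists_sup_bound (ker (bandSym φ))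
  set G0 := ker (invLapSym (fatSym φ))
  set N0 := ker (invLapSym (bandSym φ))
  set F0 := ker (fatSym φ)
  set s1 := ∑ a, l1 (d a G0) with hs1
  set s3 := ∑ a, ∑ b, ∑ c, l1 (d a (d b (d c F0))) with hs3
  set n3 := ∑ a, ∑ b, ∑ c, l1 (d a (d b (d c N0))) with hn3
  have nn := l1_nonneg
  have hs1' : ∀ a, l1 (d a G0) ≤ s1 := fun a =>
    Finset.single_le_sum (f := fun a => l1 (d a G0)) (fun _ _ => nn _) (Finset.mem_univ a)
  have h3 : ∀ (K : 𝓢(E3, ℝ)) a b c, l1 (d a (d b (d c K))) ≤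
      ∑ a, ∑ b, ∑ c, l1 (d a (d b (d c K))) := by
    intro K a b c
    refine le_trans ?_ (Finset.single_le_sum (f := fun a => ∑ b, ∑ c, l1 (d a (d b (d c K))))
      (fun _ _ => Finset.sum_nonneg fun _ _ => Finset.sum_nonneg fun _ _ => nn _)
      (Finset.mem_univ a))
    refine le_trans ?_ (Finset.single_le_sum (f := fun b => ∑ c, l1 (d a (d b (d c K))))
      (fun _ _ => Finset.sum_nonneg fun _ _ => nn _) (Finset.mem_univ b))
    exact Finset.single_le_sum (f := fun c => l1 (d a (d b (d c K)))) (fun _ _ => nn _)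
      (Finset.mem_univ c)
  have p1 : 0 ≤ s1 := Finset.sum_nonneg fun _ _ => nn _
  have p2 : 0 ≤ s3 := Finset.sum_nonneg fun _ _ => Finset.sum_nonneg fun _ _ =>
    Finset.sum_nonneg fun _ _ => nn _
  have p3 : 0 ≤ n3 := Finset.sum_nonneg fun _ _ => Finset.sum_nonneg fun _ _ =>
    Finset.sum_nonneg fun _ _ => nn _
  have p4 : 0 ≤ cS := (abs_nonneg _).trans (hcS 0)
  have p5 : 0 ≤ cF := (abs_nonneg _).trans (hcF 0)
  have p9 : 0 ≤ cP := (abs_nonneg _).trans (hcP 0)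
  have p6 := nn (ker (bandSym φ))
  have p7 := nn (ker φ)
  have p8 := nn F0
  have p10 := nn G0
  refine ⟨1 + cS + cF + cP + s1 + s3 + n3 + l1 (ker (bandSym φ)) + l1 (ker φ) + l1 F0 + l1 G0, ?_⟩
  refine ⟨by linarith, fun j => ?_, fun j => ?_, fun j => ?_, fun j x => ?_, fun j x => ?_,
    fun j x => ?_, fun j => ?_, fun j a => ?_, fun j a b c => ?_, fun j a b c => ?_⟩
  · rw [eP, l1_dil]; linarith
  · rw [eS, l1_dil]; linarith
  · rw [eF, l1_const_mul, l1_dil, abs_one, one_mul]; linarith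
  · rw [eS]
    exact (abs_dil_le hcS j x).trans (mul_le_mul_of_nonneg_right (by linarith) (by positivity))
  · rw [eF]
    simp only [one_mul]
    exact (abs_dil_le hcF j x).trans (mul_le_mul_of_nonneg_right (by linarith) (by positivity))
  · rw [eP]
    exact (abs_dil_le hcP j x).trans (mul_le_mul_of_nonneg_right (by linarith) (by positivity))
  · rw [eG, l1_const_mul, l1_dil, abs_of_pos (by positivity), mul_comm]
    exact mul_le_mul_of_nonneg_right (by linarith) (by positivity)
  · rw [eG, pd_const_mul_dil, l1_const_mul, l1_dil, abs_of_pos (by positivity), mul_comm]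
    have e : ((2 : ℝ) ^ (-j)) ^ 2 * 2 ^ j = 2 ^ (-j) := by
      rw [zpow_neg]
      have : (2 : ℝ) ^ j ≠ 0 := by positivity
      field_simp
    rw [e]
    exact mul_le_mul_of_nonneg_right (by linarith [hs1' a]) (by positivity)
  · rw [eF, pd_const_mul_dil, pd_const_mul_dil, pd_const_mul_dil, l1_const_mul, l1_dil,
      abs_of_pos (by positivity), mul_comm]
    have e : 1 * (2 : ℝ) ^ j * 2 ^ j * 2 ^ j = (2 ^ j) ^ 3 := by ring
    rw [e]
    exact mul_le_mul_of_nonneg_right (by linarith [h3 F0 a b c]) (by positivity)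
  · rw [eN, pd_const_mul_dil, pd_const_mul_dil, pd_const_mul_dil, l1_const_mul, l1_dil,
      abs_of_pos (by positivity), mul_comm]
    have e : ((2 : ℝ) ^ (-j)) ^ 2 * (2 : ℝ) ^ j * 2 ^ j * 2 ^ j = 2 ^ j := by
      rw [zpow_neg]
      have : (2 : ℝ) ^ j ≠ 0 := by positivity
      field_simp
    rw [e]
    exact mul_le_mul_of_nonneg_right (by linarith [h3 N0 a b c]) (by positivity)

end Kernels

/-! ### The `L^100` norm -/

theorem abs_pow_ninetyEight (x : ℝ) : |x| ^ 98 = x ^ 98 := by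
  rw [← abs_pow, abs_of_nonneg (by positivity)]

theorem abs_pow_hundred (x : ℝ) : |x| ^ 100 = x ^ 100 := by
  rw [← abs_pow, abs_of_nonneg (by positivity)]

/-- The `L^100` norm. -/
def nm (f : E3 → ℝ) : ℝ := lpNorm f 100 volume

theorem nm_nonneg (f : E3 → ℝ) : 0 ≤ nm f := lpNorm_nonneg

theorem BL2.integrable_pow {f : E3 → ℝ} (hf : BL2 f) {n : ℕ} (hn : 2 ≤ n) :
    Integrable (fun x => f x ^ n) := by
  have h : ∀ m : ℕ, BL2 (fun x => f x ^ (m + 1)) := by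
    intro m
    induction m with
    | zero => simpa using hf
    | succ m ih => simpa only [pow_succ _ (m + 1)] using ih.mul hf
  obtain ⟨m, rfl⟩ := Nat.exists_eq_add_of_le hn
  refine ((h m).integrable_mul hf).congr (Eventually.of_forall fun x => ?_)
  simp only; ring

theorem BL2.memLp_hundred {f : E3 → ℝ} (hf : BL2 f) : MemLp f 100 volume := by
  rw [← integrable_norm_rpow_iff hf.cont.aestronglyMeasurable (by norm_num) (by norm_num)]
  refine (hf.integrable_pow (n := 100) (by norm_num)).congr (Eventually.of_forall fun x => ?_)
  simp only [ENNReal.toReal_ofNat, Real.rpow_ofNat, Real.norm_eq_abs]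
  rw [abs_pow_hundred]

theorem nm_pow {f : E3 → ℝ} (hf : BL2 f) : nm f ^ 100 = ∫ x, f x ^ 100 := by
  unfold nm
  rw [lpNorm_eq_integral_norm_rpow_toReal (by norm_num) (by norm_num)
    hf.cont.aestronglyMeasurable]
  simp only [ENNReal.toReal_ofNat, Real.rpow_ofNat, Real.norm_eq_abs]
  rw [← Real.rpow_natCast, ← Real.rpow_mul (integral_nonneg fun _ => pow_nonneg (abs_nonneg _) _)]
  norm_num
  exact integral_congr_ae (Eventually.of_forall fun x => abs_pow_hundred (f x))

theorem nm_add_le {f g : E3 → ℝ} (hf : BL2 f) : nm (fun x => f x + g x) ≤ nm f + nm g :=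
  lpNorm_add_le hf.memLp_hundred (by norm_num)

theorem nm_sum_le {f : Fin 3 → E3 → ℝ} (hf : ∀ a, BL2 (f a)) :
    nm (fun x => ∑ a, f a x) ≤ ∑ a, nm (f a) := by
  simp only [Fin.sum_univ_three]
  exact (nm_add_le ((hf 0).add (hf 1))).trans (add_le_add_left (nm_add_le (hf 0)) _)

theorem nm_neg (f : E3 → ℝ) : nm (fun x => -f x) = nm f := lpNorm_fun_neg _ _ _

theorem nm_const_mul (c : ℝ) (f : E3 → ℝ) : nm (fun x => c * f x) = |c| * nm f := by
  have := lpNorm_const_smul (p := 100) c f (volume : Measure E3)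
  simpa [nm, Pi.smul_def] using this

theorem l1_eq_lintegral {K : E3 → ℝ} (hK : Integrable K) :
    ∫⁻ x, ‖K x‖ₑ = ENNReal.ofReal (l1 K) := (ofReal_integral_norm_eq_lintegral_enorm hK).symm

theorem nm_cv_le {K f : E3 → ℝ} (hK : Integrable K) (hf : BL2 f) : nm (cv K f) ≤ l1 K * nm f := by
  have h := eLpNorm_cv_le hK.1 hf.memLp.1 (p := 100) (by norm_num) (by norm_num)
  rw [eLpNorm_one_eq_lintegral_enorm, l1_eq_lintegral hK, ← ofReal_lpNorm hf.memLp_hundred,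
    ← ofReal_lpNorm (hf.cv hK).memLp_hundred, ← ENNReal.ofReal_mul (l1_nonneg K)] at h
  exact (ENNReal.ofReal_le_ofReal_iff (mul_nonneg (l1_nonneg K) lpNorm_nonneg)).1 h

theorem nm_mono {f g : E3 → ℝ} (hf : BL2 f) (hg : BL2 g) (h : ∀ x, |f x| ≤ |g x|) :
    nm f ≤ nm g := by
  refine le_of_pow_le_pow_left₀ (n := 100) (by norm_num) (nm_nonneg g) ?_
  rw [nm_pow hf, nm_pow hg]
  refine integral_mono (hf.integrable_pow (by norm_num)) (hg.integrable_pow (by norm_num))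
    fun x => ?_
  simp only
  rw [← abs_pow_hundred (f x), ← abs_pow_hundred (g x)]
  exact pow_le_pow_left₀ (abs_nonneg _) (h x) _

theorem nm_mul_le {f g : E3 → ℝ} (hf : BL2 f) (hg : BL2 g) {C : ℝ} (hC : ∀ x, |f x| ≤ C) :
    nm (fun x => f x * g x) ≤ C * nm g := by
  have hC0 : 0 ≤ C := (abs_nonneg _).trans (hC 0)
  have := nm_mono (hf.mul hg) (hg.const_mul C) fun x => by
    rw [abs_mul, abs_mul, abs_of_nonneg hC0]
    exact mul_le_mul_of_nonneg_right (hC x) (abs_nonneg _)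
  rwa [nm_const_mul, abs_of_nonneg hC0] at this

/-- Pointwise bounds for convolutions. -/
theorem abs_cv_pow_le {K f : E3 → ℝ} (hK : Integrable K) {S : ℝ} (hS : ∀ x, |K x| ≤ S)
    (hf : BL2 f) {n : ℕ} (hn : 2 ≤ n) (x : E3) :
    |cv K f x| ^ n ≤ l1 K ^ (n - 1) * S * ∫ x, |f x| ^ n := by
  have hS0 : 0 ≤ S := (abs_nonneg _).trans (hS 0)
  have hn1 : (1 : ℝ) ≤ n := by exact_mod_cast (by omega : 1 ≤ n)
  have hfx : AEMeasurable (fun y => ‖f (x - y)‖ₑ) volume :=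
    (hf.cont.comp (continuous_const.sub continuous_id)).aestronglyMeasurable.enorm
  have h1 := lintegral_mul_rpow_le hK.1.enorm hfx hn1 (by simp)
  have h2 : ∫⁻ y, ‖K y‖ₑ * ‖f (x - y)‖ₑ ^ (n : ℝ) ≤ ENNReal.ofReal S * ∫⁻ y, ‖f y‖ₑ ^ (n : ℝ) := by
    rw [← lintegral_const_mul' _ _ (by simp), ← lintegral_sub_left_eq_self (fun y => ENNReal.ofReal S * ‖f y‖ₑ ^ (n : ℝ)) x]
    refine lintegral_mono fun y => ?_
    refine mul_le_mul' ?_ le_rfl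
    rw [Real.enorm_eq_ofReal_abs]
    exact ENNReal.ofReal_le_ofReal (hS y)
  have h3 : ∫⁻ y, ‖f y‖ₑ ^ (n : ℝ) = ENNReal.ofReal (∫ x, |f x| ^ n) := by
    have hi : Integrable (fun x => |f x| ^ n) :=
      (hf.integrable_pow hn).abs.congr (Eventually.of_forall fun x => abs_pow _ _)
    have := ofReal_integral_norm_eq_lintegral_enorm hi
    simp only [Real.norm_eq_abs, abs_pow, abs_abs] at this
    rw [this]
    congr 1; ext y
    rw [ENNReal.rpow_natCast, enorm_pow]
    simp
  have h4 : ‖cv K f x‖ₑ ≤ ∫⁻ y, ‖K y‖ₑ * ‖f (x - y)‖ₑ := by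
    refine (enorm_integral_le_lintegral_enorm _).trans (le_of_eq ?_)
    simp only [enorm_mul]
  have h5 := (ENNReal.rpow_le_rpow h4 (by linarith : (0 : ℝ) ≤ n)).trans
    (h1.trans (mul_le_mul' le_rfl h2))
  rw [h3, l1_eq_lintegral hK, ENNReal.rpow_natCast,
    ENNReal.ofReal_rpow_of_nonneg (l1_nonneg K) (by linarith), Real.enorm_eq_ofReal_abs,
    ← ENNReal.ofReal_pow (abs_nonneg _), ← ENNReal.ofReal_mul hS0,
    ← ENNReal.ofReal_mul (Real.rpow_nonneg (l1_nonneg K) _)] at h5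
  have h6 : 0 ≤ ∫ x, |f x| ^ n := integral_nonneg fun _ => by positivity
  have h7 := (ENNReal.ofReal_le_ofReal_iff (mul_nonneg (Real.rpow_nonneg (l1_nonneg K) _)
    (mul_nonneg hS0 h6))).1 h5
  have h8 : (n : ℝ) - 1 = ((n - 1 : ℕ) : ℝ) := by
    rw [Nat.cast_sub (by omega)]; simp
  rw [h8, Real.rpow_natCast] at h7
  rwa [mul_assoc]

/-! ### Littlewood-Paley pieces of smooth functions -/

/-- The Littlewood-Paley piece `P_j f`. -/
def lp (φ : E3 → ℝ) (j : ℤ) (f : E3 → ℝ) : E3 → ℝ := cv (kP φ j) f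

section Pieces

variable {φ : E3 → ℝ} {M : ℝ}

theorem lp_sm {f : E3 → ℝ} (hf : Sm f) (j : ℤ) : Sm (lp φ j f) := hf.cv (kP φ j).integrable

theorem cv_kF_lp (hφ : IsCutoff φ) {f : E3 → ℝ} (hf : BL2 f) (j : ℤ) :
    cv (kF φ j) (lp φ j f) = lp φ j f := by
  unfold lp
  rw [← cv_assoc (kF φ j).integrable (kP φ j).integrable hf, cv_kF_kP hφ]

theorem cv_laplacian_kG (hφ : IsCutoff φ) {f : E3 → ℝ} (hf : BL2 f) (j : ℤ) (x : E3) :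
    ∑ a, cv (pd a (pd a (kG φ j))) f x = -cv (kF φ j) f x := by
  have hi : ∀ a, Integrable (pd a (pd a (kG φ j))) := fun a => by
    rw [schwartz_pd]; exact integrable_pd _ a
  have h1 := congrFun (cv_sum_left hi hf) x
  rw [← h1]
  have h2 : (fun x => ∑ a, pd a (pd a (kG φ j)) x) = fun x => -kF φ j x :=
    funext fun x => laplacian_kG hφ j x
  rw [h2, cv_neg_left]

/-- The Bernstein inequality bounding `P_j f` by its Laplacian. -/
theorem nm_lp_le (hφ : IsCutoff φ) (hM : KBound φ M) {f : E3 → ℝ} (hf : Sm f) (j : ℤ) :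
    nm (lp φ j f) ≤ M * ((2 : ℝ) ^ (-j)) ^ 2 * ∑ a, nm (pd a (pd a (lp φ j f))) := by
  have hs := lp_sm (φ := φ) hf j
  have hG := schwartz_sm (kG φ j)
  have h1 : lp φ j f = fun x => -∑ a, cv (kG φ j) (pd a (pd a (lp φ j f))) x := by
    ext x
    have := cv_laplacian_kG hφ hs.bl2 j x
    rw [cv_kF_lp hφ hf.bl2] at this
    have e : ∀ a, cv (pd a (pd a (kG φ j))) (lp φ j f) = cv (kG φ j) (pd a (pd a (lp φ j f))) :=
      fun a => by rw [cv_pd_left (hG.pd a) hs, cv_pd_left hG (hs.pd a)]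
    simp_rw [e] at this
    linarith
  have h2 : nm (lp φ j f) = nm (fun x => ∑ a, cv (kG φ j) (pd a (pd a (lp φ j f))) x) := by
    conv_lhs => rw [h1]
    exact nm_neg _
  rw [h2, Finset.mul_sum]
  refine (nm_sum_le fun a => (((hs.pd a).pd a).cv (kG φ j).integrable).bl2).trans
    (Finset.sum_le_sum fun a _ => ?_)
  refine (nm_cv_le (kG φ j).integrable ((hs.pd a).pd a).bl2).trans ?_
  exact mul_le_mul_of_nonneg_right (hM.l1_kG j) (nm_nonneg _)

theorem integrable_pd3 (K : 𝓢(E3, ℝ)) (a b c : Fin 3) : Integrable (pd a (pd b (pd c K))) := by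
  rw [schwartz_pd, schwartz_pd]; exact integrable_pd _ _

theorem pd3_cv_left {K : 𝓢(E3, ℝ)} {f : E3 → ℝ} (hf : Sm f) (a b c : Fin 3) :
    cv (pd a (pd b (pd c K))) f = pd c (pd b (pd a (cv K f))) := by
  have hK := schwartz_sm K
  rw [cv_pd_left ((hK.pd c).pd b) hf, cv_pd_left (hK.pd c) (hf.pd a),
    cv_pd_left hK ((hf.pd a).pd b), hf.pd_cv K.integrable, (hf.pd a).pd_cv K.integrable,
    ((hf.pd a).pd b).pd_cv K.integrable]

/-- The Bernstein inequality for third derivatives of `P_j f`. -/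
theorem nm_pd3_lp_le (hφ : IsCutoff φ) (hM : KBound φ M) {f : E3 → ℝ} (hf : Sm f) (j : ℤ)
    (a b c : Fin 3) :
    nm (pd a (pd b (pd c (lp φ j f)))) ≤ M * ((2 : ℝ) ^ j) ^ 3 * nm (lp φ j f) := by
  have hs := lp_sm (φ := φ) hf j
  have h := pd3_cv_left (K := kF φ j) hs c b a
  rw [cv_kF_lp hφ hf.bl2] at h
  rw [← h]
  refine (nm_cv_le (integrable_pd3 _ _ _ _) hs.bl2).trans ?_
  exact mul_le_mul_of_nonneg_right (hM.l1_pd3_kF j _ _ _) (nm_nonneg _)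

theorem abs_lp_sq_le (hM : KBound φ M) {f : E3 → ℝ} (hf : BL2 f) (j : ℤ) (x : E3) :
    |lp φ j f x| ^ 2 ≤ M ^ 2 * ((2 : ℝ) ^ j) ^ 3 * ∫ x, |f x| ^ 2 := by
  have h := abs_cv_pow_le (kP φ j).integrable (hM.sup_kP j) hf (n := 2) le_rfl x
  refine h.trans (mul_le_mul_of_nonneg_right ?_ (integral_nonneg fun _ => by positivity))
  have hM0 : 0 ≤ M := zero_le_one.trans hM.one_le
  have := mul_le_mul_of_nonneg_right (hM.l1_kP j) (by positivity : 0 ≤ M * ((2 : ℝ) ^ j) ^ 3)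
  simp only [Nat.reduceSub, pow_one]
  linarith

theorem abs_low_sq_le (hM : KBound φ M) {f : E3 → ℝ} (hf : BL2 f) (x : E3) :
    |cv (kS φ 0) f x| ^ 2 ≤ M ^ 2 * ∫ x, |f x| ^ 2 := by
  have h := abs_cv_pow_le (kS φ 0).integrable (hM.sup_kS 0) hf (n := 2) le_rfl x
  refine h.trans (mul_le_mul_of_nonneg_right ?_ (integral_nonneg fun _ => by positivity))
  have hM0 : 0 ≤ M := zero_le_one.trans hM.one_le
  have := mul_le_mul_of_nonneg_right (hM.l1_kS 0) hM0
  simp only [Nat.reduceSub, pow_one, zpow_zero, one_pow, mul_one]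
  linarith

theorem abs_lp_pow_le (hφ : IsCutoff φ) (hM : KBound φ M) {f : E3 → ℝ} (hf : Sm f) (j : ℤ)
    (x : E3) : |lp φ j f x| ^ 100 ≤ M ^ 100 * ((2 : ℝ) ^ j) ^ 3 * nm (lp φ j f) ^ 100 := by
  have hs := (lp_sm (φ := φ) hf j).bl2
  have h := abs_cv_pow_le (kF φ j).integrable (hM.sup_kF j) hs (n := 100) (by norm_num) x
  rw [cv_kF_lp hφ hf.bl2] at h
  have e : ∫ x, |lp φ j f x| ^ 100 = nm (lp φ j f) ^ 100 := by
    rw [nm_pow hs]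
    exact integral_congr_ae (Eventually.of_forall fun x => abs_pow_hundred _)
  rw [e] at h
  refine h.trans (mul_le_mul_of_nonneg_right ?_ (pow_nonneg (nm_nonneg _) 100))
  have hM0 : 0 ≤ M := zero_le_one.trans hM.one_le
  have h1 := pow_le_pow_left₀ (l1_nonneg _) (hM.l1_kF j) 99
  calc _ ≤ M ^ 99 * (M * ((2 : ℝ) ^ j) ^ 3) :=
        mul_le_mul_of_nonneg_right h1 (by positivity)
    _ = _ := by ring

/-! #### Dissipation -/

theorem pow_mul_sq_le (x y : ℝ) : x ^ 98 * y ^ 2 ≤ x ^ 100 + y ^ 100 := by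
  have hx : x ^ 98 = |x| ^ 98 := (abs_pow_ninetyEight x).symm
  have hx' : x ^ 100 = |x| ^ 100 := (abs_pow_hundred x).symm
  have hy : y ^ 2 = |y| ^ 2 := (sq_abs y).symm
  have hy' : y ^ 100 = |y| ^ 100 := (abs_pow_hundred y).symm
  rw [hx, hx', hy, hy']
  have h1 := abs_nonneg x
  have h2 := abs_nonneg y
  have p1 : 0 ≤ |x| ^ 100 := pow_nonneg h1 _
  have p2 : 0 ≤ |y| ^ 100 := pow_nonneg h2 _
  rcases le_total |x| |y| with h | h
  · have := mul_le_mul_of_nonneg_right (pow_le_pow_left₀ h1 h 98) (pow_nonneg h2 2)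
    have e : |y| ^ 98 * |y| ^ 2 = |y| ^ 100 := (pow_add _ _ _).symm
    linarith
  · have := mul_le_mul_of_nonneg_left (pow_le_pow_left₀ h2 h 2) (pow_nonneg h1 98)
    have e : |x| ^ 98 * |x| ^ 2 = |x| ^ 100 := (pow_add _ _ _).symm
    linarith

theorem pow_mul_le (x y : ℝ) : x ^ 99 * y ≤ x ^ 100 + y ^ 100 := by
  have hx' : x ^ 100 = |x| ^ 100 := (abs_pow_hundred x).symm
  have hy' : y ^ 100 = |y| ^ 100 := (abs_pow_hundred y).symm
  have h0 : x ^ 99 * y ≤ |x| ^ 99 * |y| := by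
    rw [← abs_pow, ← abs_mul]; exact le_abs_self _
  refine h0.trans ?_
  rw [hx', hy']
  have h1 := abs_nonneg x
  have h2 := abs_nonneg y
  have p1 : 0 ≤ |x| ^ 100 := pow_nonneg h1 _
  have p2 : 0 ≤ |y| ^ 100 := pow_nonneg h2 _
  rcases le_total |x| |y| with h | h
  · have := mul_le_mul_of_nonneg_right (pow_le_pow_left₀ h1 h 99) h2
    have e : |y| ^ 99 * |y| = |y| ^ 100 := (pow_succ _ _).symm
    linarith
  · have := mul_le_mul_of_nonneg_left h (pow_nonneg h1 99)
    have e : |x| ^ 99 * |x| = |x| ^ 100 := (pow_succ _ _).symm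
    linarith

/-- Replaces Hölder with exponents 100/98 and 50: rescaling `h` by ε⁻¹ makes both terms of
`pow_mul_sq_le` comparable to the integral of f^100, at the price of the factor 2. -/
theorem integral_pow_mul_sq_le {f h : E3 → ℝ} (hf : BL2 f) (hh : BL2 h) {ε : ℝ} (hε : 0 < ε)
    (hn : nm h ≤ ε * nm f) : ∫ x, f x ^ 98 * h x ^ 2 ≤ 2 * ε ^ 2 * ∫ x, f x ^ 100 := by
  have hif := hf.integrable_pow (n := 100) (by norm_num)
  have hih := hh.integrable_pow (n := 100) (by norm_num)
  have h1 : ∀ x, f x ^ 98 * h x ^ 2 ≤ ε ^ 2 * (f x ^ 100 + (ε⁻¹) ^ 100 * h x ^ 100) := by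
    intro x
    have := mul_le_mul_of_nonneg_left (pow_mul_sq_le (f x) (ε⁻¹ * h x)) (sq_nonneg ε)
    rw [mul_pow, mul_pow] at this
    refine le_trans (le_of_eq ?_) this
    field_simp
  have hi2 : Integrable (fun x => ε ^ 2 * (f x ^ 100 + (ε⁻¹) ^ 100 * h x ^ 100)) :=
    (hif.add (hih.const_mul _)).const_mul _
  have h2 : ∫ x, f x ^ 98 * h x ^ 2 ≤ ∫ x, ε ^ 2 * (f x ^ 100 + (ε⁻¹) ^ 100 * h x ^ 100) :=
    integral_mono_of_nonneg (Eventually.of_forall fun x => by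
      simp only [Pi.zero_apply]; positivity) hi2 (Eventually.of_forall h1)
  refine h2.trans ?_
  rw [integral_const_mul, integral_add hif (hih.const_mul _), integral_const_mul, ← nm_pow hf,
    ← nm_pow hh]
  have h3 := pow_le_pow_left₀ (nm_nonneg h) hn 100
  have h4 : (ε⁻¹) ^ 100 * nm h ^ 100 ≤ nm f ^ 100 := by
    refine (mul_le_mul_of_nonneg_left h3 (by positivity)).trans (le_of_eq ?_)
    rw [mul_pow, ← mul_assoc, ← mul_pow, inv_mul_cancel₀ hε.ne', one_pow, one_mul]
  have := mul_le_mul_of_nonneg_left h4 (sq_nonneg ε)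
  nlinarith

/-- A frequency-localised f is minus the divergence of h_a = ∂_a G * f, where G is the fattened
inverse Laplacian kernel and h_a is smaller than f by a factor M 2^{-j}. Testing with f^99 and
integrating by parts produces f^98 ∂_a f h_a, and Young's inequality separates the gradient from
h_a. -/
theorem dissipation (hφ : IsCutoff φ) (hM : KBound φ M) {g : E3 → ℝ} (hg : Sm g) (j : ℤ) :
    ∫ x, lp φ j g x ^ 100 ≤ 60000 * M ^ 2 * ((2 : ℝ) ^ (-j)) ^ 2 *
      ∑ a, ∫ x, lp φ j g x ^ 98 * pd a (lp φ j g) x ^ 2 := by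
  set f := lp φ j g with hf
  have hs : Sm f := lp_sm hg j
  have hG := schwartz_sm (kG φ j)
  have hM0 : 0 < M := zero_lt_one.trans_le hM.one_le
  set ε := M * (2 : ℝ) ^ (-j) with hε
  have hε0 : 0 < ε := by positivity
  set h : Fin 3 → E3 → ℝ := fun a => cv (pd a (kG φ j)) f with hh
  have hhs : ∀ a, Sm (h a) := fun a => hs.cv (integrable_pd _ _)
  have hhn : ∀ a, nm (h a) ≤ ε * nm f := fun a =>
    (nm_cv_le (integrable_pd _ _) hs.bl2).trans
      (mul_le_mul_of_nonneg_right (hM.l1_pd_kG j a) (nm_nonneg _))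
  have hsum : ∀ x, f x = -∑ a, pd a (h a) x := by
    intro x
    have h1 := cv_laplacian_kG hφ hs.bl2 j x
    rw [hf, cv_kF_lp hφ hg.bl2, ← hf] at h1
    have e : ∀ a, pd a (h a) = cv (pd a (pd a (kG φ j))) f := fun a => by
      rw [hh, hs.pd_cv (integrable_pd _ _), cv_pd_left (hG.pd a) hs]
    simp_rw [e]
    linarith
  have h99 : Sm (fun x => f x ^ 99) := hs.pow (by norm_num)
  have hIBP : ∀ a, -∫ x, f x ^ 99 * pd a (h a) x = ∫ x, 99 * f x ^ 98 * pd a f x * h a x := by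
    intro a
    rw [integral_mul_pd h99 (hhs a), pd_pow hs.diff, neg_neg]
    norm_num
  have hi1 : ∀ a, Integrable (fun x => f x ^ 99 * pd a (h a) x) := fun a =>
    h99.integrable_mul ((hhs a).pd a)
  have hi2 : ∀ a, Integrable (fun x => f x ^ 98 * pd a f x ^ 2) := fun a =>
    (hs.pow (by norm_num)).integrable_mul ((hs.pd a).pow (by norm_num))
  have hi3 : ∀ a, Integrable (fun x => f x ^ 98 * h a x ^ 2) := fun a =>
    (hs.pow (by norm_num)).integrable_mul ((hhs a).pow (by norm_num))
  have hi4 : ∀ a, Integrable (fun x => 99 * f x ^ 98 * pd a f x * h a x) := fun a =>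
    ((((hs.pow (by norm_num)).const_mul 99).mul (hs.pd a))).integrable_mul (hhs a)
  have hy : ∫ x, f x ^ 100 = ∑ a, ∫ x, 99 * f x ^ 98 * pd a f x * h a x := by
    have e : ∀ x, f x ^ 100 = -∑ a, f x ^ 99 * pd a (h a) x := by
      intro x
      rw [← Finset.mul_sum, ← mul_neg, ← hsum]; ring
    simp_rw [e]
    rw [integral_neg, integral_finsetSum _ fun a _ => hi1 a, ← Finset.sum_neg_distrib]
    exact Finset.sum_congr rfl fun a _ => hIBP a
  -- With this weight each of the three error terms is 1/6 of the integral of f^100. Half of the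
  -- left side is absorbed, whence the final constant 60000 = 2 · 30000.
  set α := 30000 * ε ^ 2 with hα
  have hα0 : 0 < α := by positivity
  have hb : ∀ a, ∫ x, 99 * f x ^ 98 * pd a f x * h a x ≤
      α * (∫ x, f x ^ 98 * pd a f x ^ 2) + (10000 / (4 * α)) * (2 * ε ^ 2 * ∫ x, f x ^ 100) := by
    intro a
    have hc := integral_pow_mul_sq_le hs.bl2 (hhs a).bl2 hε0 (hhn a)
    have hm : ∫ x, 99 * f x ^ 98 * pd a f x * h a x ≤
        ∫ x, α * (f x ^ 98 * pd a f x ^ 2) + (10000 / (4 * α)) * (f x ^ 98 * h a x ^ 2) := by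
      refine integral_mono (hi4 a) (((hi2 a).const_mul _).add ((hi3 a).const_mul _)) fun x => ?_
      simp only
      have e1 : 99 * (pd a f x * h a x) ≤ α * pd a f x ^ 2 + (10000 / (4 * α)) * h a x ^ 2 := by
        have h1 : 0 ≤ α * (pd a f x - 99 / (2 * α) * h a x) ^ 2 := by positivity
        have h2 : α * (pd a f x - 99 / (2 * α) * h a x) ^ 2 = α * pd a f x ^ 2 -
            99 * (pd a f x * h a x) + 9801 / (4 * α) * h a x ^ 2 := by
          field_simp
          ring
        have h3 : 9801 / (4 * α) * h a x ^ 2 ≤ 10000 / (4 * α) * h a x ^ 2 := by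
          gcongr; norm_num
        linarith
      have e2 : 0 ≤ f x ^ 98 := by positivity
      have := mul_le_mul_of_nonneg_left e1 e2
      linarith
    rw [integral_add ((hi2 a).const_mul _) ((hi3 a).const_mul _), integral_const_mul,
      integral_const_mul] at hm
    have := mul_le_mul_of_nonneg_left hc (by positivity : 0 ≤ 10000 / (4 * α))
    linarith
  have hfin := hy.le.trans (Finset.sum_le_sum fun a _ => hb a)
  rw [Finset.sum_add_distrib, ← Finset.mul_sum] at hfin
  have e : (10000 / (4 * α)) * (2 * ε ^ 2 * ∫ x, f x ^ 100) = (1 / 6) * ∫ x, f x ^ 100 := by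
    rw [hα]; field_simp; ring
  rw [e] at hfin
  simp only [Finset.sum_const, Finset.card_univ, Fintype.card_fin, nsmul_eq_mul, Nat.cast_ofNat]
    at hfin
  have e2 : 60000 * M ^ 2 * ((2 : ℝ) ^ (-j)) ^ 2 = 2 * α := by rw [hα, hε]; ring
  rw [e2]
  linarith

/-! #### Summation of the pieces -/

/-- After rescaling, the kernel is the fixed `kS φ 0`, of total mass φ(0) = 1, and dominated
convergence applies. -/
theorem tendsto_low (hφ : IsCutoff φ) {f : E3 → ℝ} (hf : BL2 f) (x : E3) :
    Tendsto (fun n : ℕ => cv (kS φ (n : ℤ)) f x) atTop (𝓝 (f x)) := by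
  obtain ⟨C, hC⟩ := hf.bdd
  have e : ∀ n : ℕ, cv (kS φ (n : ℤ)) f x =
      ∫ y, kS φ 0 y * f (x - ((2 : ℝ) ^ (n : ℤ))⁻¹ • y) := by
    intro n
    rw [← integral_comp_dil _ (n : ℤ)]
    unfold cv
    rw [kS_eq_dil hφ]
    unfold dil
    congr 1; ext y
    rw [smul_smul, inv_mul_cancel₀ (by positivity), one_smul]
    ring
  simp_rw [e]
  have hlim : f x = ∫ y, kS φ 0 y * f x := by
    rw [integral_mul_const, integral_kS_zero hφ, one_mul]
  rw [hlim]
  refine tendsto_integral_of_dominated_convergence (fun y => |kS φ 0 y| * C) (fun n => ?_)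
    ((kS φ 0).integrable.abs.mul_const C) (fun n => Eventually.of_forall fun y => ?_)
    (Eventually.of_forall fun y => ?_)
  · have hcn : Continuous fun y : E3 => x - ((2 : ℝ) ^ (n : ℤ))⁻¹ • y := by fun_prop
    exact ((kS φ 0).continuous.mul (hf.cont.comp hcn)).aestronglyMeasurable
  · rw [norm_mul]
    exact mul_le_mul_of_nonneg_left (hC _) (norm_nonneg _)
  · refine Tendsto.const_mul _ ((hf.cont.tendsto x).comp ?_)
    have h1 : Tendsto (fun n : ℕ => ((2 : ℝ) ^ (n : ℤ))⁻¹) atTop (𝓝 0) := by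
      simp only [zpow_natCast]
      exact tendsto_inv_atTop_zero.comp (tendsto_pow_atTop_atTop_of_one_lt one_lt_two)
    have h2 := (h1.smul_const y).const_sub x
    simpa using h2

theorem low_succ (hφ : IsCutoff φ) {f : E3 → ℝ} (hf : BL2 f) (n : ℕ) (x : E3) :
    cv (kS φ ((n + 1 : ℕ) : ℤ)) f x = cv (kS φ (n : ℤ)) f x + lp φ ((n + 1 : ℕ) : ℤ) f x := by
  have h : (kP φ ((n + 1 : ℕ) : ℤ) : E3 → ℝ) = fun x => kS φ ((n + 1 : ℕ) : ℤ) x - kS φ n x := by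
    ext x
    rw [kP_eq_sub hφ]
    congr 3
    push_cast; ring
  unfold lp
  rw [h, cv_sub_left (SchwartzMap.integrable _) (SchwartzMap.integrable _) hf]
  ring

theorem low_sub_low (hφ : IsCutoff φ) {f : E3 → ℝ} (hf : BL2 f) (i n : ℕ) (x : E3) :
    cv (kS φ ((i + n : ℕ) : ℤ)) f x - cv (kS φ (i : ℤ)) f x =
      ∑ m ∈ Finset.range n, lp φ ((i + m + 1 : ℕ) : ℤ) f x := by
  induction n with
  | zero => simp
  | succ n ih =>
    rw [Finset.sum_range_succ, ← ih, ← add_assoc, low_succ hφ hf]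
    ring

theorem abs_le_low_add (hφ : IsCutoff φ) {f : E3 → ℝ} (hf : BL2 f) {b : ℕ → ℝ} (x : E3) {S : ℝ}
    (hb : ∀ m, |lp φ ((m + 1 : ℕ) : ℤ) f x| ≤ b m)
    (hS : ∀ n, ∑ m ∈ Finset.range n, b m ≤ S) : |f x| ≤ |cv (kS φ 0) f x| + S := by
  refine le_of_tendsto ((tendsto_low hφ hf x).abs) (Eventually.of_forall fun n => ?_)
  have h := low_sub_low hφ hf 0 n x
  simp only [zero_add, Nat.cast_zero] at h
  have h1 : cv (kS φ (n : ℤ)) f x = cv (kS φ 0) f x +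
    ∑ m ∈ Finset.range n, lp φ ((m + 1 : ℕ) : ℤ) f x := by linarith
  rw [h1]
  refine (abs_add_le _ _).trans (add_le_add_right ?_ _)
  exact ((Finset.abs_sum_le_sum_abs _ _).trans (Finset.sum_le_sum fun m _ => hb m)).trans (hS n)

theorem nm_sum_range_le {f : ℕ → E3 → ℝ} (hf : ∀ m, BL2 (f m)) (n : ℕ) :
    BL2 (fun x => ∑ m ∈ Finset.range n, f m x) ∧
      nm (fun x => ∑ m ∈ Finset.range n, f m x) ≤ ∑ m ∈ Finset.range n, nm (f m) := by
  induction n with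
  | zero =>
    simp only [Finset.range_zero, Finset.sum_empty]
    refine ⟨by simpa using (hf 0).const_mul 0, ?_⟩
    unfold nm
    exact (lpNorm_fun_zero _ _).le
  | succ n ih =>
    simp only [Finset.sum_range_succ]
    exact ⟨ih.1.add (hf n), (nm_add_le ih.1).trans (add_le_add_left ih.2 _)⟩

/-- The finite pieces telescope to a difference of two low-pass filters, which converges pointwise.
Fatou for the L^100 norm then suffices, and convergence of the series in L^100 need not be known. -/
theorem nm_high_le (hφ : IsCutoff φ) {f : E3 → ℝ} (hf : Sm f) (i : ℕ) {S : ℝ}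
    (hS : ∀ n, ∑ m ∈ Finset.range n, nm (lp φ ((i + m + 1 : ℕ) : ℤ) f) ≤ S) :
    nm (fun x => f x - cv (kS φ (i : ℤ)) f x) ≤ S := by
  have hS0 : 0 ≤ S := by simpa using hS 0
  have hlow : ∀ n : ℕ, BL2 (cv (kS φ (n : ℤ)) f) := fun n => hf.bl2.cv (SchwartzMap.integrable _)
  have hw := hf.bl2.sub (hlow i)
  have hlim : ∀ᵐ x, Tendsto (fun n : ℕ => cv (kS φ ((i + n : ℕ) : ℤ)) f x - cv (kS φ (i : ℤ)) f x)
      atTop (𝓝 (f x - cv (kS φ (i : ℤ)) f x)) := Eventually.of_forall fun x =>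
    ((tendsto_low hφ hf.bl2 x).comp (tendsto_add_atTop_nat i |>.congr fun n => by
      rw [add_comm])).sub_const _
  have hfat := Lp.eLpNorm_lim_le_liminf_eLpNorm (p := 100)
    (fun n : ℕ => ((hlow (i + n)).sub (hlow i)).cont.aestronglyMeasurable) _ hlim
  have hb : ∀ n : ℕ, eLpNorm (fun x => cv (kS φ ((i + n : ℕ) : ℤ)) f x - cv (kS φ (i : ℤ)) f x) 100
      volume ≤ ENNReal.ofReal S := by
    intro n
    rw [← ofReal_lpNorm ((hlow (i + n)).sub (hlow i)).memLp_hundred]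
    refine ENNReal.ofReal_le_ofReal (le_trans ?_ (hS n))
    have h := funext fun x => low_sub_low hφ hf.bl2 i n x
    rw [h]
    exact (nm_sum_range_le (fun m => (lp_sm hf _).bl2) n).2
  have h2 := hfat.trans ((liminf_le_liminf (Eventually.of_forall hb)).trans
    (le_of_eq (liminf_const (ENNReal.ofReal S))))
  rw [← ofReal_lpNorm hw.memLp_hundred] at h2
  exact (ENNReal.ofReal_le_ofReal_iff hS0).1 h2

/-! #### The product estimate -/

/-- The support identity for three kernels passes to arbitrary `u` and `v` by associativity of
convolution, one factor at a time, so `u` and `v` are never Fourier transformed. -/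
theorem cv_kN_low_mul_low (hφ : IsCutoff φ) {u v : E3 → ℝ} (hu : BL2 u) (hv : BL2 v) (j : ℤ) :
    cv (kN φ j) (fun x => cv (kS φ (j - 3)) u x * cv (kS φ (j - 3)) v x) = fun _ => 0 := by
  set s := kS φ (j - 3) with hs
  set N := kN φ j with hN
  have hz : ∀ w w', ∫ y, N y * (s (w - y) * s (w' - y)) = 0 := integral_kN_kS_kS hφ j
  have h1 : ∀ x w, ∫ y, N y * cv s u (x - y) * s (w - y) = 0 := by
    intro x w
    have hA : Integrable (fun y => N y * s (w - y)) :=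
      (schwartz_bl2 s).integrable_cv N.integrable w
    have e : ∫ y, N y * cv s u (x - y) * s (w - y) = cv (fun y => N y * s (w - y)) (cv s u) x := by
      unfold cv
      congr 1; ext y; ring
    rw [e, ← cv_assoc hA s.integrable hu]
    have e2 : cv (fun y => N y * s (w - y)) s = fun _ => 0 := by
      ext w'
      rw [← hz w w']
      unfold cv
      congr 1; ext y; ring
    rw [e2]
    simp [cv]
  ext x
  have hA : Integrable (fun y => N y * cv s u (x - y)) :=
    (hu.cv s.integrable).integrable_cv N.integrable x
  have e : cv N (fun x => cv s u x * cv s v x) x = cv (fun y => N y * cv s u (x - y)) (cv s v) x := by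
    unfold cv
    congr 1; ext y; ring
  rw [e, ← cv_assoc hA s.integrable hv]
  have e2 : cv (fun y => N y * cv s u (x - y)) s = fun _ => 0 := by
    ext w
    exact h1 x w
  rw [e2]
  simp [cv]

/-- The localised bilinear estimate. -/
theorem nm_bilinear_le (hφ : IsCutoff φ) (hM : KBound φ M) {u v : E3 → ℝ} (hu : Sm u) (hv : Sm v)
    {U W : ℝ} (hU : ∀ x, |u x| ≤ U) (hV : ∀ x, |v x| ≤ U) (i : ℕ)
    (hWu : nm (fun x => u x - cv (kS φ (i : ℤ)) u x) ≤ W)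
    (hWv : nm (fun x => v x - cv (kS φ (i : ℤ)) v x) ≤ W) (a b c : Fin 3) :
    nm (cv (pd a (pd b (pd c (kN φ ((i : ℤ) + 3))))) (fun x => u x * v x)) ≤
      2 * M ^ 2 * (2 : ℝ) ^ ((i : ℤ) + 3) * U * W := by
  set s := kS φ (i : ℤ) with hs
  set N := kN φ ((i : ℤ) + 3) with hN
  set D := pd a (pd b (pd c N)) with hD
  have hDi : Integrable D := integrable_pd3 _ _ _ _
  have hsu : Sm (cv s u) := hu.cv s.integrable
  have hsv : Sm (cv s v) := hv.cv s.integrable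
  have hM1 := hM.one_le
  have hU0 : 0 ≤ U := (abs_nonneg _).trans (hU 0)
  have hW0 : 0 ≤ W := (nm_nonneg _).trans hWu
  -- The product u v is low·low + p + q. The first term is annihilated by the frequency supports,
  -- while p and q each contain one high-frequency factor, measured by `W`, and one bounded factor.
  set p := fun x => cv s u x * (v x - cv s v x) with hp
  set q := fun x => v x * (u x - cv s u x) with hq
  have hps : Sm p := hsu.mul (hv.sub hsv)
  have hqs : Sm q := hv.mul (hu.sub hsu)
  have hzero : cv D (fun x => cv s u x * cv s v x) = fun _ => 0 := by
    rw [hD, pd3_cv_left (hsu.mul hsv)]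
    have := cv_kN_low_mul_low hφ hu.bl2 hv.bl2 ((i : ℤ) + 3)
    simp only [add_sub_cancel_right] at this
    rw [← hN, ← hs] at this
    rw [this, pd_zero, pd_zero, pd_zero]
  have hdec : cv D (fun x => u x * v x) = cv D (fun x => p x + q x) := by
    have e : (fun x => u x * v x) = fun x => cv s u x * cv s v x + (p x + q x) := by
      ext x; simp only [hp, hq]; ring
    rw [e, cv_add_right hDi (hsu.mul hsv).bl2 (hps.add hqs).bl2, hzero]
    simp
  rw [hdec]
  refine (nm_cv_le hDi (hps.add hqs).bl2).trans ?_
  have hsub : ∀ x, |cv s u x| ≤ M * U := fun x => (abs_cv_le s.integrable hU x).trans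
    (mul_le_mul_of_nonneg_right (hM.l1_kS i) hU0)
  have h1 : nm p ≤ M * U * W := (nm_mul_le hsu.bl2 (hv.sub hsv).bl2 hsub).trans
    (mul_le_mul_of_nonneg_left hWv (by positivity))
  have h2 : nm q ≤ U * W := (nm_mul_le hv.bl2 (hu.sub hsu).bl2 hV).trans
    (mul_le_mul_of_nonneg_left hWu (by positivity))
  have h3 : nm (fun x => p x + q x) ≤ 2 * M * U * W := by
    refine (nm_add_le hps.bl2).trans ?_
    have : U * W ≤ M * (U * W) := le_mul_of_one_le_left (by positivity) hM1
    linarith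
  have h4 : l1 D ≤ M * (2 : ℝ) ^ ((i : ℤ) + 3) := hM.l1_pd3_kN _ a b c
  calc l1 D * nm (fun x => p x + q x) ≤ (M * (2 : ℝ) ^ ((i : ℤ) + 3)) * (2 * M * U * W) :=
        mul_le_mul h4 h3 (nm_nonneg _) (by positivity)
    _ = _ := by ring

end Pieces

/-! ### Time derivatives of power integrals -/

theorem BL2.pow {f : E3 → ℝ} (hf : BL2 f) {n : ℕ} (hn : n ≠ 0) : BL2 (fun x => f x ^ n) := by
  obtain ⟨m, rfl⟩ := Nat.exists_eq_succ_of_ne_zero hn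
  induction m with
  | zero => simpa using hf
  | succ m ih => simpa only [Nat.succ_eq_add_one, pow_succ _ (m + 1)] using (ih (by omega)).mul hf

/-- The second-order Taylor remainder with a constant uniform on [-R, R]. Uniformity is what allows
the remainder to be integrated over space. -/
theorem exists_pow_remainder_le (n : ℕ) (R : ℝ) : ∃ C, 0 ≤ C ∧ ∀ x y : ℝ, |x| ≤ R → |y| ≤ R →
    |x ^ n - y ^ n - n * y ^ (n - 1) * (x - y)| ≤ C * (x - y) ^ 2 := by
  induction n with
  | zero => exact ⟨0, le_rfl, fun x y _ _ => by simp⟩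
  | succ n ih =>
    obtain ⟨C, hC0, hC⟩ := ih
    refine ⟨|R| * C + n * |R| ^ (n - 1), by positivity, fun x y hx hy => ?_⟩
    have hxR : |x| ≤ |R| := hx.trans (le_abs_self R)
    have hyR : |y| ≤ |R| := hy.trans (le_abs_self R)
    have key : x ^ (n + 1) - y ^ (n + 1) - ((n + 1 : ℕ) : ℝ) * y ^ (n + 1 - 1) * (x - y)
        = x * (x ^ n - y ^ n - n * y ^ (n - 1) * (x - y)) + n * y ^ (n - 1) * (x - y) ^ 2 := by
      rcases n with _ | n
      · simp
      · simp only [Nat.add_sub_cancel]; push_cast; ring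
    rw [key]
    calc _ ≤ |x * (x ^ n - y ^ n - n * y ^ (n - 1) * (x - y))| + |n * y ^ (n - 1) * (x - y) ^ 2| :=
          abs_add_le _ _
      _ ≤ |R| * (C * (x - y) ^ 2) + n * |R| ^ (n - 1) * (x - y) ^ 2 := by
          rw [abs_mul, abs_mul, abs_mul, abs_pow, abs_sq, Nat.abs_cast]
          gcongr
          exact hC x y hx hy
      _ = _ := by ring

theorem BL2.sq_integral_mul_le {f g : E3 → ℝ} (hf : BL2 f) (hg : BL2 g) :
    (∫ x, f x * g x) ^ 2 ≤ (∫ x, f x ^ 2) * ∫ x, g x ^ 2 := by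
  have h := discrim_le_zero (a := ∫ x, f x ^ 2) (b := 2 * ∫ x, f x * g x) (c := ∫ x, g x ^ 2)
    fun r => by
      have h1 := (hf.integrable_pow le_rfl).const_mul (r * r)
      have h2 := (hf.integrable_mul hg).const_mul (2 * r)
      have h3 := hg.integrable_pow le_rfl
      have : 0 ≤ ∫ x, (r * r * f x ^ 2 + 2 * r * (f x * g x)) + g x ^ 2 :=
        integral_nonneg fun x => by
          have : r * r * f x ^ 2 + 2 * r * (f x * g x) + g x ^ 2 = (r * f x + g x) ^ 2 := by ring
          simp only [Pi.zero_apply, this]; positivity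
      rw [integral_add (f := fun x => r * r * f x ^ 2 + 2 * r * (f x * g x)) (h1.add h2) h3,
        integral_add h1 h2, integral_const_mul,
        integral_const_mul] at this
      linarith
  unfold discrim at h
  linarith

theorem BL2.integral_sq_eq {f : E3 → ℝ} (hf : BL2 f) :
    ∫ x, f x ^ 2 = (eLpNorm f 2 volume).toReal ^ 2 := by
  rw [toReal_eLpNorm hf.cont.aestronglyMeasurable, lpNorm_eq_integral_norm_rpow_toReal (by norm_num) (by norm_num)
    hf.cont.aestronglyMeasurable]
  simp only [ENNReal.toReal_ofNat, Real.rpow_ofNat, Real.norm_eq_abs, sq_abs]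
  rw [← Real.rpow_natCast, ← Real.rpow_mul (integral_nonneg fun _ => sq_nonneg _)]
  norm_num

/-- Convergence of the difference quotient in L² is enough. With the quotient written as g + q, the
Taylor remainder divided by s - t is at most |C| |s - t| (g + q)², and the linear error is f^(n-1)
q, controlled by Cauchy-Schwarz. -/
theorem hasDerivWithinAt_integral_pow {I : Set ℝ} {t C : ℝ} {n : ℕ} (hn : 2 ≤ n)
    {f : ℝ → E3 → ℝ} {g : E3 → ℝ} (hf : ∀ s ∈ I, BL2 (f s)) (ht : t ∈ I) (hg : BL2 g)
    (hC : ∀ s ∈ I, ∀ x,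
      |f s x ^ n - f t x ^ n - n * f t x ^ (n - 1) * (f s x - f t x)| ≤ C * (f s x - f t x) ^ 2)
    (hq : Tendsto (fun s => eLpNorm (fun x => (s - t)⁻¹ * (f s x - f t x) - g x) 2 volume)
      (𝓝[I \ {t}] t) (𝓝 0)) :
    HasDerivWithinAt (fun s => ∫ x, f s x ^ n) (n * ∫ x, f t x ^ (n - 1) * g x) I t := by
  rw [hasDerivWithinAt_iff_tendsto_slope]
  set q : ℝ → E3 → ℝ := fun s x => (s - t)⁻¹ * (f s x - f t x) - g x with hqd
  have hqb : ∀ s ∈ I, BL2 (q s) := fun s hs => (((hf s hs).sub (hf t ht)).const_mul _).sub hg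
  set h : E3 → ℝ := fun x => f t x ^ (n - 1) with hh
  have hhb : BL2 h := (hf t ht).pow (by omega)
  set a : ℝ → ℝ := fun s => (eLpNorm (q s) 2 volume).toReal ^ 2 with ha
  have hat : Tendsto a (𝓝[I \ {t}] t) (𝓝 0) := by
    have := ((ENNReal.tendsto_toReal ENNReal.zero_ne_top).comp hq).pow 2
    simpa using this
  have hst : Tendsto (fun s => |s - t|) (𝓝[I \ {t}] t) (𝓝 0) := by
    have : Tendsto (fun s : ℝ => |s - t|) (𝓝 t) (𝓝 |t - t|) := by
      exact (continuous_id.sub continuous_const).abs.tendsto t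
    simp only [sub_self, abs_zero] at this
    exact this.mono_left nhdsWithin_le_nhds
  have hlim : Tendsto (fun s => |C| * |s - t| * (2 * (∫ x, g x ^ 2) + 2 * a s)
      + n * √((∫ x, h x ^ 2) * a s)) (𝓝[I \ {t}] t) (𝓝 0) := by
    have h1 : Tendsto (fun s => |C| * |s - t| * (2 * (∫ x, g x ^ 2) + 2 * a s)) (𝓝[I \ {t}] t)
        (𝓝 (|C| * 0 * (2 * (∫ x, g x ^ 2) + 2 * 0))) :=
      (hst.const_mul _).mul ((hat.const_mul 2).const_add _)
    have h2 : Tendsto (fun s => n * √((∫ x, h x ^ 2) * a s)) (𝓝[I \ {t}] t)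
        (𝓝 (n * √((∫ x, h x ^ 2) * 0))) :=
      ((Real.continuous_sqrt.tendsto _).comp (hat.const_mul _)).const_mul _
    simpa using h1.add h2
  rw [tendsto_iff_norm_sub_tendsto_zero]
  refine squeeze_zero' (Eventually.of_forall fun _ => norm_nonneg _) ?_ hlim
  filter_upwards [self_mem_nhdsWithin] with s hs
  have hsI : s ∈ I := hs.1
  have hne : s - t ≠ 0 := sub_ne_zero.2 hs.2
  have hIs := (hf s hsI).integrable_pow hn
  have hIt := (hf t ht).integrable_pow hn
  have hIg := hhb.integrable_mul hg
  have hIq := hhb.integrable_mul (hqb s hsI)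
  set r : E3 → ℝ := fun x =>
    (s - t)⁻¹ * (f s x ^ n - f t x ^ n - n * f t x ^ (n - 1) * (f s x - f t x)) with hr
  have hreq : ∀ x, r x = (s - t)⁻¹ * (f s x ^ n - f t x ^ n) - n * (h x * g x) - n * (h x * q s x) := by
    intro x; simp only [hr, hh, hqd]; field_simp; ring
  have hIr : Integrable r := by
    refine ((((hIs.sub hIt).const_mul (s - t)⁻¹).sub (hIg.const_mul n)).sub
      (hIq.const_mul n)).congr (Eventually.of_forall fun x => ?_)
    simp [hreq]
  have hslope : slope (fun s => ∫ x, f s x ^ n) t s - n * ∫ x, h x * g x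
      = (∫ x, r x) + n * ∫ x, h x * q s x := by
    have : ∫ x, r x = (s - t)⁻¹ * ((∫ x, f s x ^ n) - ∫ x, f t x ^ n)
        - n * (∫ x, h x * g x) - n * ∫ x, h x * q s x := by
      rw [integral_congr_ae (Eventually.of_forall hreq), integral_sub, integral_sub,
        integral_const_mul, integral_const_mul, integral_const_mul, integral_sub hIs hIt]
      · exact (hIs.sub hIt).const_mul _
      · exact hIg.const_mul _
      · exact ((hIs.sub hIt).const_mul _).sub (hIg.const_mul _)
      · exact hIq.const_mul _
    rw [this, slope_def_field]
    ring
  rw [hslope, Real.norm_eq_abs]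
  have has : ∫ x, q s x ^ 2 = a s := (hqb s hsI).integral_sq_eq
  refine (abs_add_le _ _).trans (add_le_add ?_ ?_)
  · have hbd : ∀ x, ‖r x‖ ≤ |C| * |s - t| * (2 * g x ^ 2 + 2 * q s x ^ 2) := by
      intro x
      have h1 : f s x - f t x = (s - t) * (g x + q s x) := by simp only [hqd]; field_simp; ring
      have h2 := hC s hsI x
      rw [Real.norm_eq_abs, hr, abs_mul, abs_inv, inv_mul_le_iff₀ (abs_pos.2 hne)]
      refine h2.trans ?_
      rw [h1]
      have h3 : (g x + q s x) ^ 2 ≤ 2 * g x ^ 2 + 2 * q s x ^ 2 := by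
        nlinarith [sq_nonneg (g x - q s x)]
      calc C * ((s - t) * (g x + q s x)) ^ 2 ≤ |C| * ((s - t) * (g x + q s x)) ^ 2 := by
            gcongr; exact le_abs_self C
        _ = |C| * |s - t| ^ 2 * (g x + q s x) ^ 2 := by rw [sq_abs]; ring
        _ ≤ |C| * |s - t| ^ 2 * (2 * g x ^ 2 + 2 * q s x ^ 2) := by gcongr
        _ = _ := by ring
    have hi2 := (((hg.integrable_pow le_rfl).const_mul 2).add
      (((hqb s hsI).integrable_pow le_rfl).const_mul 2)).const_mul (|C| * |s - t|)
    refine (norm_integral_le_of_norm_le hi2 (Eventually.of_forall hbd)).trans_eq ?_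
    simp only [Pi.add_apply]
    rw [integral_const_mul, integral_add ((hg.integrable_pow le_rfl).const_mul 2)
      (((hqb s hsI).integrable_pow le_rfl).const_mul 2), integral_const_mul, integral_const_mul, has]
  · rw [abs_mul, Nat.abs_cast]
    gcongr
    refine Real.abs_le_sqrt ?_
    rw [← has]
    exact hhb.sq_integral_mul_le (hqb s hsI)

/-! ### Classical solutions -/

/-- The time derivative of the `i`-th component prescribed by the Navier-Stokes equations. -/
def rhs (ν : ℝ) (U : Fin 3 → E3 → ℝ) (P : E3 → ℝ) (i : Fin 3) (x : E3) : ℝ :=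
  ν * (∑ a, pd a (pd a (U i)) x) - (∑ a, U a x * pd a (U i) x) - pd i P x

theorem sm_rhs {U : Fin 3 → E3 → ℝ} {P : E3 → ℝ} (hU : ∀ i, Sm (U i)) (hP : Sm P) (ν : ℝ)
    (i : Fin 3) : Sm (rhs ν U P i) :=
  (((Sm.sum fun a => ((hU i).pd a).pd a).const_mul ν).sub
    (Sm.sum fun a => (hU a).mul ((hU i).pd a))).sub (hP.pd i)

/-- The components `U` and the pressure `P` of a solution, in terms of smooth functions. -/
structure Classical (ν T : ℝ) (U : ℝ → Fin 3 → E3 → ℝ) (P : ℝ → E3 → ℝ) : Prop where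
  sm : ∀ t ∈ Set.Icc 0 T, ∀ i, Sm (U t i)
  smP : ∀ t ∈ Set.Icc 0 T, Sm (P t)
  div : ∀ t ∈ Set.Icc 0 T, ∀ x, ∑ a, pd a (U t a) x = 0
  quot : ∀ t ∈ Set.Icc 0 T, ∀ i, Tendsto
    (fun s => eLpNorm (fun x => (s - t)⁻¹ * (U s i x - U t i x) - rhs ν (U t) (P t) i x) 2 volume)
    (𝓝[Set.Icc 0 T \ {t}] t) (𝓝 0)

theorem MemW.mono {F : Type*} [NormedAddCommGroup F] [NormedSpace ℝ F] {m m' : ℕ} {q : ℝ≥0∞}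
    {f : E3 → F} (h : MemW m' q f) (hm : m ≤ m') : MemW m q f := fun n hn => h n (hn.trans hm)

theorem IsC1AllW.allW {F : Type*} [NormedAddCommGroup F] [NormedSpace ℝ F] {T : ℝ}
    {u v : ℝ → E3 → F} (h : IsC1AllW T u v) {t : ℝ} (ht : t ∈ Set.Icc 0 T) : AllW (u t) := fun m =>
  ⟨((h (m + 1) (by omega)).1.mem t ht).mono (by omega),
    ((h (m + 1) (by omega)).2.mem t ht).mono (by omega)⟩

theorem IsC1AllW.allW_deriv {F : Type*} [NormedAddCommGroup F] [NormedSpace ℝ F] {T : ℝ}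
    {u v : ℝ → E3 → F} (h : IsC1AllW T u v) {t : ℝ} (ht : t ∈ Set.Icc 0 T) : AllW (v t) := fun m =>
  ⟨((h (m + 1) (by omega)).1.mem_deriv t ht).mono (by omega),
    ((h (m + 1) (by omega)).2.mem_deriv t ht).mono (by omega)⟩

/-- The weak derivatives of a vector field whose components have smooth representatives. -/
theorem weakDeriv_apply_ae {u : E3 → E3} {n : ℕ} {s : Fin n → Fin 3} {F G : E3 → ℝ} {i : Fin 3}
    (hu : ∃ g, HasWeakDeriv s u g) (hF : F =ᵐ[volume] fun x => u x i) (hG : HasWeakDeriv s F G) :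
    (fun x => weakDeriv s u x i) =ᵐ[volume] G := by
  obtain ⟨g, hg⟩ := hu
  exact (((weakDeriv_spec hg).clm_comp (EuclideanSpace.proj i)).unique
    (hG.congr hF (ae_eq_refl _)))

/-- For smooth representatives the weak derivatives are classical ones. Continuity upgrades the
divergence condition to every point; the time derivative is identified only almost everywhere, which
is all that the L² difference quotient sees. -/
theorem NavierStokesAt.eq_rhs {ν : ℝ} {u v : E3 → E3} {p : E3 → ℝ} (h : NavierStokesAt ν u v p)
    (hu : AllW u) (hp : AllW p) {U : Fin 3 → E3 → ℝ} {P : E3 → ℝ} (hU : ∀ i, Sm (U i)) (hP : Sm P)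
    (hUu : ∀ i, U i =ᵐ[volume] fun x => u x i) (hPp : P =ᵐ[volume] p) :
    (∀ i, (fun x => v x i) =ᵐ[volume] rhs ν U P i) ∧ ∀ x, ∑ a, pd a (U a) x = 0 := by
  have h1 : ∀ a i, (fun x => weakDeriv ![a] u x i) =ᵐ[volume] pd a (U i) := fun a i => by
    obtain ⟨g, hg, -⟩ := (hu 1).1 1 le_rfl ![a]
    exact weakDeriv_apply_ae ⟨g, hg⟩ (hUu i) ((hU i).hasWeakDeriv_one a)
  have h2 : ∀ a i, (fun x => weakDeriv ![a, a] u x i) =ᵐ[volume] pd a (pd a (U i)) := fun a i => by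
    obtain ⟨g, hg, -⟩ := (hu 2).1 2 le_rfl ![a, a]
    exact weakDeriv_apply_ae ⟨g, hg⟩ (hUu i) ((hU i).hasWeakDeriv_two a a)
  have h3 : ∀ i, weakDeriv ![i] p =ᵐ[volume] pd i P := fun i => by
    obtain ⟨g, hg, -⟩ := (hp 1).1 1 le_rfl ![i]
    exact (weakDeriv_spec hg).unique ((hP.hasWeakDeriv_one i).congr hPp (ae_eq_refl _))
  have h1' := fun i => eventually_all.2 fun a => h1 a i
  have h2' := fun i => eventually_all.2 fun a => h2 a i
  have hU' := eventually_all.2 hUu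
  constructor
  · intro i
    filter_upwards [h.1, h1' i, h2' i, h3 i, hU'] with x hx e1 e2 e3 e4
    have := hx i
    simp only [e1, e2, e3, ← e4] at this
    simp only [rhs]
    linarith
  · have hc : Continuous fun x => ∑ a, pd a (U a) x := (Sm.sum fun a => (hU a).pd a).cont
    have : (fun x => ∑ a, pd a (U a) x) =ᵐ[volume] fun _ => 0 := by
      filter_upwards [h.2, eventually_all.2 fun a => h1 a a] with x hx e1
      simpa only [e1] using hx
    exact congrFun ((hc.ae_eq_iff_eq volume continuous_const).1 this)

theorem AllW.exists_sm_apply {u : E3 → E3} (hu : AllW u) (i : Fin 3) :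
    ∃ F, Sm F ∧ F =ᵐ[volume] fun x => u x i :=
  (hu.clm_comp (EuclideanSpace.proj i)).exists_sm

theorem IsC1AllW.tendsto_quot {T : ℝ} {u ut : ℝ → E3 → E3} (hu : IsC1AllW T u ut)
    {U : ℝ → E3 → ℝ} {V : E3 → ℝ} {i : Fin 3} {t : ℝ} (ht : t ∈ Set.Icc 0 T)
    (hU : ∀ s ∈ Set.Icc 0 T, U s =ᵐ[volume] fun x => u s x i)
    (hV : (fun x => ut t x i) =ᵐ[volume] V) : Tendsto
      (fun s => eLpNorm (fun x => (s - t)⁻¹ * (U s x - U t x) - V x) 2 volume)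
      (𝓝[Set.Icc 0 T \ {t}] t) (𝓝 0) := by
  refine tendsto_of_tendsto_of_tendsto_of_le_of_le' tendsto_const_nhds
    ((hu 1 le_rfl).1.hasDeriv t ht) (Eventually.of_forall fun _ => zero_le) ?_
  filter_upwards [self_mem_nhdsWithin] with s hs
  have hli : LocallyIntegrable (fun x => (s - t)⁻¹ • (u s x - u t x) - ut t x) := by
    have h1 := (hu.allW hs.1).locallyIntegrable
    have h2 := (hu.allW ht).locallyIntegrable
    have h3 := (hu.allW_deriv ht).locallyIntegrable
    exact ((h1.sub h2).smul ((s - t)⁻¹)).sub h3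
  refine le_trans (eLpNorm_mono_ae ?_) (eLpNorm_le_normW hli 1 2)
  filter_upwards [hU s hs.1, hU t ht, hV] with x e1 e2 e3
  rw [e1, e2, ← e3]
  exact PiLp.norm_apply_le ((s - t)⁻¹ • (u s x - u t x) - ut t x) i

theorem IsRegularSolution.exists_classical {ν T : ℝ} {u₀ : E3 → E3} {u : ℝ → E3 → E3}
    {p : ℝ → E3 → ℝ} (h : IsRegularSolution ν T u₀ u p) :
    ∃ U P, Classical ν T U P ∧ ∀ t ∈ Set.Icc 0 T, ∀ i, U t i =ᵐ[volume] fun x => u t x i := by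
  obtain ⟨ut, pt, hu, hp, hns, -⟩ := h
  -- Representatives are chosen separately at each time; outside [0, T] the value 0 is a mere
  -- filler.
  have exU : ∀ t i, ∃ F, t ∈ Set.Icc 0 T → Sm F ∧ F =ᵐ[volume] fun x => u t x i := by
    intro t i
    by_cases ht : t ∈ Set.Icc 0 T
    · obtain ⟨F, hF⟩ := (hu.allW ht).exists_sm_apply i
      exact ⟨F, fun _ => hF⟩
    · exact ⟨0, fun h => absurd h ht⟩
  have exP : ∀ t, ∃ F, t ∈ Set.Icc 0 T → Sm F ∧ F =ᵐ[volume] p t := by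
    intro t
    by_cases ht : t ∈ Set.Icc 0 T
    · obtain ⟨F, hF⟩ := (hp.allW ht).exists_sm
      exact ⟨F, fun _ => hF⟩
    · exact ⟨0, fun h => absurd h ht⟩
  choose U hU using exU
  choose P hP using exP
  have key : ∀ t ∈ Set.Icc 0 T, (∀ i, (fun x => ut t x i) =ᵐ[volume] rhs ν (U t) (P t) i) ∧
      ∀ x, ∑ a, pd a (U t a) x = 0 := fun t ht =>
    (hns t ht).eq_rhs (hu.allW ht) (hp.allW ht)
      (fun i => (hU t i ht).1) (hP t ht).1 (fun i => (hU t i ht).2) (hP t ht).2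
  refine ⟨U, P, ⟨fun t ht i => (hU t i ht).1, fun t ht => (hP t ht).1, fun t ht => (key t ht).2,
    fun t ht i => ?_⟩, fun t ht i => (hU t i ht).2⟩
  exact hu.tendsto_quot ht (fun s hs => (hU s i hs).2) ((key t ht).1 i)

/-! ### The energy inequality -/

theorem integral_mul_laplacian_nonpos {f : E3 → ℝ} (hf : Sm f) :
    ∫ x, f x * ∑ a, pd a (pd a f) x ≤ 0 := by
  simp only [Finset.mul_sum]
  rw [integral_finsetSum _ fun a _ => hf.integrable_mul ((hf.pd a).pd a)]
  refine Finset.sum_nonpos fun a _ => ?_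
  rw [integral_mul_pd hf (hf.pd a)]
  have : 0 ≤ ∫ x, pd a f x * pd a f x := integral_nonneg fun x => mul_self_nonneg _
  linarith

/-- f ∂_a f is half the derivative of f², so integration by parts leaves the divergence of the
velocity. -/
theorem integral_mul_transport {U : Fin 3 → E3 → ℝ} (hU : ∀ i, Sm (U i))
    (hdiv : ∀ x, ∑ a, pd a (U a) x = 0) {f : E3 → ℝ} (hf : Sm f) :
    ∫ x, f x * ∑ a, U a x * pd a f x = 0 := by
  have hf2 : Sm fun x => f x ^ 2 := hf.pow two_ne_zero
  have h1 : ∀ a, ∫ x, U a x * pd a (fun x => f x ^ 2) x = -∫ x, pd a (U a) x * f x ^ 2 :=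
    fun a => integral_mul_pd (hU a) hf2 a
  have h2 : ∑ a, ∫ x, U a x * pd a (fun x => f x ^ 2) x = 0 := by
    simp only [h1, Finset.sum_neg_distrib, neg_eq_zero]
    rw [← integral_finsetSum _ fun a _ => ((hU a).pd a).integrable_mul hf2]
    simp [← Finset.sum_mul, hdiv]
  rw [← integral_finsetSum _ fun a _ => (hU a).integrable_mul (hf2.pd a)] at h2
  have h3 : ∀ x, ∑ a, U a x * pd a (fun x => f x ^ 2) x = 2 * (f x * ∑ a, U a x * pd a f x) := by
    intro x
    rw [Finset.mul_sum, Finset.mul_sum]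
    refine Finset.sum_congr rfl fun a _ => ?_
    rw [pd_pow hf.diff]
    push_cast; ring
  simp only [h3, integral_const_mul] at h2
  linarith

theorem integral_mul_grad {U : Fin 3 → E3 → ℝ} (hU : ∀ i, Sm (U i))
    (hdiv : ∀ x, ∑ a, pd a (U a) x = 0) {P : E3 → ℝ} (hP : Sm P) :
    ∑ i, ∫ x, U i x * pd i P x = 0 := by
  have h1 : ∀ i, ∫ x, U i x * pd i P x = -∫ x, pd i (U i) x * P x :=
    fun i => integral_mul_pd (hU i) hP i
  simp only [h1, Finset.sum_neg_distrib, neg_eq_zero]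
  rw [← integral_finsetSum _ fun a _ => ((hU a).pd a).integrable_mul hP]
  simp [← Finset.sum_mul, hdiv]

theorem sum_integral_mul_rhs_nonpos {U : Fin 3 → E3 → ℝ} (hU : ∀ i, Sm (U i))
    (hdiv : ∀ x, ∑ a, pd a (U a) x = 0) {P : E3 → ℝ} (hP : Sm P) {ν : ℝ} (hν : 0 ≤ ν) :
    ∑ i, ∫ x, U i x * rhs ν U P i x ≤ 0 := by
  have h : ∀ i, ∫ x, U i x * rhs ν U P i x = ν * (∫ x, U i x * ∑ a, pd a (pd a (U i)) x)
      - ∫ x, U i x * pd i P x := by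
    intro i
    have i1 := (hU i).integrable_mul (Sm.sum fun a => ((hU i).pd a).pd a)
    have i2 := (hU i).integrable_mul (Sm.sum fun a => (hU a).mul ((hU i).pd a))
    have i3 := (hU i).integrable_mul (hP.pd i)
    have i4 : Integrable fun x => ν * (U i x * ∑ a, pd a (pd a (U i)) x)
        - U i x * (∑ a, U a x * pd a (U i) x) := (i1.const_mul ν).sub i2
    have e : ∀ x, U i x * rhs ν U P i x = ν * (U i x * ∑ a, pd a (pd a (U i)) x)
        - U i x * (∑ a, U a x * pd a (U i) x) - U i x * pd i P x := fun x => by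
      simp only [rhs]; ring
    rw [integral_congr_ae (Eventually.of_forall e), integral_sub i4 i3,
      integral_sub (i1.const_mul ν) i2, integral_const_mul, integral_mul_transport hU hdiv (hU i),
      sub_zero]
  simp only [h, Finset.sum_sub_distrib, integral_mul_grad hU hdiv hP, sub_zero]
  exact Finset.sum_nonpos fun i _ =>
    mul_nonpos_of_nonneg_of_nonpos hν (integral_mul_laplacian_nonpos (hU i))

/-- Transport and pressure integrate to zero by incompressibility, and viscosity has a sign. For
squares the Taylor remainder is exactly the squared difference, hence `C := 1`. -/
theorem Classical.energy {ν T : ℝ} {U : ℝ → Fin 3 → E3 → ℝ} {P : ℝ → E3 → ℝ}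
    (h : Classical ν T U P) (hν : 0 ≤ ν) {t : ℝ} (ht : t ∈ Set.Icc 0 T) :
    ∑ i, ∫ x, U t i x ^ 2 ≤ ∑ i, ∫ x, U 0 i x ^ 2 := by
  have hd : ∀ s ∈ Set.Icc 0 T, HasDerivWithinAt (fun s => ∑ i, ∫ x, U s i x ^ 2)
      (∑ i, ((2 : ℕ) : ℝ) * ∫ x, U s i x ^ (2 - 1) * rhs ν (U s) (P s) i x) (Set.Icc 0 T) s :=
    fun s hs => HasDerivWithinAt.fun_sum fun i _ =>
      hasDerivWithinAt_integral_pow (C := 1) le_rfl (fun r hr => (h.sm r hr i).bl2) hs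
        (sm_rhs (h.sm s hs) (h.smP s hs) ν i).bl2
        (fun r _ x => by
          have : U r i x ^ 2 - U s i x ^ 2 - ((2 : ℕ) : ℝ) * U s i x ^ (2 - 1) * (U r i x - U s i x)
              = (U r i x - U s i x) ^ 2 := by push_cast; ring
          rw [this, abs_sq, one_mul]) (h.quot s hs i)
  have ha : AntitoneOn (fun s => ∑ i, ∫ x, U s i x ^ 2) (Set.Icc 0 T) := by
    refine antitoneOn_of_hasDerivWithinAt_nonpos (convex_Icc 0 T)
      (fun s hs => (hd s hs).continuousWithinAt)
      (fun s hs => (hd s (interior_subset hs)).mono interior_subset) fun s hs => ?_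
    have hs' := interior_subset hs
    have := sum_integral_mul_rhs_nonpos (h.sm s hs') (h.div s hs') (h.smP s hs') hν
    simp only [Nat.add_one_sub_one, pow_one, ← Finset.mul_sum]
    exact mul_nonpos_of_nonneg_of_nonpos (by norm_num) this
  exact ha ⟨le_rfl, ht.1.trans ht.2⟩ ht ht.1

/-! ### The frequency-localised Leray projection -/

section Leray

variable {φ : E3 → ℝ}

theorem schwartz_pd2_integrable (K : 𝓢(E3, ℝ)) (a b : Fin 3) : Integrable (pd a (pd b K)) := by
  rw [schwartz_pd K b]
  exact integrable_pd _ a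

/-- The `i`-th component of the Leray projection of `P_j w`. -/
def leray (φ : E3 → ℝ) (j : ℤ) (i : Fin 3) (w : Fin 3 → E3 → ℝ) (x : E3) : ℝ :=
  lp φ j (w i) x + ∑ b, cv (pd i (pd b (kN φ j))) (w b) x

theorem leray_add (j : ℤ) (i : Fin 3) {w z : Fin 3 → E3 → ℝ} (hw : ∀ a, BL2 (w a))
    (hz : ∀ a, BL2 (z a)) :
    leray φ j i (fun a x => w a x + z a x) = fun x => leray φ j i w x + leray φ j i z x := by
  ext x
  simp only [leray, lp, cv_add_right (kP φ j).integrable (hw _) (hz _),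
    cv_add_right (schwartz_pd2_integrable (kN φ j) _ _) (hw _) (hz _), Finset.sum_add_distrib]
  ring

theorem leray_const_mul (j : ℤ) (i : Fin 3) (c : ℝ) (w : Fin 3 → E3 → ℝ) :
    leray φ j i (fun a x => c * w a x) = fun x => c * leray φ j i w x := by
  ext x
  simp only [leray, lp, cv_const_mul_right, ← Finset.mul_sum]
  ring

theorem leray_sub (j : ℤ) (i : Fin 3) {w z : Fin 3 → E3 → ℝ} (hw : ∀ a, BL2 (w a))
    (hz : ∀ a, BL2 (z a)) :
    leray φ j i (fun a x => w a x - z a x) = fun x => leray φ j i w x - leray φ j i z x := by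
  have h := leray_add (φ := φ) j i hw fun a => (hz a).const_mul (-1)
  rw [leray_const_mul] at h
  simpa [sub_eq_add_neg] using h

theorem bl2_leray (j : ℤ) (i : Fin 3) {w : Fin 3 → E3 → ℝ} (hw : ∀ a, BL2 (w a)) :
    BL2 (leray φ j i w) := by
  unfold leray lp
  simp only [Fin.sum_univ_three]
  exact ((hw i).cv (kP φ j).integrable).add
    ((((hw 0).cv (schwartz_pd2_integrable _ _ _)).add
      ((hw 1).cv (schwartz_pd2_integrable _ _ _))).add ((hw 2).cv (schwartz_pd2_integrable _ _ _)))

/-- Moving one derivative from the kernel to the field assembles its divergence in the correction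
term. -/
theorem leray_of_div_eq_zero (j : ℤ) (i : Fin 3) {w : Fin 3 → E3 → ℝ} (hw : ∀ a, Sm (w a))
    (hdiv : ∀ x, ∑ a, pd a (w a) x = 0) : leray φ j i w = lp φ j (w i) := by
  have hN := schwartz_sm (kN φ j)
  have h1 : ∀ b, cv (pd i (pd b (kN φ j))) (w b) = cv (pd i (kN φ j)) (pd b (w b)) := fun b => by
    rw [hN.pd_comm i b, cv_pd_left (hN.pd i) (hw b)]
  have h2 := cv_sum_right (integrable_pd (kN φ j) i) fun b => ((hw b).pd b).bl2
  ext x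
  simp only [leray, h1]
  rw [← congrFun h2 x, funext hdiv]
  simp [cv]

/-- On a gradient the correction term assembles the Laplacian of `kN`, which is minus the kernel of
P_j, and cancels the first term. The pressure thus disappears without being estimated. -/
theorem leray_grad (hφ : IsCutoff φ) (j : ℤ) (i : Fin 3) {P : E3 → ℝ} (hP : Sm P) :
    leray φ j i (fun a => pd a P) = fun _ => 0 := by
  have hN := schwartz_sm (kN φ j)
  have h1 : ∀ b, cv (pd i (pd b (kN φ j))) (pd b P) = cv (pd b (pd b (kN φ j))) (pd i P) :=
    fun b => by
      rw [← cv_pd_left ((hN.pd b).pd i) hP, ← cv_pd_left ((hN.pd b).pd b) hP,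
        (hN.pd b).pd_comm b i]
  have h2 := cv_sum_left (fun b => schwartz_pd2_integrable (kN φ j) b b) (hP.pd i).bl2
  ext x
  simp only [leray, h1, lp]
  rw [← congrFun h2 x, funext (laplacian_kN hφ j), cv_neg_left]
  ring

theorem lp_laplacian (j : ℤ) {f : E3 → ℝ} (hf : Sm f) :
    lp φ j (fun x => ∑ a, pd a (pd a f) x) = fun x => ∑ a, pd a (pd a (lp φ j f)) x := by
  have hK := (kP φ j).integrable (μ := volume)
  simp only [lp, cv_sum_right hK fun a => ((hf.pd a).pd a).bl2, hf.pd_cv hK, (hf.pd _).pd_cv hK]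

theorem leray_laplacian (j : ℤ) (i : Fin 3) {U : Fin 3 → E3 → ℝ} (hU : ∀ a, Sm (U a))
    (hdiv : ∀ x, ∑ a, pd a (U a) x = 0) :
    leray φ j i (fun b x => ∑ a, pd a (pd a (U b)) x)
      = fun x => ∑ a, pd a (pd a (lp φ j (U i))) x := by
  rw [leray_of_div_eq_zero, lp_laplacian j (hU i)]
  · exact fun b => Sm.sum fun a => ((hU b).pd a).pd a
  · intro x
    have h0 : ∀ a, pd a (pd a fun x => ∑ b, pd b (U b) x) x = 0 := fun a => by
      simp only [hdiv, pd_zero]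
    have h1 : ∀ a b, pd b (pd a (pd a (U b))) = pd a (pd a (pd b (U b))) := fun a b => by
      rw [((hU b).pd a).pd_comm b a, (hU b).pd_comm b a]
    simp only [pd_sum (fun a => (((hU _).pd a).pd a).diff)]
    rw [Finset.sum_comm]
    refine Finset.sum_eq_zero fun a _ => ?_
    rw [← h0 a, pd_sum fun b => ((hU b).pd b).diff, pd_sum fun b => (((hU b).pd b).pd a).diff]
    exact Finset.sum_congr rfl fun b _ => by rw [h1]

/-- The transport term `(U · ∇) U`. -/
def transport (U : Fin 3 → E3 → ℝ) (i : Fin 3) (x : E3) : ℝ := ∑ a, U a x * pd a (U i) x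

theorem sm_transport {U : Fin 3 → E3 → ℝ} (hU : ∀ a, Sm (U a)) (i : Fin 3) : Sm (transport U i) :=
  Sm.sum fun a => (hU a).mul ((hU i).pd a)

theorem transport_eq {U : Fin 3 → E3 → ℝ} (hU : ∀ a, Sm (U a))
    (hdiv : ∀ x, ∑ a, pd a (U a) x = 0) (i : Fin 3) :
    transport U i = fun x => ∑ c, pd c (fun x => U c x * U i x) x := by
  ext x
  simp only [transport, pd_mul (hU _).diff (hU i).diff, Finset.sum_add_distrib, ← Finset.sum_mul,
    hdiv, zero_mul, add_zero]

/-- The transport term is a divergence, and P_j is convolution with minus the Laplacian of `kN`.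
Every term then has three derivatives of `kN` acting on a product of components, the single shape
bounded by `nm_bilinear_le`. -/
theorem leray_transport (hφ : IsCutoff φ) (j : ℤ) (i : Fin 3) {U : Fin 3 → E3 → ℝ}
    (hU : ∀ a, Sm (U a)) (hdiv : ∀ x, ∑ a, pd a (U a) x = 0) :
    leray φ j i (transport U) = fun x =>
      (∑ c, ∑ a, -cv (pd c (pd a (pd a (kN φ j)))) (fun x => U c x * U i x) x) +
        ∑ b, ∑ c, cv (pd c (pd i (pd b (kN φ j)))) (fun x => U c x * U b x) x := by
  have hN := schwartz_sm (kN φ j)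
  have hUU : ∀ a b, Sm (fun x => U a x * U b x) := fun a b => (hU a).mul (hU b)
  ext x
  simp only [leray, lp]
  congr 1
  · rw [transport_eq hU hdiv, cv_sum_right (kP φ j).integrable fun c => ((hUU c i).pd c).bl2]
    refine Finset.sum_congr rfl fun c _ => ?_
    have h2 := cv_sum_left (fun a => schwartz_pd2_integrable (kN φ j) a a) ((hUU c i).pd c).bl2
    rw [funext (laplacian_kN hφ j), cv_neg_left] at h2
    have h3 := congrFun h2 x
    rw [Finset.sum_neg_distrib, ← neg_eq_iff_eq_neg, h3]
    exact Finset.sum_congr rfl fun a _ => by rw [cv_pd_left ((hN.pd a).pd a) (hUU c i)]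
  · refine Finset.sum_congr rfl fun b _ => ?_
    rw [transport_eq hU hdiv, cv_sum_right (schwartz_pd2_integrable _ _ _)
      fun c => ((hUU c b).pd c).bl2]
    exact Finset.sum_congr rfl fun c _ => by rw [cv_pd_left ((hN.pd b).pd i) (hUU c b)]

theorem bl2_sum {f : Fin 3 → E3 → ℝ} (hf : ∀ a, BL2 (f a)) : BL2 (fun x => ∑ a, f a x) := by
  simp only [Fin.sum_univ_three]
  exact ((hf 0).add (hf 1)).add (hf 2)

theorem nm_sum_le_of_le {f : Fin 3 → E3 → ℝ} (hf : ∀ a, BL2 (f a)) {D : ℝ}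
    (hD : ∀ a, nm (f a) ≤ D) : nm (fun x => ∑ a, f a x) ≤ 3 * D :=
  (nm_sum_le hf).trans ((Finset.sum_le_sum fun a _ => hD a).trans_eq (by simp))

/-- Nine terms from each of the two double sums, each with constant 2, give 36. -/
theorem nm_leray_transport_le (hφ : IsCutoff φ) {M : ℝ} (hM : KBound φ M) (m : ℕ) (i : Fin 3)
    {U : Fin 3 → E3 → ℝ} (hU : ∀ a, Sm (U a)) (hdiv : ∀ x, ∑ a, pd a (U a) x = 0) {R W : ℝ}
    (hR : ∀ a x, |U a x| ≤ R) (hW : ∀ a, nm (fun x => U a x - cv (kS φ (m : ℤ)) (U a) x) ≤ W) :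
    nm (leray φ ((m : ℤ) + 3) i (transport U)) ≤ 36 * M ^ 2 * (2 : ℝ) ^ ((m : ℤ) + 3) * R * W := by
  have hN := schwartz_sm (kN φ ((m : ℤ) + 3))
  have hb : ∀ a b c d e, BL2 (cv (pd a (pd b (pd c (kN φ ((m : ℤ) + 3)))))
      (fun x => U d x * U e x)) := fun a b c d e =>
    (BL2.mul (hU d).bl2 (hU e).bl2).cv (by
      rw [schwartz_pd _ c]; exact schwartz_pd2_integrable _ _ _)
  have hk : ∀ a b c d e, nm (cv (pd a (pd b (pd c (kN φ ((m : ℤ) + 3))))) (fun x => U d x * U e x))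
      ≤ 2 * M ^ 2 * (2 : ℝ) ^ ((m : ℤ) + 3) * R * W := fun a b c d e =>
    nm_bilinear_le hφ hM (hU d) (hU e) (hR d) (hR e) m (hW d) (hW e) a b c
  rw [leray_transport hφ _ i hU hdiv]
  have hneg : ∀ {f : E3 → ℝ}, BL2 f → BL2 (fun x => -f x) := fun {f} hf => by
    simpa using hf.const_mul (-1)
  refine (nm_add_le (bl2_sum fun c => bl2_sum fun a => hneg (hb _ _ _ _ _))).trans ?_
  have h1 := nm_sum_le_of_le (fun c => bl2_sum fun a => hneg (hb c a a c i)) fun c =>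
    nm_sum_le_of_le (fun a => hneg (hb c a a c i)) fun a => (nm_neg _).trans_le (hk c a a c i)
  have h2 := nm_sum_le_of_le (fun b => bl2_sum fun c => hb c i b c b) fun b =>
    nm_sum_le_of_le (fun c => hb c i b c b) fun c => hk c i b c b
  linarith

end Leray

/-! ### Evolution of the Littlewood-Paley pieces -/

section Evolution

variable {φ : E3 → ℝ} {ν T : ℝ} {U : ℝ → Fin 3 → E3 → ℝ} {P : ℝ → E3 → ℝ}

theorem leray_rhs (hφ : IsCutoff φ) (j : ℤ) (i : Fin 3) {U : Fin 3 → E3 → ℝ} {P : E3 → ℝ}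
    (hU : ∀ a, Sm (U a)) (hdiv : ∀ x, ∑ a, pd a (U a) x = 0) (hP : Sm P) :
    leray φ j i (rhs ν U P) = fun x => ν * (∑ a, pd a (pd a (lp φ j (U i))) x)
      - leray φ j i (transport U) x := by
  have h1 : ∀ b, Sm (fun x => ∑ a, pd a (pd a (U b)) x) := fun b =>
    Sm.sum fun a => ((hU b).pd a).pd a
  have h2 : rhs ν U P = fun b x => (ν * (∑ a, pd a (pd a (U b)) x) - transport U b x) - pd b P x :=
    rfl
  rw [h2, leray_sub (w := fun b x => ν * (∑ a, pd a (pd a (U b)) x) - transport U b x) j i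
    (fun b => (((h1 b).const_mul ν).sub (sm_transport hU b)).bl2) (fun b => (hP.pd b).bl2),
    leray_grad hφ j i hP,
    leray_sub (w := fun b x => ν * (∑ a, pd a (pd a (U b)) x)) j i
    (fun b => ((h1 b).const_mul ν).bl2) (fun b => (sm_transport hU b).bl2),
    leray_const_mul (w := fun b x => ∑ a, pd a (pd a (U b)) x), leray_laplacian j i hU hdiv]
  simp

/-- Uniformity in j is irrelevant here: the bound only carries L² convergence of the difference
quotients through the projection. -/
theorem eLpNorm_leray_le (j : ℤ) (i : Fin 3) {w : Fin 3 → E3 → ℝ} (hw : ∀ a, BL2 (w a)) :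
    eLpNorm (leray φ j i w) 2 volume ≤ eLpNorm (kP φ j) 1 volume * eLpNorm (w i) 2 volume +
      ∑ b, eLpNorm (pd i (pd b (kN φ j))) 1 volume * eLpNorm (w b) 2 volume := by
  have hm : ∀ b, BL2 (cv (pd i (pd b (kN φ j))) (w b)) := fun b =>
    (hw b).cv (schwartz_pd2_integrable _ _ _)
  refine (eLpNorm_add_le ((hw i).cv (kP φ j).integrable).cont.aestronglyMeasurable
    (bl2_sum hm).cont.aestronglyMeasurable (by norm_num)).trans (add_le_add ?_ ?_)
  · exact eLpNorm_cv_le (kP φ j).integrable.1 (hw i).cont.aestronglyMeasurable (by norm_num)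
      (by norm_num)
  · have := eLpNorm_sum_le (s := Finset.univ) (f := fun b => cv (pd i (pd b (kN φ j))) (w b))
      (p := 2) (μ := volume) (fun b _ => (hm b).cont.aestronglyMeasurable) (by norm_num)
    refine le_trans (le_of_eq ?_) (this.trans (Finset.sum_le_sum fun b _ => ?_))
    · congr 1
    · exact eLpNorm_cv_le (schwartz_pd2_integrable _ _ _).1 (hw b).cont.aestronglyMeasurable
        (by norm_num) (by norm_num)

/-- `leray` is linear, reduces to P_j on divergence-free fields and kills the pressure gradient.
Applied to the full difference quotient it therefore yields the pressure-free equation of one band.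
-/
theorem Classical.tendsto_quot_lp (hφ : IsCutoff φ) (h : Classical ν T U P) (j : ℤ) (i : Fin 3)
    {t : ℝ} (ht : t ∈ Set.Icc 0 T) : Tendsto
    (fun s => eLpNorm (fun x => (s - t)⁻¹ * (lp φ j (U s i) x - lp φ j (U t i) x) -
      (ν * (∑ a, pd a (pd a (lp φ j (U t i))) x) - leray φ j i (transport (U t)) x)) 2 volume)
    (𝓝[Set.Icc 0 T \ {t}] t) (𝓝 0) := by
  set q : ℝ → Fin 3 → E3 → ℝ := fun s a x =>
    (s - t)⁻¹ * (U s a x - U t a x) - rhs ν (U t) (P t) a x with hq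
  have hlim : Tendsto (fun s => eLpNorm (kP φ j) 1 volume * eLpNorm (q s i) 2 volume +
      ∑ b, eLpNorm (pd i (pd b (kN φ j))) 1 volume * eLpNorm (q s b) 2 volume)
      (𝓝[Set.Icc 0 T \ {t}] t) (𝓝 0) := by
    have hK : ∀ {K : E3 → ℝ}, Integrable K → eLpNorm K 1 volume ≠ ⊤ := fun hK =>
      (memLp_one_iff_integrable.2 hK).eLpNorm_ne_top
    have hc : ∀ {K : E3 → ℝ} (b : Fin 3), Integrable K → Tendsto
        (fun s => eLpNorm K 1 volume * eLpNorm (q s b) 2 volume) (𝓝[Set.Icc 0 T \ {t}] t) (𝓝 0) :=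
      fun {K} b hi => by
        have := ENNReal.Tendsto.const_mul (h.quot t ht b) (Or.inr (hK hi))
        simpa using this
    have h2 := tendsto_finsetSum Finset.univ fun b _ =>
      hc b (schwartz_pd2_integrable (kN φ j) i b)
    simpa using (hc i (kP φ j).integrable).add h2
  refine tendsto_of_tendsto_of_tendsto_of_le_of_le' tendsto_const_nhds hlim
    (Eventually.of_forall fun _ => zero_le) ?_
  filter_upwards [self_mem_nhdsWithin] with s hs
  have hb : ∀ a, BL2 (fun x => U s a x - U t a x) := fun a =>
    (h.sm s hs.1 a).bl2.sub (h.sm t ht a).bl2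
  have hr : ∀ a, BL2 (rhs ν (U t) (P t) a) := fun a => (sm_rhs (h.sm t ht) (h.smP t ht) ν a).bl2
  have hqb : ∀ a, BL2 (q s a) := fun a => ((hb a).const_mul _).sub (hr a)
  refine le_trans (le_of_eq ?_) (eLpNorm_leray_le j i hqb)
  congr 1
  rw [hq]
  simp only
  rw [leray_sub (w := fun a x => (s - t)⁻¹ * (U s a x - U t a x)) j i
    (fun a => (hb a).const_mul _) hr, leray_const_mul (w := fun a x => U s a x - U t a x),
    leray_sub j i (fun a => (h.sm s hs.1 a).bl2) (fun a => (h.sm t ht a).bl2),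
    leray_of_div_eq_zero j i (h.sm s hs.1) (h.div s hs.1),
    leray_of_div_eq_zero j i (h.sm t ht) (h.div t ht),
    leray_rhs hφ j i (h.sm t ht) (h.div t ht) (h.smP t ht)]

/-- Provides the bound, uniform in time, under which one Taylor remainder constant works for the
powers of P_j u at all times. -/
theorem Classical.abs_lp_le (h : Classical ν T U P) (hν : 0 ≤ ν) {M : ℝ} (hM : KBound φ M) (j : ℤ)
    (i : Fin 3) {t : ℝ} (ht : t ∈ Set.Icc 0 T) (x : E3) :
    |lp φ j (U t i) x| ≤ √(M ^ 2 * ((2 : ℝ) ^ j) ^ 3 * ∑ a, ∫ x, U 0 a x ^ 2) := by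
  refine Real.abs_le_sqrt ?_
  rw [← sq_abs]
  refine (abs_lp_sq_le hM (h.sm t ht i).bl2 j x).trans ?_
  simp only [sq_abs]
  gcongr
  refine le_trans ?_ (h.energy hν ht)
  exact Finset.single_le_sum (f := fun a => ∫ x, U t a x ^ 2)
    (fun a _ => integral_nonneg fun x => sq_nonneg _) (Finset.mem_univ i)

theorem Classical.hasDerivWithinAt_lp (hφ : IsCutoff φ) (h : Classical ν T U P) (hν : 0 ≤ ν)
    {M : ℝ} (hM : KBound φ M) (j : ℤ) (i : Fin 3) {t : ℝ} (ht : t ∈ Set.Icc 0 T) :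
    HasDerivWithinAt (fun s => ∫ x, lp φ j (U s i) x ^ 100)
      (100 * ∫ x, lp φ j (U t i) x ^ 99 * (ν * (∑ a, pd a (pd a (lp φ j (U t i))) x)
        - leray φ j i (transport (U t)) x)) (Set.Icc 0 T) t := by
  obtain ⟨C, -, hC⟩ := exists_pow_remainder_le 100
    (√(M ^ 2 * ((2 : ℝ) ^ j) ^ 3 * ∑ a, ∫ x, U 0 a x ^ 2))
  have hb := fun s (hs : s ∈ Set.Icc 0 T) => h.abs_lp_le hν hM j i hs
  have hs := lp_sm (φ := φ) (h.sm t ht i) j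
  have := hasDerivWithinAt_integral_pow (n := 100) (by norm_num)
    (fun s hs => (lp_sm (φ := φ) (h.sm s hs i) j).bl2) ht
    (((Sm.sum fun a => (hs.pd a).pd a).const_mul ν).bl2.sub
      (bl2_leray j i fun a => (sm_transport (h.sm t ht) a).bl2))
    (fun s hs x => hC _ _ (hb s hs x) (hb t ht x)) (h.tendsto_quot_lp hφ j i ht)
  exact_mod_cast this

theorem integral_pow_mul_laplacian {f : E3 → ℝ} (hf : Sm f) :
    ∫ x, f x ^ 99 * ∑ a, pd a (pd a f) x = -(99 * ∑ a, ∫ x, f x ^ 98 * pd a f x ^ 2) := by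
  have h99 : Sm fun x => f x ^ 99 := hf.pow (by norm_num)
  simp only [Finset.mul_sum]
  rw [integral_finsetSum _ fun a _ => h99.integrable_mul ((hf.pd a).pd a), ← Finset.sum_neg_distrib]
  refine Finset.sum_congr rfl fun a _ => ?_
  rw [integral_mul_pd h99 (hf.pd a), pd_pow hf.diff, ← integral_const_mul]
  congr 1
  refine integral_congr_ae (Eventually.of_forall fun x => ?_)
  simp only [Nat.reduceSub, Nat.cast_ofNat]
  rw [sq]
  simp only [mul_assoc]

theorem abs_integral_pow_mul_le {f g : E3 → ℝ} (hf : BL2 f) (hg : BL2 g) {θ : ℝ} (hθ : 0 < θ) :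
    |∫ x, f x ^ 99 * g x| ≤ θ * ((∫ x, f x ^ 100) + (nm g / θ) ^ 100) := by
  have hgp := hg.integrable_pow (n := 100) (by norm_num)
  have hfp := hf.integrable_pow (n := 100) (by norm_num)
  have hi : Integrable fun x => θ * (f x ^ 100 + (θ⁻¹) ^ 100 * g x ^ 100) :=
    (hfp.add (hgp.const_mul _)).const_mul _
  refine (norm_integral_le_of_norm_le (f := fun x => f x ^ 99 * g x) hi (Eventually.of_forall fun x => ?_)).trans_eq ?_
  · rw [Real.norm_eq_abs, abs_mul, abs_pow, ← mul_pow]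
    have h1 := pow_mul_le |f x| |θ⁻¹ * g x|
    rw [abs_pow_hundred, abs_pow_hundred] at h1
    calc |f x| ^ 99 * |g x| = θ * (|f x| ^ 99 * |θ⁻¹ * g x|) := by
          rw [abs_mul, abs_inv, abs_of_pos hθ]; field_simp
      _ ≤ _ := by gcongr
  · rw [integral_const_mul, integral_add hfp (hgp.const_mul _), integral_const_mul, ← nm_pow hg,
      div_eq_inv_mul, mul_pow]

/-- Two integrations of the budget: viscosity provides 100 · 99 ν D, of which `dissipation` turns
6000 ν D into lam times the integral of f^100. The forcing, split by Young with θ = lam/200, uses up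
half of that. -/
theorem integral_pow_mul_evolution_le (hφ : IsCutoff φ) {M : ℝ} (hM : KBound φ M) (hν : 0 < ν)
    (j : ℤ) {v G : E3 → ℝ} (hv : Sm v) (hG : BL2 G) {g lam : ℝ} (hg : nm G ≤ g)
    (hl : lam = ν * ((2 : ℝ) ^ j) ^ 2 / (10 * M ^ 2)) :
    100 * ∫ x, lp φ j v x ^ 99 * (ν * (∑ a, pd a (pd a (lp φ j v)) x) - G x) ≤
      lam / 2 * ((200 * g / lam) ^ 100 - ∫ x, lp φ j v x ^ 100) := by
  have hM0 : 0 < M := zero_lt_one.trans_le hM.one_le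
  have hlam : 0 < lam := by rw [hl]; positivity
  have hf := lp_sm (φ := φ) hv j
  have hdis := dissipation hφ hM hv j
  set f := lp φ j v with hfd
  set y := ∫ x, f x ^ 100 with hy
  set D := ∑ a, ∫ x, f x ^ 98 * pd a f x ^ 2 with hD
  have h99 : Sm fun x => f x ^ 99 := hf.pow (by norm_num)
  have i1 : Integrable fun x => ν * (f x ^ 99 * ∑ a, pd a (pd a f) x) :=
    (h99.integrable_mul (Sm.sum fun a => (hf.pd a).pd a)).const_mul ν
  have i2 : Integrable fun x => f x ^ 99 * G x := h99.bl2.integrable_mul hG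
  have e1 : ∫ x, f x ^ 99 * (ν * (∑ a, pd a (pd a f) x) - G x)
      = -(99 * ν * D) - ∫ x, f x ^ 99 * G x := by
    have : ∀ x, f x ^ 99 * (ν * (∑ a, pd a (pd a f) x) - G x)
        = ν * (f x ^ 99 * ∑ a, pd a (pd a f) x) - f x ^ 99 * G x := fun x => by
      rw [mul_sub, mul_left_comm]
    rw [integral_congr_ae (Eventually.of_forall this), integral_sub i1 i2, integral_const_mul,
      integral_pow_mul_laplacian hf]
    ring
  have h1 := abs_integral_pow_mul_le hf.bl2 hG (θ := lam / 200) (by positivity)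
  have h2 : (nm G / (lam / 200)) ^ 100 ≤ (200 * g / lam) ^ 100 := by
    refine pow_le_pow_left₀ (div_nonneg (nm_nonneg G) (by positivity)) ?_ _
    rw [div_div_eq_mul_div, mul_comm]
    gcongr
  have h3 : lam * y ≤ 6000 * ν * D := by
    have h4 : ((2 : ℝ) ^ j) ^ 2 * ((2 : ℝ) ^ (-j)) ^ 2 = 1 := by
      rw [← mul_pow, ← zpow_add₀ two_ne_zero]; simp
    calc lam * y ≤ lam * (60000 * M ^ 2 * ((2 : ℝ) ^ (-j)) ^ 2 * D) := by gcongr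
      _ = 6000 * ν * D * (((2 : ℝ) ^ j) ^ 2 * ((2 : ℝ) ^ (-j)) ^ 2) := by
          rw [hl]; field_simp; ring
      _ = _ := by rw [h4, mul_one]
  have hD0 : 0 ≤ ν * D := by
    have : 0 ≤ y := integral_nonneg fun x => by
      simp only [Pi.zero_apply]; rw [← abs_pow_hundred]; exact pow_nonneg (abs_nonneg _) _
    nlinarith [mul_nonneg hlam.le this]
  have h5 := (abs_le.1 h1).1
  rw [e1]
  have h6 : lam / 200 * (nm G / (lam / 200)) ^ 100 ≤ lam / 200 * (200 * g / lam) ^ 100 := by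
    gcongr
  linarith

/-- Each high-frequency piece is controlled by its initial size and the bilinear forcing. -/
theorem Classical.nm_lp_le (hφ : IsCutoff φ) (h : Classical ν T U P) (hν : 0 < ν)
    {M : ℝ} (hM : KBound φ M) (m : ℕ) (i : Fin 3) {T' R W : ℝ} (hT : T' ≤ T)
    (hR : ∀ s ∈ Set.Icc 0 T', ∀ a x, |U s a x| ≤ R)
    (hW : ∀ s ∈ Set.Icc 0 T', ∀ a,
      nm (fun x => U s a x - cv (kS φ (m : ℤ)) (U s a) x) ≤ W)
    {t : ℝ} (ht : t ∈ Set.Icc 0 T') :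
    nm (lp φ ((m : ℤ) + 3) (U t i)) ≤ max (nm (lp φ ((m : ℤ) + 3) (U 0 i)))
      (72000 * M ^ 4 * R * W / (ν * (2 : ℝ) ^ ((m : ℤ) + 3))) := by
  set j := (m : ℤ) + 3 with hj
  have hM0 : 0 < M := zero_lt_one.trans_le hM.one_le
  set lam := ν * ((2 : ℝ) ^ j) ^ 2 / (10 * M ^ 2) with hl
  have hlam : 0 < lam := by positivity
  set g := 36 * M ^ 2 * (2 : ℝ) ^ j * R * W with hg
  have hQ : 200 * g / lam = 72000 * M ^ 4 * R * W / (ν * (2 : ℝ) ^ j) := by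
    rw [hg, hl]; field_simp; ring
  rw [← hQ]
  set Z := max (nm (lp φ j (U 0 i))) (200 * g / lam) with hZ
  have hZ0 : 0 ≤ Z := (nm_nonneg _).trans (le_max_left _ _)
  have hT0 : (0 : ℝ) ≤ T' := ht.1.trans ht.2
  have hsub : Set.Icc 0 T' ⊆ Set.Icc 0 T := Set.Icc_subset_Icc_right hT
  have hbl : ∀ s ∈ Set.Icc 0 T', BL2 (lp φ j (U s i)) := fun s hs =>
    (lp_sm (h.sm s (hsub hs) i) j).bl2
  have hg0 : 0 ≤ g := (nm_nonneg _).trans (nm_leray_transport_le hφ hM m i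
    (h.sm 0 (hsub ⟨le_rfl, hT0⟩)) (h.div 0 (hsub ⟨le_rfl, hT0⟩)) (hR 0 ⟨le_rfl, hT0⟩)
    (hW 0 ⟨le_rfl, hT0⟩))
  have hQ0 : 0 ≤ 200 * g / lam := by positivity
  -- Barrier argument: whenever the integral equals a level K > Z^100, its derivative is strictly
  -- negative, so the level is not crossed. Strictness is the reason for working with K > Z^100 and
  -- letting K decrease to Z^100 afterwards.
  have key : ∀ K, Z ^ 100 < K → ∫ x, lp φ j (U t i) x ^ 100 ≤ K := by
    intro K hK
    refine image_le_of_deriv_right_lt_deriv_boundary' (B := fun _ => K) (B' := fun _ => 0)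
      (fun s hs => ((h.hasDerivWithinAt_lp hφ hν.le hM j i (hsub hs)).continuousWithinAt).mono hsub)
      (fun s hs => (h.hasDerivWithinAt_lp hφ hν.le hM j i
        (hsub (Set.Ico_subset_Icc_self hs))).mono_of_mem_nhdsWithin
          (Filter.mem_of_superset (Icc_mem_nhdsGE (hs.2.trans_le hT))
            (Set.Icc_subset_Icc_left hs.1)))
      ?_ continuousOn_const (fun s _ => hasDerivWithinAt_const _ _ _) ?_ ht
    · rw [← nm_pow (hbl 0 ⟨le_rfl, hT0⟩)]
      exact (pow_le_pow_left₀ (nm_nonneg _) (le_max_left _ _) _).trans hK.le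
    · intro s hs hsK
      have hs' := Set.Ico_subset_Icc_self hs
      have hsm := h.sm s (hsub hs')
      have h1 := integral_pow_mul_evolution_le hφ hM hν j (hsm i)
        (bl2_leray (φ := φ) j i fun a => (sm_transport hsm a).bl2)
        (nm_leray_transport_le hφ hM m i hsm (h.div s (hsub hs')) (hR s hs') (hW s hs')) hl
      refine h1.trans_lt ?_
      have h2 : (200 * g / lam) ^ 100 ≤ Z ^ 100 := pow_le_pow_left₀ hQ0 (le_max_right _ _) _
      refine mul_neg_of_pos_of_neg (by positivity) ?_
      rw [hsK]
      linarith
  have h1 : nm (lp φ j (U t i)) ^ 100 ≤ Z ^ 100 := by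
    rw [nm_pow (hbl t ht)]
    exact le_of_forall_gt_imp_ge_of_dense key
  exact le_of_pow_le_pow_left₀ (by norm_num) hZ0 h1

end Evolution

/-! ### Dyadic sums of vector fields in terms of components -/

/-- The vector field with given components. -/
def vec (w : Fin 3 → E3 → ℝ) (x : E3) : E3 := WithLp.toLp 2 fun i => w i x

theorem contDiff_vec {w : Fin 3 → E3 → ℝ} (hw : ∀ i, Sm (w i)) : ContDiff ℝ ∞ (vec w) :=
  contDiff_euclidean.2 fun i => (hw i).contDiff

theorem partialD_vec_apply {w : Fin 3 → E3 → ℝ} (hw : ∀ i, Sm (w i)) {n : ℕ} (s : Fin n → Fin 3)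
    (x : E3) (i : Fin 3) : partialD s (vec w) x i = partialD s (w i) x := by
  have h := (EuclideanSpace.proj i : E3 →L[ℝ] ℝ).iteratedFDeriv_comp_left (x := x) (i := n)
    (contDiff_vec hw).contDiffAt (by exact_mod_cast le_top)
  have e : (EuclideanSpace.proj i : E3 →L[ℝ] ℝ) ∘ vec w = w i := rfl
  rw [e] at h
  unfold partialD
  rw [h]
  rfl

theorem partialD_three (s : Fin 3 → Fin 3) {f : E3 → ℝ} (hf : ContDiff ℝ ∞ f) :
    partialD s f = pd (s 0) (pd (s 1) (pd (s 2) f)) := by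
  rw [partialD_succ_real _ hf, partialD_succ_real _ hf, partialD_succ_real _ hf, partialD_zero]
  rfl

theorem lpProj_eq_vec {φ : E3 → ℝ} (hφ : IsCutoff φ) (j : ℤ) {u : E3 → E3} {U : Fin 3 → E3 → ℝ}
    (hU : ∀ i, Sm (U i)) (h : ∀ i, U i =ᵐ[volume] fun x => u x i) :
    lpProj φ j u = vec fun i => lp φ j (U i) := by
  ext x i
  have h0 : u =ᵐ[volume] vec U := by
    filter_upwards [eventually_all.2 h] with x hx
    ext i
    exact (hx i).symm
  have h1 : ∀ᵐ y, u (x - y) = vec U (x - y) := (quasiMeasurePreserving_sub_left volume x).ae h0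
  have h2 : lpProj φ j u x = ∫ y, kP φ j y • vec U (x - y) := by
    unfold lpProj
    rw [lpKernel_eq hφ]
    exact integral_congr_ae (h1.mono fun y hy => by simp only [hy])
  have hi : ∀ i, Integrable fun y => (kP φ j y • vec U (x - y)) i := fun i =>
    (hU i).bl2.integrable_cv (kP φ j).integrable x
  rw [h2, eval_integral_piLp hi]
  rfl

theorem abs_partialD_le_derivNorm {w : Fin 3 → E3 → ℝ} (hw : ∀ i, Sm (w i)) {n : ℕ}
    (s : Fin n → Fin 3) (x : E3) (i : Fin 3) :
    |partialD s (w i) x| ≤ derivNorm n (vec w) x := by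
  rw [← partialD_vec_apply hw]
  refine (PiLp.norm_apply_le (partialD s (vec w) x) i).trans (Real.le_sqrt_of_sq_le ?_)
  exact Finset.single_le_sum (f := fun s => ‖partialD s (vec w) x‖ ^ 2) (fun _ _ => sq_nonneg _)
    (Finset.mem_univ s)

theorem sqrt_sum_sq_le {ι : Type*} (s : Finset ι) {f : ι → ℝ} (hf : ∀ i ∈ s, 0 ≤ f i) :
    √(∑ i ∈ s, f i ^ 2) ≤ ∑ i ∈ s, f i := by
  rw [Real.sqrt_le_left (Finset.sum_nonneg hf)]
  exact Finset.sum_sq_le_sq_sum_of_nonneg hf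

theorem derivNorm_vec_le {w : Fin 3 → E3 → ℝ} (hw : ∀ i, Sm (w i)) (n : ℕ) (x : E3) :
    derivNorm n (vec w) x ≤ ∑ s : Fin n → Fin 3, ∑ i, |partialD s (w i) x| := by
  refine (sqrt_sum_sq_le _ fun _ _ => norm_nonneg _).trans (Finset.sum_le_sum fun s _ => ?_)
  rw [EuclideanSpace.norm_eq]
  refine (sqrt_sum_sq_le _ fun _ _ => norm_nonneg _).trans_eq ?_
  simp only [partialD_vec_apply hw, Real.norm_eq_abs]

theorem derivNorm_nonneg {F : Type*} [NormedAddCommGroup F] [NormedSpace ℝ F] (n : ℕ) (f : E3 → F)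
    (x : E3) : 0 ≤ derivNorm n f x := Real.sqrt_nonneg _

theorem sm_partialD {f : E3 → ℝ} (hf : Sm f) {n : ℕ} (s : Fin n → Fin 3) : Sm (partialD s f) := by
  induction n with
  | zero => rwa [partialD_zero]
  | succ n ih => rw [partialD_succ_real s hf.contDiff]; exact (ih _).pd _

theorem nm_eq_toReal {f : E3 → ℝ} (hf : BL2 f) : nm f = (eLpNorm f 100 volume).toReal :=
  (toReal_eLpNorm hf.cont.aestronglyMeasurable).symm

theorem ofReal_nm {f : E3 → ℝ} (hf : BL2 f) : ENNReal.ofReal (nm f) = eLpNorm f 100 volume :=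
  ofReal_lpNorm hf.memLp_hundred

theorem eLpNorm_derivNorm_vec_le {w : Fin 3 → E3 → ℝ} (hw : ∀ i, Sm (w i)) {n : ℕ} {D : ℝ}
    (hD : ∀ (s : Fin n → Fin 3) i, nm (partialD s (w i)) ≤ D) :
    eLpNorm (derivNorm n (vec w)) 100 volume ≤ ENNReal.ofReal (3 ^ n * (3 * D)) := by
  have hb : ∀ (s : Fin n → Fin 3) i, BL2 (partialD s (w i)) := fun s i => (sm_partialD (hw i) s).bl2
  have hm : ∀ (s : Fin n → Fin 3) i, AEStronglyMeasurable (fun x => |partialD s (w i) x|) volume :=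
    fun s i => (hb s i).cont.abs.aestronglyMeasurable
  have h1 : eLpNorm (derivNorm n (vec w)) 100 volume ≤
      eLpNorm (∑ s : Fin n → Fin 3, ∑ i, fun x => |partialD s (w i) x|) 100 volume :=
    eLpNorm_mono_real fun x => by
      rw [Real.norm_of_nonneg (derivNorm_nonneg _ _ _)]
      simpa only [Finset.sum_apply] using derivNorm_vec_le hw n x
  have hD0 : 0 ≤ D := (nm_nonneg _).trans (hD (fun _ => 0) 0)
  calc _ ≤ _ := h1
    _ ≤ ∑ s : Fin n → Fin 3, ∑ i, eLpNorm (fun x => |partialD s (w i) x|) 100 volume :=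
        (eLpNorm_sum_le (fun s _ => Finset.aestronglyMeasurable_sum _ fun i _ => hm s i)
          (by norm_num)).trans
        (Finset.sum_le_sum fun s _ => eLpNorm_sum_le (fun i _ => hm s i) (by norm_num))
    _ ≤ ∑ s : Fin n → Fin 3, ∑ i : Fin 3, ENNReal.ofReal D := by
        refine Finset.sum_le_sum fun s _ => Finset.sum_le_sum fun i _ => ?_
        have : eLpNorm (fun x => |partialD s (w i) x|) 100 volume
            = eLpNorm (partialD s (w i)) 100 volume := eLpNorm_norm (partialD s (w i))
        rw [this, ← ofReal_nm (hb s i)]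
        exact ENNReal.ofReal_le_ofReal (hD s i)
    _ = ENNReal.ofReal (3 ^ n * (3 * D)) := by
        simp only [Finset.sum_const, Finset.card_univ, Fintype.card_fun, Fintype.card_fin,
          nsmul_eq_mul]
        rw [ENNReal.ofReal_mul (by positivity), ENNReal.ofReal_mul (by positivity)]
        norm_num

section DyadicSum

variable {φ : E3 → ℝ} {M : ℝ} {u : E3 → E3} {U : Fin 3 → E3 → ℝ}

/-- δ_m is the L^100 norm of D²P_{m+1} u itself, the shift matching a sum that starts at j = 1. The
factor 3 counts the second derivatives in the Laplacian. -/
theorem exists_nm_lp_le_of_dyadicSum_le (hφ : IsCutoff φ) (hM : KBound φ M) (hU : ∀ i, Sm (U i))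
    (h : ∀ i, U i =ᵐ[volume] fun x => u x i) {A : ℝ} (hA : 0 ≤ A)
    (hs : dyadicSum φ 2 100 u ≤ ENNReal.ofReal A) :
    ∃ δ : ℕ → ℝ, (∀ m, 0 ≤ δ m) ∧ (∀ n, ∑ m ∈ Finset.range n, δ m ^ 100 ≤ A) ∧
      ∀ m i, nm (lp φ ((m + 1 : ℕ) : ℤ) (U i)) ≤ 3 * M * ((4 : ℝ)⁻¹) ^ (m + 1) * δ m := by
  set τ : ℕ → ℝ≥0∞ := fun m => eLpNorm (derivNorm 2 (lpProj φ ((m : ℤ) + 1) u)) 100 volume with hτ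
  have hsum : ∑' m, τ m ^ 100 ≤ ENNReal.ofReal A := hs
  have hfin : ∀ m, τ m ≠ ⊤ := fun m hm => by
    have := (ENNReal.le_tsum (f := fun m => τ m ^ 100) m).trans hsum
    simp [hm] at this
  refine ⟨fun m => (τ m).toReal, fun m => ENNReal.toReal_nonneg, fun n => ?_, fun m i => ?_⟩
  · have h1 := (ENNReal.sum_le_tsum (f := fun m => τ m ^ 100) (Finset.range n)).trans hsum
    have h2 := ENNReal.toReal_mono ENNReal.ofReal_ne_top h1
    rw [ENNReal.toReal_ofReal hA, ENNReal.toReal_sum fun m _ => ENNReal.pow_ne_top (hfin m)] at h2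
    simpa only [ENNReal.toReal_pow] using h2
  · have hM0 : 0 ≤ M := zero_le_one.trans hM.one_le
    have hcast : ((m + 1 : ℕ) : ℤ) = (m : ℤ) + 1 := by push_cast; rfl
    rw [hcast]
    have hw : ∀ i, Sm (lp φ ((m : ℤ) + 1) (U i)) := fun i => lp_sm (hU i) _
    have hd : ∀ a, nm (pd a (pd a (lp φ ((m : ℤ) + 1) (U i)))) ≤ (τ m).toReal := fun a => by
      rw [nm_eq_toReal (((hw i).pd a).pd a).bl2]
      refine ENNReal.toReal_mono (hfin m) ?_
      rw [hτ]
      simp only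
      rw [lpProj_eq_vec hφ _ hU h, ← partialD_two a a (hw i).contDiff]
      exact eLpNorm_mono_real fun x => abs_partialD_le_derivNorm hw _ x i
    refine (nm_lp_le hφ hM (hU i) _).trans ?_
    have e : ((2 : ℝ) ^ (-((m : ℤ) + 1))) ^ 2 = ((4 : ℝ)⁻¹) ^ (m + 1) := by
      rw [← hcast, zpow_neg, zpow_natCast, ← inv_pow, ← pow_mul, mul_comm, pow_mul]; norm_num
    rw [e]
    calc _ ≤ M * (4⁻¹ : ℝ) ^ (m + 1) * ∑ a : Fin 3, (τ m).toReal := by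
          gcongr with a; exact hd a
      _ = _ := by simp; ring

/-- Three derivatives cost 8^j by Bernstein, exactly the decay assumed. The factor 81 = 27 · 3
counts the partial derivatives of order three and the components. -/
theorem dyadicSum_le_of_nm_lp_le (hφ : IsCutoff φ) (hM : KBound φ M) (hU : ∀ i, Sm (U i))
    (h : ∀ i, U i =ᵐ[volume] fun x => u x i) {D : ℝ} {e : ℕ → ℝ} (he : ∀ m, 0 ≤ e m)
    (hD : ∀ n, ∑ m ∈ Finset.range n, e m ^ 100 ≤ D)
    (hb : ∀ m i, nm (lp φ ((m + 1 : ℕ) : ℤ) (U i)) ≤ ((8 : ℝ)⁻¹) ^ (m + 1) * e m) :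
    dyadicSum φ 3 100 u ≤ ENNReal.ofReal ((81 * M) ^ 100 * D) := by
  have hM0 : 0 ≤ M := zero_le_one.trans hM.one_le
  have hterm : ∀ m : ℕ, eLpNorm (derivNorm 3 (lpProj φ ((m : ℤ) + 1) u)) 100 volume ^ 100 ≤
      ENNReal.ofReal ((81 * M) ^ 100 * e m ^ 100) := fun m => by
    have hcast : ((m + 1 : ℕ) : ℤ) = (m : ℤ) + 1 := by push_cast; rfl
    have hw : ∀ i, Sm (lp φ ((m : ℤ) + 1) (U i)) := fun i => lp_sm (hU i) _
    rw [← mul_pow, ENNReal.ofReal_pow (mul_nonneg (by positivity) (he m))]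
    refine pow_le_pow_left₀ zero_le ?_ _
    rw [lpProj_eq_vec hφ _ hU h]
    have h1 : ∀ (s : Fin 3 → Fin 3) i, nm (partialD s (lp φ ((m : ℤ) + 1) (U i))) ≤ M * e m :=
      fun s i => by
        rw [partialD_three s (hw i).contDiff]
        refine (nm_pd3_lp_le hφ hM (hU i) _ _ _ _).trans ?_
        have h2 := hb m i
        rw [hcast] at h2
        have e8 : ((2 : ℝ) ^ ((m : ℤ) + 1)) ^ 3 * ((8 : ℝ)⁻¹) ^ (m + 1) = 1 := by
          rw [← hcast, zpow_natCast, ← pow_mul, mul_comm (m + 1), pow_mul, ← mul_pow]; norm_num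
        calc _ ≤ M * ((2 : ℝ) ^ ((m : ℤ) + 1)) ^ 3 * (((8 : ℝ)⁻¹) ^ (m + 1) * e m) := by gcongr
          _ = M * e m * (((2 : ℝ) ^ ((m : ℤ) + 1)) ^ 3 * ((8 : ℝ)⁻¹) ^ (m + 1)) := by ring
          _ = _ := by rw [e8, mul_one]
    refine (eLpNorm_derivNorm_vec_le hw h1).trans_eq ?_
    congr 1; ring
  unfold dyadicSum
  refine ENNReal.tsum_le_of_sum_range_le fun n => ?_
  refine (Finset.sum_le_sum fun m _ => hterm m).trans ?_
  rw [← ENNReal.ofReal_sum_of_nonneg fun m _ =>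
    mul_nonneg (pow_nonneg (by positivity) _) (pow_nonneg (he m) _), ← Finset.mul_sum]
  exact ENNReal.ofReal_le_ofReal (mul_le_mul_of_nonneg_left (hD n) (pow_nonneg (by positivity) _))

end DyadicSum

/-! ### Gaining one derivative -/

section Bootstrap

variable {φ : E3 → ℝ} {M ν T : ℝ} {U : ℝ → Fin 3 → E3 → ℝ} {P : ℝ → E3 → ℝ}

theorem sum_geometric_succ_le {r : ℝ} (h0 : 0 ≤ r) (h1 : r < 1) (n : ℕ) :
    ∑ m ∈ Finset.range n, r ^ (m + 1) ≤ r / (1 - r) := by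
  have h2 : 0 < 1 - r := by linarith
  simp only [pow_succ, ← Finset.sum_mul]
  rw [geom_sum_eq h1.ne, div_mul_eq_mul_div, ← neg_div_neg_eq]
  have h3 : -(r - 1) = 1 - r := by ring
  rw [h3]
  refine div_le_div_of_nonneg_right ?_ h2.le
  nlinarith [pow_nonneg h0 n]

theorem pd_lp {f : E3 → ℝ} (hf : Sm f) (j : ℤ) (a : Fin 3) :
    pd a (lp φ j f) = lp φ j (pd a f) := hf.pd_cv (kP φ j).integrable a

theorem nm_lp_le_nm (hM : KBound φ M) {f : E3 → ℝ} (hf : Sm f) (j : ℤ) :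
    nm (lp φ j f) ≤ M * nm f :=
  (nm_cv_le (kP φ j).integrable hf.bl2).trans
    (mul_le_mul_of_nonneg_right (hM.l1_kP j) (nm_nonneg f))

/-- The Bernstein inequality for the Laplacian, used twice. Applied to the initial data it supplies
the decay 16^{-j} that the second smoothing pass needs. -/
theorem nm_lp_le_bilaplacian (hφ : IsCutoff φ) (hM : KBound φ M) {f : E3 → ℝ} (hf : Sm f) (m : ℕ) :
    nm (lp φ ((m + 1 : ℕ) : ℤ) f) ≤
      ((16 : ℝ)⁻¹) ^ (m + 1) * (M ^ 3 * ∑ a, ∑ b, nm (pd b (pd b (pd a (pd a f))))) := by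
  have hM0 : 0 ≤ M := zero_le_one.trans hM.one_le
  set j : ℤ := ((m + 1 : ℕ) : ℤ) with hj
  have e : ((2 : ℝ) ^ (-j)) ^ 2 * ((2 : ℝ) ^ (-j)) ^ 2 = ((16 : ℝ)⁻¹) ^ (m + 1) := by
    rw [hj, zpow_neg, zpow_natCast, ← inv_pow, ← pow_add, ← pow_mul, mul_comm, pow_mul]; norm_num
  have h1 : ∀ {g : E3 → ℝ}, Sm g →
      nm (lp φ j g) ≤ M * ((2 : ℝ) ^ (-j)) ^ 2 * ∑ a, nm (lp φ j (pd a (pd a g))) :=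
    fun {g} hg => by simpa only [pd_lp hg, pd_lp (hg.pd _)] using nm_lp_le hφ hM hg j
  calc _ ≤ M * ((2 : ℝ) ^ (-j)) ^ 2 * ∑ a, nm (lp φ j (pd a (pd a f))) := h1 hf
    _ ≤ M * ((2 : ℝ) ^ (-j)) ^ 2 * ∑ a, (M * ((2 : ℝ) ^ (-j)) ^ 2 *
          ∑ b, M * nm (pd b (pd b (pd a (pd a f))))) := by
        gcongr with a
        refine (h1 ((hf.pd a).pd a)).trans ?_
        gcongr with b
        exact nm_lp_le_nm hM ((((hf.pd a).pd a).pd b).pd b) j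
    _ = _ := by
        rw [← e]
        simp only [← Finset.mul_sum]
        ring

/-- Interpolates two Bernstein bounds: from L^100, with loss 2^{3k/100} rounded up to 2^k, and from
L², with loss 2^{3k/2} rounded up to 4^k. The rounding still leaves decay. -/
theorem abs_lp_le_of_nm_le (hφ : IsCutoff φ) (hM : KBound φ M) {f : E3 → ℝ} (hf : Sm f)
    {E Y y : ℝ} (hE0 : 0 ≤ E) (hE : ∫ x, f x ^ 2 ≤ E ^ 2) (hY : 0 ≤ Y) (hy : 0 ≤ y)
    (hyY : Y ^ 7 = y ^ 10) {m : ℕ}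
    (hm : nm (lp φ ((m + 1 : ℕ) : ℤ) f) ≤ 3 * M * ((4 : ℝ)⁻¹) ^ (m + 1) * Y) (x : E3) :
    |lp φ ((m + 1 : ℕ) : ℤ) f x| ≤ 3 * M ^ 2 * (1 + E) * y * (15 / 16 : ℝ) ^ (m + 1) := by
  have hM1 := hM.one_le
  have hM0 : 0 ≤ M := zero_le_one.trans hM1
  set k := m + 1 with hk
  set v := |lp φ (k : ℤ) f x| with hv
  have hv0 : 0 ≤ v := abs_nonneg _
  have h2k : (1 : ℝ) ≤ 2 ^ k := one_le_pow₀ (by norm_num)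
  have b1 : v ≤ 3 * M ^ 2 * (2⁻¹ : ℝ) ^ k * Y := by
    have h1 := abs_lp_pow_le hφ hM hf (k : ℤ) x
    rw [zpow_natCast] at h1
    have h2 : v ^ 100 ≤ (M * 2 ^ k * nm (lp φ (k : ℤ) f)) ^ 100 := by
      refine h1.trans ?_
      rw [mul_pow, mul_pow]
      have h3 : ((2 : ℝ) ^ k) ^ 3 ≤ ((2 : ℝ) ^ k) ^ 100 := pow_le_pow_right₀ h2k (by norm_num)
      exact mul_le_mul_of_nonneg_right (mul_le_mul_of_nonneg_left h3 (pow_nonneg hM0 _))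
        (pow_nonneg (nm_nonneg _) _)
    have h3 := le_of_pow_le_pow_left₀ (by norm_num)
      (mul_nonneg (mul_nonneg hM0 (by positivity)) (nm_nonneg _)) h2
    calc v ≤ M * 2 ^ k * (3 * M * ((4 : ℝ)⁻¹) ^ k * Y) := h3.trans (by gcongr)
      _ = 3 * M ^ 2 * ((2 : ℝ) ^ k * ((4 : ℝ)⁻¹) ^ k) * Y := by ring
      _ = _ := by rw [← mul_pow]; norm_num
  have b2 : v ≤ M * 4 ^ k * E := by
    have h1 := abs_lp_sq_le hM hf.bl2 (k : ℤ) x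
    rw [zpow_natCast] at h1
    simp only [sq_abs (f _)] at h1
    refine le_of_pow_le_pow_left₀ two_ne_zero (by positivity) (h1.trans ?_)
    calc M ^ 2 * ((2 : ℝ) ^ k) ^ 3 * ∫ x, f x ^ 2 ≤ M ^ 2 * ((2 : ℝ) ^ k) ^ 4 * E ^ 2 := by
          have h3 : ((2 : ℝ) ^ k) ^ 3 ≤ ((2 : ℝ) ^ k) ^ 4 := pow_le_pow_right₀ h2k (by norm_num)
          gcongr
      _ = (M * 4 ^ k * E) ^ 2 := by
          have h4 : (4 : ℝ) ^ k = (2 ^ k) ^ 2 := by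
            rw [← pow_mul, mul_comm, pow_mul]; norm_num
          rw [h4]; ring
  -- The weights 7/10 and 3/10 appear as v^10 = v^7 v^3, and 2^{-7k} 4^{3k} = 2^{-k}. The rate 15/16
  -- is a rational number whose tenth power still exceeds 1/2.
  refine le_of_pow_le_pow_left₀ (n := 10) (by norm_num) (by positivity) ?_
  calc v ^ 10 = v ^ 7 * v ^ 3 := by ring
    _ ≤ (3 * M ^ 2 * (2⁻¹ : ℝ) ^ k * Y) ^ 7 * (M * 4 ^ k * E) ^ 3 := by gcongr
    _ = 3 ^ 7 * M ^ 17 * E ^ 3 * Y ^ 7 * (((2⁻¹ : ℝ) ^ k) ^ 7 * (4 ^ k) ^ 3) := by ring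
    _ = 3 ^ 7 * M ^ 17 * E ^ 3 * Y ^ 7 * (2⁻¹ : ℝ) ^ k := by
        congr 1
        rw [← pow_mul, ← pow_mul, mul_comm k, mul_comm k, pow_mul, pow_mul, ← mul_pow]
        norm_num
    _ ≤ 3 ^ 10 * M ^ 20 * (1 + E) ^ 10 * y ^ 10 * ((15 / 16 : ℝ) ^ 10) ^ k := by
        rw [hyY]
        have hE1 : E ^ 3 ≤ (1 + E) ^ 10 :=
          (pow_le_pow_left₀ hE0 (by linarith) 3).trans
            (pow_le_pow_right₀ (by linarith) (by norm_num))
        gcongr <;> norm_num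
    _ = _ := by
        have e : ((15 / 16 : ℝ) ^ 10) ^ k = ((15 / 16) ^ k) ^ 10 := by
          rw [← pow_mul, mul_comm, pow_mul]
        rw [e]
        simp only [mul_pow, ← pow_mul]

theorem abs_le_of_nm_lp_le (hφ : IsCutoff φ) (hM : KBound φ M) {f : E3 → ℝ} (hf : Sm f)
    {E Y y : ℝ} (hE0 : 0 ≤ E) (hE : ∫ x, f x ^ 2 ≤ E ^ 2) (hY : 0 ≤ Y) (hy : 1 ≤ y)
    (hyY : Y ^ 7 = y ^ 10)
    (h : ∀ m : ℕ, nm (lp φ ((m + 1 : ℕ) : ℤ) f) ≤ 3 * M * ((4 : ℝ)⁻¹) ^ (m + 1) * Y) (x : E3) :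
    |f x| ≤ 46 * M ^ 2 * (1 + E) * y := by
  have hM1 := hM.one_le
  have hM0 : 0 ≤ M := zero_le_one.trans hM1
  have hlow : |cv (kS φ 0) f x| ≤ M * E := by
    refine le_of_pow_le_pow_left₀ two_ne_zero (by positivity) ((abs_low_sq_le hM hf.bl2 x).trans ?_)
    simp only [sq_abs]
    rw [mul_pow]
    gcongr
  -- The geometric series of ratio 15/16 sums to 15, so 46 = 3 · 15 + 1, the last unit coming from
  -- the low frequencies.
  have hhigh := abs_le_low_add hφ hf.bl2 x
    (fun m => abs_lp_le_of_nm_le hφ hM hf hE0 hE hY (by linarith) hyY (h m) x)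
    (S := 3 * M ^ 2 * (1 + E) * y * 15) fun n => by
      rw [← Finset.mul_sum]
      gcongr
      exact (sum_geometric_succ_le (by norm_num) (by norm_num) n).trans (by norm_num)
  have h1 : M * E ≤ M ^ 2 * (1 + E) * y := by
    calc M * E ≤ M ^ 2 * (1 + E) := by gcongr <;> nlinarith
      _ ≤ _ := le_mul_of_one_le_right (by positivity) hy
  linarith

/-- The forcing bound carries R W / (ν 2^j), and the tail W above frequency 2^{j-3} inherits the
decay r^{-j} of the pieces. The quotient by 2^j is the gained derivative; the data must already
decay at the improved rate. -/
theorem Classical.gain_one (hφ : IsCutoff φ) (hM : KBound φ M) (h : Classical ν T U P)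
    (hν : 0 < ν) {T' R L K r : ℝ} (hT : T' ≤ T) (hr2 : 2 ≤ r) (hr8 : r ≤ 8) (hL : 0 ≤ L)
    (hK4 : 4 ≤ K) (hK : 72000 * 512 * M ^ 4 * R / ν ≤ K) (hR0 : 0 ≤ R)
    (hR : ∀ s ∈ Set.Icc 0 T', ∀ a x, |U s a x| ≤ R)
    (hLs : ∀ s ∈ Set.Icc 0 T', ∀ a, ∀ m : ℕ,
      nm (lp φ ((m + 1 : ℕ) : ℤ) (U s a)) ≤ (r⁻¹) ^ (m + 1) * L)
    (h0 : ∀ a, ∀ m : ℕ, nm (lp φ ((m + 1 : ℕ) : ℤ) (U 0 a)) ≤ ((2 * r)⁻¹) ^ (m + 1) * L)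
    {t : ℝ} (ht : t ∈ Set.Icc 0 T') (a : Fin 3) (m : ℕ) :
    nm (lp φ ((m + 1 : ℕ) : ℤ) (U t a)) ≤ ((2 * r)⁻¹) ^ (m + 1) * (K * L) := by
  have hr0 : 0 < r := by linarith
  have hM1 := hM.one_le
  have hM0 : 0 < M := zero_lt_one.trans_le hM1
  have hrr : (r⁻¹ : ℝ) = (2 * r)⁻¹ * 2 := by field_simp
  -- The bands j = 1, 2 are too low for the filter at j - 3 ≥ 0. There the missing factor 2^j ≤ 4 is
  -- absorbed by `K`.
  have low : m < 2 → nm (lp φ ((m + 1 : ℕ) : ℤ) (U t a)) ≤ ((2 * r)⁻¹) ^ (m + 1) * (K * L) := by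
    intro hm
    refine (hLs t ht a m).trans ?_
    rw [hrr, mul_pow, mul_assoc]
    gcongr
    refine le_trans ?_ hK4
    calc (2 : ℝ) ^ (m + 1) ≤ 2 ^ 2 := pow_le_pow_right₀ (by norm_num) (by omega)
      _ = 4 := by norm_num
  rcases lt_or_ge m 2 with hm | hm
  · exact low hm
  obtain ⟨i, rfl⟩ := Nat.exists_eq_add_of_le' hm
  have hW : ∀ s ∈ Set.Icc 0 T', ∀ a,
      nm (fun x => U s a x - cv (kS φ (i : ℤ)) (U s a) x) ≤ (r⁻¹) ^ i * L := by
    intro s hs a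
    refine nm_high_le hφ (h.sm s ⟨hs.1, hs.2.trans hT⟩ a) i fun n => ?_
    calc _ ≤ ∑ m ∈ Finset.range n, (r⁻¹) ^ i * L * (2⁻¹ : ℝ) ^ (m + 1) := by
          refine Finset.sum_le_sum fun m _ => (hLs s hs a (i + m)).trans ?_
          rw [add_assoc, pow_add, mul_right_comm]
          gcongr
      _ ≤ (r⁻¹) ^ i * L * 1 := by
          rw [← Finset.mul_sum]
          gcongr
          exact (sum_geometric_succ_le (by norm_num) (by norm_num) n).trans (by norm_num)
      _ = _ := mul_one _
  have key := h.nm_lp_le hφ hν hM i a hT hR hW ht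
  have hj : (i : ℤ) + 3 = ((i + 2 + 1 : ℕ) : ℤ) := by push_cast; ring
  rw [hj] at key
  refine key.trans (max_le ((h0 a (i + 2)).trans ?_) ?_)
  · gcongr
    nlinarith
  · rw [zpow_natCast]
    -- Here r^{-i} 2^{-(i+3)} = r³ (2r)^{-(i+3)}, and r ≤ 8 turns r³ into the constant 512.
    calc 72000 * M ^ 4 * R * ((r⁻¹) ^ i * L) / (ν * 2 ^ (i + 2 + 1))
        = ((2 * r)⁻¹) ^ (i + 2 + 1) * (72000 * r ^ 3 * M ^ 4 * R / ν * L) := by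
          have e3 : ((2 * r)⁻¹) ^ 3 = (8 * r ^ 3)⁻¹ := by rw [inv_pow, mul_pow]; norm_num
          rw [hrr, mul_pow, add_assoc, pow_add _ i 3, pow_add _ i 3, e3]
          generalize ((2 * r)⁻¹) ^ i = z
          field_simp
          ring
      _ ≤ ((2 * r)⁻¹) ^ (i + 2 + 1) * (72000 * 8 ^ 3 * M ^ 4 * R / ν * L) := by gcongr
      _ = ((2 * r)⁻¹) ^ (i + 2 + 1) * (72000 * 512 * M ^ 4 * R / ν * L) := by norm_num
      _ ≤ _ := by gcongr

/-- Of the 200 factors K, 99 are paired with factors q, and 101 remain. This is the origin of the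
exponent 101 in the theorem. -/
theorem pow_hundred_split (q K m Y : ℝ) : (q * (K * (K * (m * Y)))) ^ 100 =
    m ^ 100 * K ^ 101 * ((q * K) ^ 99 * (q * Y ^ 100)) := by
  have h : ∀ n : ℕ, (q * (K * (K * (m * Y)))) ^ (n + 1) =
      m ^ (n + 1) * K ^ (n + 2) * ((q * K) ^ n * (q * Y ^ (n + 1))) := fun n => by ring
  exact h 99

/-- Converting 4^{-j} into 8^{-j} costs 2^j, which is at most K below the threshold 2^j = K and
keeps the summability of δ. Above the threshold the 16^{-j} bound leaves 2^{-j} K², whose hundredth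
power is K^101 times a geometric term because 2^{-j} K ≤ 1. -/
theorem exists_interpolation {A K M Y : ℝ} {δ : ℕ → ℝ} (hK : 1 ≤ K) (hM : 0 ≤ M) (hY : 0 ≤ Y)
    (hYA : Y ^ 100 = A) (hδ : ∀ m, 0 ≤ δ m) (hs : ∀ n, ∑ m ∈ Finset.range n, δ m ^ 100 ≤ A) :
    ∃ e : ℕ → ℝ, (∀ m, 0 ≤ e m) ∧
      (∀ n, ∑ m ∈ Finset.range n, e m ^ 100 ≤ (3 * M) ^ 100 * K ^ 101 * (2 * A)) ∧
      ∀ m x, x ≤ 3 * M * ((4 : ℝ)⁻¹) ^ (m + 1) * δ m →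
        x ≤ ((16 : ℝ)⁻¹) ^ (m + 1) * (K * (K * (3 * M * Y))) → x ≤ ((8 : ℝ)⁻¹) ^ (m + 1) * e m := by
  have hK0 : 0 ≤ K := zero_le_one.trans hK
  have hA : 0 ≤ A := hYA ▸ pow_nonneg hY _
  refine ⟨fun m => if (2 : ℝ) ^ (m + 1) ≤ K then 3 * M * K * δ m
    else (2⁻¹ : ℝ) ^ (m + 1) * (K * (K * (3 * M * Y))), fun m => ?_, fun n => ?_, fun m x h4 h16 => ?_⟩
  · have := hδ m
    dsimp only
    split_ifs <;> positivity
  · calc _ ≤ ∑ m ∈ Finset.range n,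
          (3 * M) ^ 100 * K ^ 101 * (δ m ^ 100 + (2⁻¹ : ℝ) ^ (m + 1) * A) := by
          refine Finset.sum_le_sum fun m _ => ?_
          have hd := pow_nonneg (hδ m) 100
          have h2 : 0 ≤ (2⁻¹ : ℝ) ^ (m + 1) * A := by positivity
          have h3M : 0 ≤ (3 * M) ^ 100 := pow_nonneg (mul_nonneg zero_le_three hM) _
          dsimp only
          split_ifs with hc
          · have e1 : (3 * M * K * δ m) ^ 100 = (3 * M) ^ 100 * K ^ 100 * δ m ^ 100 := by
              rw [mul_pow, mul_pow]
            rw [e1]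
            have h3 : K ^ 100 ≤ K ^ 101 := pow_le_pow_right₀ hK (by norm_num)
            refine mul_le_mul (mul_le_mul_of_nonneg_left h3 h3M) (by linarith) hd ?_
            exact mul_nonneg h3M (pow_nonneg hK0 _)
          · have hq : (2⁻¹ : ℝ) ^ (m + 1) * K ≤ 1 := by
              rw [inv_pow, inv_mul_le_iff₀ (by positivity)]
              linarith
            have hq0 : 0 ≤ (2⁻¹ : ℝ) ^ (m + 1) * K := by positivity
            have e1 : ((2⁻¹ : ℝ) ^ (m + 1) * (K * (K * (3 * M * Y)))) ^ 100
                = (3 * M) ^ 100 * K ^ 101 * ((((2⁻¹ : ℝ) ^ (m + 1) * K) ^ 99) *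
                  ((2⁻¹ : ℝ) ^ (m + 1) * A)) := by
              rw [← hYA]
              exact pow_hundred_split _ _ _ _
            rw [e1]
            refine mul_le_mul_of_nonneg_left ?_ (mul_nonneg h3M (pow_nonneg hK0 _))
            have h99 : ((2⁻¹ : ℝ) ^ (m + 1) * K) ^ 99 ≤ 1 := pow_le_one₀ hq0 hq
            nlinarith
      _ = (3 * M) ^ 100 * K ^ 101 *
          (∑ m ∈ Finset.range n, δ m ^ 100 + (∑ m ∈ Finset.range n, (2⁻¹ : ℝ) ^ (m + 1)) * A) := by
          rw [← Finset.mul_sum, Finset.sum_add_distrib, Finset.sum_mul]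
      _ ≤ _ := by
          have h1 := (sum_geometric_succ_le (r := 2⁻¹) (by norm_num) (by norm_num) n).trans
            (by norm_num : (2⁻¹ : ℝ) / (1 - 2⁻¹) ≤ 1)
          refine mul_le_mul_of_nonneg_left ?_
            (mul_nonneg (pow_nonneg (mul_nonneg zero_le_three hM) _) (pow_nonneg hK0 _))
          have := hs n
          nlinarith
  · dsimp only
    split_ifs with hc
    · refine h4.trans ?_
      have e4 : ((4 : ℝ)⁻¹) ^ (m + 1) = (8 : ℝ)⁻¹ ^ (m + 1) * 2 ^ (m + 1) := by
        rw [← mul_pow]; norm_num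
      have := hδ m
      calc _ = (8 : ℝ)⁻¹ ^ (m + 1) * (3 * M * 2 ^ (m + 1) * δ m) := by rw [e4]; ring
        _ ≤ _ := by gcongr
    · refine h16.trans_eq ?_
      have e16 : ((16 : ℝ)⁻¹) ^ (m + 1) = (8 : ℝ)⁻¹ ^ (m + 1) * 2⁻¹ ^ (m + 1) := by
        rw [← mul_pow]; norm_num
      rw [e16]; ring

end Bootstrap

/-! ### The third-order dyadic estimate for classical solutions -/

theorem Classical.dyadicSum_three_le {φ : E3 → ℝ} {M ν T : ℝ} {U : ℝ → Fin 3 → E3 → ℝ}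
    {P : ℝ → E3 → ℝ} (hφ : IsCutoff φ) (hM : KBound φ M) (h : Classical ν T U P) (hν : 0 < ν)
    {u : ℝ → E3 → E3} (hUu : ∀ t ∈ Set.Icc 0 T, ∀ i, U t i =ᵐ[volume] fun x => u t x i)
    {T' A Y y E K : ℝ} (hT : T' ≤ T) (hY : 1 ≤ Y) (hYA : Y ^ 100 = A) (hy : 1 ≤ y)
    (hyY : Y ^ 7 = y ^ 10) (hE0 : 0 ≤ E) (hE : ∑ i, ∫ x, U 0 i x ^ 2 ≤ E ^ 2)
    (h0 : ∀ a, ∀ m : ℕ, nm (lp φ ((m + 1 : ℕ) : ℤ) (U 0 a)) ≤ ((16 : ℝ)⁻¹) ^ (m + 1) * Y)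
    (hs : ∀ t ∈ Set.Icc 0 T', dyadicSum φ 2 100 (u t) ≤ ENNReal.ofReal A)
    (hK : K = 72000 * 512 * 46 * M ^ 6 * (1 + 1 / ν) * (1 + E) * y)
    {t : ℝ} (ht : t ∈ Set.Icc 0 T') :
    dyadicSum φ 3 100 (u t) ≤
      ENNReal.ofReal ((81 * M) ^ 100 * (3 * M) ^ 100 * (K ^ 101 * (2 * A))) := by
  have hM1 := hM.one_le
  have hM0 : 0 < M := zero_lt_one.trans_le hM1
  have hY0 : 0 ≤ Y := zero_le_one.trans hY
  have hA : 0 ≤ A := hYA ▸ pow_nonneg hY0 _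
  have hsub : ∀ s ∈ Set.Icc 0 T', s ∈ Set.Icc 0 T := fun s hs => ⟨hs.1, hs.2.trans hT⟩
  choose δ hδ0 hδs hδ using fun s (hs' : s ∈ Set.Icc 0 T') =>
    exists_nm_lp_le_of_dyadicSum_le hφ hM (h.sm s (hsub s hs')) (hUu s (hsub s hs')) hA (hs s hs')
  have hδY : ∀ s hs' m, δ s hs' m ≤ Y := fun s hs' m => by
    refine le_of_pow_le_pow_left₀ (n := 100) (by norm_num) hY0 ?_
    rw [hYA]
    exact (Finset.single_le_sum (f := fun m => δ s hs' m ^ 100)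
      (fun m _ => pow_nonneg (hδ0 s hs' m) _) (Finset.self_mem_range_succ m)).trans
      (hδs s hs' (m + 1))
  have h4 : ∀ s ∈ Set.Icc 0 T', ∀ a, ∀ m : ℕ, nm (lp φ ((m + 1 : ℕ) : ℤ) (U s a)) ≤
      3 * M * ((4 : ℝ)⁻¹) ^ (m + 1) * Y := fun s hs' a m =>
    (hδ s hs' m a).trans (mul_le_mul_of_nonneg_left (hδY s hs' m) (by positivity))
  set R := 46 * M ^ 2 * (1 + E) * y with hR
  have hEs : ∀ s ∈ Set.Icc 0 T', ∀ a, ∫ x, U s a x ^ 2 ≤ E ^ 2 := fun s hs' a =>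
    (Finset.single_le_sum (f := fun a => ∫ x, U s a x ^ 2)
      (fun a _ => integral_nonneg fun x => sq_nonneg _) (Finset.mem_univ a)).trans
      ((h.energy hν.le (hsub s hs')).trans hE)
  have hRb : ∀ s ∈ Set.Icc 0 T', ∀ a x, |U s a x| ≤ R := fun s hs' a x =>
    abs_le_of_nm_lp_le hφ hM (h.sm s (hsub s hs') a) hE0 (hEs s hs' a) hY0 hy hyY (h4 s hs' a) x
  have hR0 : 0 ≤ R := by positivity
  have hν1 : 1 ≤ 1 + 1 / ν := le_add_of_nonneg_right (by positivity)
  -- `K` is the constant of `Classical.gain_one` with 1/ν replaced by 1 + 1/ν, which also keeps K ≥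
  -- 4 when ν is large.
  have hKR : K = 72000 * 512 * M ^ 4 * R * (1 + 1 / ν) := by rw [hK, hR]; ring
  have hR1 : 46 ≤ R := by
    have e1 : 1 ≤ M ^ 2 := one_le_pow₀ hM1
    have e2 : 1 ≤ M ^ 2 * ((1 + E) * y) :=
      one_le_mul_of_one_le_of_one_le e1 (one_le_mul_of_one_le_of_one_le (by linarith) hy)
    calc (46 : ℝ) ≤ 46 * (M ^ 2 * ((1 + E) * y)) := le_mul_of_one_le_right (by norm_num) e2
      _ = R := by rw [hR]; ring
  have hK4 : 4 ≤ K := by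
    have e1 : 1 ≤ M ^ 4 := one_le_pow₀ hM1
    calc (4 : ℝ) ≤ 72000 * 512 * 1 * 46 * 1 := by norm_num
      _ ≤ 72000 * 512 * M ^ 4 * R * (1 + 1 / ν) := by gcongr
      _ = K := hKR.symm
  have hKν : 72000 * 512 * M ^ 4 * R / ν ≤ K := by
    rw [hKR, div_eq_mul_one_div]
    gcongr
    linarith
  have h3M : 1 ≤ 3 * M := by linarith
  have hMY : Y ≤ 3 * M * Y := le_mul_of_one_le_left hY0 h3M
  -- First pass, from 4^{-j} to 8^{-j}, at all times up to T', since the second pass needs it at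
  -- every earlier time.
  have pass1 : ∀ s ∈ Set.Icc 0 T', ∀ a, ∀ m : ℕ, nm (lp φ ((m + 1 : ℕ) : ℤ) (U s a)) ≤
      ((8 : ℝ)⁻¹) ^ (m + 1) * (K * (3 * M * Y)) := fun s hs' a m => by
    have := h.gain_one hφ hM hν (r := 4) (L := 3 * M * Y) hT (by norm_num) (by norm_num)
      (by positivity) hK4 hKν hR0 hRb
      (fun s hs' a m => (h4 s hs' a m).trans_eq (by ring))
      (fun a m => (h0 a m).trans (by gcongr; norm_num)) hs' a m
    norm_num at this ⊢
    exact this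
  -- Second pass, from 8^{-j} to 16^{-j}; this one is needed only at the final time.
  have pass2 : ∀ a, ∀ m : ℕ, nm (lp φ ((m + 1 : ℕ) : ℤ) (U t a)) ≤
      ((16 : ℝ)⁻¹) ^ (m + 1) * (K * (K * (3 * M * Y))) := fun a m => by
    have := h.gain_one hφ hM hν (r := 8) (L := K * (3 * M * Y)) hT (by norm_num) (by norm_num)
      (by positivity) hK4 hKν hR0 hRb pass1
      (fun a m => (h0 a m).trans (by
        have : Y ≤ K * (3 * M * Y) :=
          hMY.trans (le_mul_of_one_le_left (by positivity) (by linarith))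
        gcongr; norm_num)) ht a m
    norm_num at this ⊢
    exact this
  obtain ⟨e, he0, hes, he⟩ := exists_interpolation (K := K) (M := M) (by linarith) hM0.le hY0 hYA
    (hδ0 t ht) (hδs t ht)
  have := dyadicSum_le_of_nm_lp_le hφ hM (h.sm t (hsub t ht)) (hUu t (hsub t ht)) he0 hes
    fun m i => he m _ (hδ t ht m i) (pass2 i m)
  simpa only [mul_assoc] using this

/-! ### Exponents, size of the data and bookkeeping of constants -/

theorem powB_hundred (B : ℝ) : powB B 100 = 100 * B + 110 := by
  have : √((100 : ℕ) : ℝ) = 10 := by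
    rw [show ((100 : ℕ) : ℝ) = 10 ^ 2 by norm_num]
    exact Real.sqrt_sq (by norm_num)
  unfold powB
  rw [this]
  push_cast
  ring

/-- y^101 = A^{707/1000} ≤ A^{255/347} because A ≥ 1. The exponent 255/347 is that of the statement,
and the additive 110 in `powB` contributes only a universal factor. -/
theorem rpow_absorb_le {𝓑 B A y : ℝ} (hb : 1 ≤ 𝓑) (hB : 0 ≤ B)
    (hA : A = 𝓑 * (2 : ℝ) ^ powB B 100) (hy : y = A ^ (7 / 1000 : ℝ)) :
    y ^ 101 * A ≤ (2 : ℝ) ^ (110 * (255 / 347) : ℝ) *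
      (𝓑 ^ ((1 : ℝ) + (5 * (100 + 2) / 2) / ((2 + 3 / 2) * 100 - 3))
        * (2 : ℝ) ^ ((5 * (100 + 2) * B / 2) / (2 + 3 / 2 - 3 / 100))
        * (2 : ℝ) ^ (powB B 100)) := by
  have hb0 : 0 < 𝓑 := by linarith
  have h2p : (1 : ℝ) ≤ (2 : ℝ) ^ powB B 100 :=
    Real.one_le_rpow (by norm_num) (by rw [powB_hundred]; linarith)
  have hA1 : 1 ≤ A := hA ▸ one_le_mul_of_one_le_of_one_le hb h2p
  have e1 : y ^ 101 ≤ A ^ (255 / 347 : ℝ) := by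
    rw [hy, ← Real.rpow_natCast, ← Real.rpow_mul (by linarith)]
    exact Real.rpow_le_rpow_of_exponent_le hA1 (by norm_num)
  have e2 : A ^ (255 / 347 : ℝ) = 𝓑 ^ (255 / 347 : ℝ) *
      ((2 : ℝ) ^ (110 * (255 / 347) : ℝ) *
        (2 : ℝ) ^ ((5 * (100 + 2) * B / 2) / (2 + 3 / 2 - 3 / 100))) := by
    rw [hA, Real.mul_rpow hb0.le (by positivity), ← Real.rpow_mul (by norm_num),
      ← Real.rpow_add (by norm_num), powB_hundred]
    congr 2
    ring
  have e3 : 𝓑 ^ ((1 : ℝ) + (5 * (100 + 2) / 2) / ((2 + 3 / 2) * 100 - 3))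
      = 𝓑 * 𝓑 ^ (255 / 347 : ℝ) := by
    rw [Real.rpow_add hb0, Real.rpow_one]
    norm_num
  calc y ^ 101 * A ≤ A ^ (255 / 347 : ℝ) * A := by gcongr
    _ = _ := by
        rw [e2, e3]
        conv_lhs => rw [hA]
        ring

theorem integral_sq_sum_le {u₀ : E3 → E3} (hu : AEStronglyMeasurable u₀ volume)
    (hi : ∀ i, Integrable fun x => u₀ x i ^ 2) :
    ∑ i, ∫ x, u₀ x i ^ 2 ≤ (eLpNorm u₀ 2 volume).toReal ^ 2 := by
  rw [toReal_eLpNorm hu, lpNorm_eq_integral_norm_rpow_toReal (by norm_num) (by norm_num) hu]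
  simp only [ENNReal.toReal_ofNat, Real.rpow_ofNat, EuclideanSpace.norm_sq_eq, Real.norm_eq_abs,
    sq_abs]
  rw [← Real.rpow_natCast, ← Real.rpow_mul (integral_nonneg fun _ =>
    Finset.sum_nonneg fun _ _ => sq_nonneg _), integral_finsetSum _ fun i _ => hi i]
  norm_num

/-- The size of the initial data in the norm that controls four derivatives. -/
def dataSize (M : ℝ) (u₀ : E3 → E3) : ℝ :=
  M ^ 3 * ∑ i, ∑ a, ∑ b, nm (pd b (pd b (pd a (pd a fun x => u₀ x i))))

theorem dataSize_nonneg {M : ℝ} (hM : 0 ≤ M) (u₀ : E3 → E3) : 0 ≤ dataSize M u₀ :=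
  mul_nonneg (pow_nonneg hM _) (Finset.sum_nonneg fun _ _ => Finset.sum_nonneg fun _ _ =>
    Finset.sum_nonneg fun _ _ => nm_nonneg _)

theorem nm_lp_le_dataSize {φ : E3 → ℝ} {M : ℝ} (hφ : IsCutoff φ) (hM : KBound φ M) {u₀ : E3 → E3}
    (h : ∀ i, Sm fun x => u₀ x i) (i : Fin 3) (m : ℕ) :
    nm (lp φ ((m + 1 : ℕ) : ℤ) fun x => u₀ x i) ≤ ((16 : ℝ)⁻¹) ^ (m + 1) * dataSize M u₀ := by
  have hM0 : 0 ≤ M := zero_le_one.trans hM.one_le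
  refine (nm_lp_le_bilaplacian hφ hM (h i) m).trans ?_
  unfold dataSize
  refine mul_le_mul_of_nonneg_left (mul_le_mul_of_nonneg_left ?_ (by positivity)) (by positivity)
  exact Finset.single_le_sum
    (f := fun i => ∑ a, ∑ b, nm (pd b (pd b (pd a (pd a fun x => u₀ x i)))))
    (fun _ _ => Finset.sum_nonneg fun _ _ => Finset.sum_nonneg fun _ _ => nm_nonneg _)
    (Finset.mem_univ i)

theorem le_two_rpow {x : ℝ} : x ≤ (2 : ℝ) ^ x := by
  rcases le_or_gt x 0 with h | h
  · exact h.trans (Real.rpow_nonneg (by norm_num) _)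
  · have h1 : x < ⌊x⌋₊ + 1 := Nat.lt_floor_add_one x
    have h2 : ((⌊x⌋₊ + 1 : ℕ) : ℝ) ≤ ((2 ^ ⌊x⌋₊ : ℕ) : ℝ) := by
      exact_mod_cast Nat.lt_two_pow_self
    have h3 : (2 : ℝ) ^ (⌊x⌋₊ : ℝ) ≤ (2 : ℝ) ^ x :=
      Real.rpow_le_rpow_of_exponent_le (by norm_num) (Nat.floor_le h.le)
    rw [Real.rpow_natCast] at h3
    push_cast at h2
    linarith

/-- All slack is spent here: the power 101 of `F` is raised to 202, and the factor `τ`, which will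
be 1 + T, is inserted for free. -/
theorem mul_bound_le {c m K N F A Q D : ℝ} {y τ : ℝ} (hc : 0 ≤ c) (hm : 0 ≤ m) (hN : 0 ≤ N)
    (hF : 1 ≤ F) (hτ : 1 ≤ τ) (hK : K = c * N * F * y) (hQ0 : 0 ≤ Q) (hD : 0 ≤ D)
    (hQ : y ^ 101 * A ≤ D * Q) :
    m * (K ^ 101 * (2 * A)) ≤ (m * c ^ 101 * 2 * D) * N ^ 101 * τ * F ^ 202 * Q := by
  have hF0 : 0 ≤ F := zero_le_one.trans hF
  have h1 : F ^ 101 ≤ F ^ 202 := pow_le_pow_right₀ hF (by norm_num)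
  have hc' : 0 ≤ c ^ 101 := pow_nonneg hc _
  have hN' : 0 ≤ N ^ 101 := pow_nonneg hN _
  have hF' : 0 ≤ F ^ 101 := pow_nonneg hF0 _
  have hF2 : 0 ≤ F ^ 202 := pow_nonneg hF0 _
  have e : K ^ 101 = c ^ 101 * N ^ 101 * F ^ 101 * y ^ 101 := by rw [hK]; simp only [mul_pow]
  rw [e]
  generalize c ^ 101 = c' at *
  generalize N ^ 101 = N' at *
  generalize F ^ 101 = F' at *
  generalize F ^ 202 = F2 at *
  generalize y ^ 101 = y' at *
  calc m * (c' * N' * F' * y' * (2 * A)) = m * c' * 2 * N' * F' * (y' * A) := by ring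
    _ ≤ m * c' * 2 * N' * F' * (D * Q) := by gcongr
    _ ≤ m * c' * 2 * N' * F2 * (D * Q) := by gcongr
    _ = m * c' * 2 * D * N' * 1 * F2 * Q := by ring
    _ ≤ _ := by gcongr

end

end NSReg

/-! ### Assembly of the theorem -/

theorem theorem7p1 (φ : NSReg.E3 → ℝ) (hφ : NSReg.IsCutoff φ) :
    ∃ C : ℝ, 0 < C ∧
      ∀ u₀ : 𝓢(NSReg.E3, NSReg.E3), ∃ B₂ : ℝ, 1 < B₂ ∧
        ∀ (ν T T' 𝓑 B : ℝ) (u : ℝ → NSReg.E3 → NSReg.E3) (p : ℝ → NSReg.E3 → ℝ),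
          0 < ν → 0 < T → 0 ≤ T' → T' ≤ T → 1 < 𝓑 → 1 < B →
          NSReg.IsRegularSolution ν T u₀ u p →
          B₂ ≤ B →
          (∀ t ∈ Set.Icc 0 T',
            NSReg.dyadicSum φ 2 100 (u t) ≤
              ENNReal.ofReal (𝓑 * (2 : ℝ) ^ (NSReg.powB B 100))) →
          ∀ t ∈ Set.Icc 0 T',
            NSReg.dyadicSum φ (2 + 1) 100 (u t) ≤
              ENNReal.ofReal
                (C * (1 + 1 / ν) ^ (100 + 1) * (1 + T)
                  * (1 + (eLpNorm u₀ 2 volume).toReal) ^ (2 * 100 + 2)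
                  * 𝓑 ^ ((1 : ℝ) + (5 * (100 + 2) / 2) / ((2 + 3 / 2) * 100 - 3))
                  * (2 : ℝ) ^ ((5 * (100 + 2) * B / 2) / (2 + 3 / 2 - 3 / 100))
                  * (2 : ℝ) ^ (NSReg.powB B 100)) := by
  obtain ⟨M, hM⟩ := NSReg.exists_kBound hφ
  have hM0 : 0 < M := zero_lt_one.trans_le hM.one_le
  have hm : 0 < (81 * M) ^ 100 * (3 * M) ^ 100 :=
    mul_pos (pow_pos (by linarith) _) (pow_pos (by linarith) _)
  have hc : 0 < 72000 * 512 * 46 * M ^ 6 := by positivity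
  have hD : 0 < (2 : ℝ) ^ (110 * (255 / 347) : ℝ) := Real.rpow_pos_of_pos two_pos _
  -- The constant is assembled from the conversions between dyadic sums and band norms, the
  -- numerical part of K^101, the factor 2 from summation, and the universal power of 2. The
  -- threshold for `B` depends on four derivatives of the data.
  refine ⟨(81 * M) ^ 100 * (3 * M) ^ 100 * (72000 * 512 * 46 * M ^ 6) ^ 101 * 2 *
    (2 : ℝ) ^ (110 * (255 / 347) : ℝ), mul_pos (mul_pos (mul_pos hm (pow_pos hc _)) two_pos) hD,
    fun u₀ => ⟨2 + NSReg.dataSize M u₀, by linarith [NSReg.dataSize_nonneg hM0.le u₀], ?_⟩⟩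
  intro ν T T' 𝓑 B u p hν hT hT' hTT hb hB hsol hB2 hs t ht
  obtain ⟨U, P, hcl, hUu⟩ := hsol.exists_classical
  have h0T : (0 : ℝ) ∈ Set.Icc 0 T := ⟨le_rfl, hT.le⟩
  -- Both sides are continuous, so the initial condition, given almost everywhere, holds at every
  -- point.
  have hinit : ∀ i, U 0 i = fun x => u₀ x i := fun i => by
    obtain ⟨_, _, _, _, _, hu0⟩ := hsol
    have hc1 : Continuous fun x => u₀ x i :=
      (EuclideanSpace.proj i : NSReg.E3 →L[ℝ] ℝ).continuous.comp u₀.continuous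
    refine ((hcl.sm 0 h0T i).cont.ae_eq_iff_eq volume hc1).1 ?_
    filter_upwards [hUu 0 h0T i, hu0] with x h1 h2
    rw [h1, h2]
  have hsm0 : ∀ i, NSReg.Sm fun x => u₀ x i := fun i => hinit i ▸ hcl.sm 0 h0T i
  set A := 𝓑 * (2 : ℝ) ^ NSReg.powB B 100 with hA
  have h2B : (2 : ℝ) ^ (100 * B) ≤ A := by
    have h1 : (2 : ℝ) ^ (100 * B) ≤ (2 : ℝ) ^ NSReg.powB B 100 :=
      Real.rpow_le_rpow_of_exponent_le (by norm_num) (by rw [NSReg.powB_hundred]; linarith)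
    exact h1.trans (le_mul_of_one_le_left (by positivity) hb.le)
  have hA1 : 1 ≤ A := (Real.one_le_rpow (by norm_num) (by linarith)).trans h2B
  have hA0 : 0 ≤ A := zero_le_one.trans hA1
  -- `Y` bounds each single δ_m, and `y` = Y^{7/10} is the power left by the interpolation of the
  -- sup norm.
  set Y := A ^ (1 / 100 : ℝ) with hY
  set y := A ^ (7 / 1000 : ℝ) with hy
  set E := (eLpNorm u₀ 2 volume).toReal with hE
  have hE0 : 0 ≤ E := ENNReal.toReal_nonneg
  have hYA : Y ^ 100 = A := by
    rw [hY, ← Real.rpow_natCast, ← Real.rpow_mul hA0]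
    norm_num
  have hyY : Y ^ 7 = y ^ 10 := by
    rw [hY, hy, ← Real.rpow_natCast, ← Real.rpow_natCast, ← Real.rpow_mul hA0,
      ← Real.rpow_mul hA0]
    norm_num
  have hBY : (2 : ℝ) ^ B ≤ Y := by
    have := Real.rpow_le_rpow (by positivity) h2B (by norm_num : (0 : ℝ) ≤ 1 / 100)
    rwa [← Real.rpow_mul (by norm_num), mul_one_div, mul_div_cancel_left₀ _ (by norm_num)] at this
  -- The only use of the threshold: the data size is at most B ≤ 2^B ≤ Y.
  have hdY : NSReg.dataSize M u₀ ≤ Y := by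
    have := NSReg.le_two_rpow (x := B)
    linarith
  have key := hcl.dyadicSum_three_le hφ hM hν hUu hTT (Real.one_le_rpow hA1 (by norm_num)) hYA
    (Real.one_le_rpow hA1 (by norm_num)) hyY hE0
    (by
      simp only [hinit]
      exact NSReg.integral_sq_sum_le u₀.continuous.aestronglyMeasurable fun i =>
        (hsm0 i).integrable_pow le_rfl)
    (fun a m => by
      rw [hinit a]
      exact (NSReg.nm_lp_le_dataSize hφ hM hsm0 a m).trans
        (mul_le_mul_of_nonneg_left hdY (by positivity))) hs rfl ht
  refine key.trans (ENNReal.ofReal_le_ofReal ?_)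
  have habs := NSReg.rpow_absorb_le hb.le (by linarith) hA hy
  have hfin := NSReg.mul_bound_le (τ := 1 + T) hc.le hm.le (by positivity : 0 ≤ 1 + 1 / ν)
    (by linarith : 1 ≤ 1 + E) (by linarith) rfl (by positivity) hD.le habs
  refine hfin.trans_eq ?_
  simp only [mul_assoc]
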